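/- Let $n,p,q$ be integers with $1\le p<n/2$ and $q\ge 0$, and put $m=\lfloor n/2\rfloor$. Let $H^q$ be the space of complex-valued harmonic polynomials on $\mathbf{R}^n$ that are homogeneous of degree $q$, and let $\Lambda^p$ be the $p$-th exterior power of $\mathbf{R}^n\otimes\mathbf{C}$, so that $H^q\otimes\Lambda^p$ is a representation of $\mathfrak{so}(n)\simeq\mathfrak{spin}(n)$. With $e_i$ the standard basis and $i(e_i)$ the interior product, let $$d=\sum_i e_i\wedge\frac{\partial}{\partial x_i},\quad d^*=-\sum_i i(e_i)\frac{\partial}{\partial x_i},\quad x_\wedge=\sum_i x_i\,e_i\wedge,\quad i(x)=\sum_i x_i\,i(e_i),\quad E=i(x)\,d-x_\wedge\,d^*.$$ Write $k_j$ for a string of $j$ entries $k$, and consider the weights of length $m$ $$\mu_0=(q+1,1_{p-1},0_{m-p}),\quad \mu_1=(q,1_p,0_{m-p-1}),\quad \mu_2=(q,1_{p-2},0_{m-p+1})\ \ (p\ge 2),\quad \mu_3=(q-1,1_{p-1},0_{m-p}),$$ where $\mu_1$ is read as $(q,1_{m-1})$ if $p=m$. If $n=2m$ and $p=m-1$, consider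 also $\mu_1'=(q,1_{m-2},-1)$. For a weight $\mu$ let $V_\mu$ be the sum of all irreducible subrepresentations of $H^q\otimes\Lambda^p$ with highest weight $\mu$. Then $H^q\otimes\Lambda^p$ is the direct sum of the $V_\mu$, where $\mu$ runs over $\mu_0$; over $\mu_1$ if $q\ge1$; over $\mu_1'$ if $q\ge1$, $n=2m$ and $p=m-1$; over $\mu_2$ if $q\ge1$ and $p\ge2$; and over $\mu_3$ if $q\ge2$ or $p=q=1$. Each of these $V_\mu$ is irreducible with highest weight $\mu$. The operator $E$ acts on them as the scalar $$E=\begin{cases}0&\text{on }V_{\mu_0},\\ q+p&\text{on }V_{\mu_1}\ (\text{and on }V_{\mu_1'}\text{ if }n=2m,\ p=m-1),\\ n+q-p&\text{on }V_{\mu_2},\\ n+2q-2&\text{on }V_{\mu_3}.\end{cases}$$ In particular $V_{\mu_0}=\ker d\cap\ker d^*$, the kernels being taken in $H^q\otimes\Lambda^p$. -/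

import Mathlib

open scoped TensorProduct

noncomputable section

namespace PFormHarmonic

/-! ### The spaces -/

/-- Complex-valued polynomials on `ℝⁿ`. -/
abbrev Poly (n : ℕ) := MvPolynomial (Fin n) ℂ

/-- The full (complexified) exterior algebra of `ℝⁿ`. -/
abbrev Ext (n : ℕ) := ExteriorAlgebra ℂ (Fin n → ℂ)

/-- Polynomial differential forms on `ℝⁿ`. -/
abbrev FormPoly (n : ℕ) := Poly n ⊗[ℂ] Ext n

/-- The Laplacian `□ = - ∑ ∂²/∂xᵢ²`. -/
def laplacian (n : ℕ) : Poly n →ₗ[ℂ] Poly n :=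
  -∑ i : Fin n, (MvPolynomial.pderiv i).toLinearMap ∘ₗ (MvPolynomial.pderiv i).toLinearMap

/-- `H^q`: harmonic polynomials, homogeneous of degree `q`. -/
def harmonic (n q : ℕ) : Submodule ℂ (Poly n) :=
  MvPolynomial.homogeneousSubmodule (Fin n) ℂ q ⊓ LinearMap.ker (laplacian n)

/-- `H^q ⊗ Λ^p`, as a subspace of the polynomial differential forms. -/
def harmonicForms (n q p : ℕ) : Submodule ℂ (FormPoly n) :=
  LinearMap.range (TensorProduct.mapIncl (harmonic n q) (⋀[ℂ]^p (Fin n → ℂ)))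

/-! ### The operators -/

/-- Multiplication by `xᵢ`. -/
def mulX {n : ℕ} (i : Fin n) : Poly n →ₗ[ℂ] Poly n :=
  LinearMap.mulLeft ℂ (MvPolynomial.X i)

/-- `∂/∂xᵢ`. -/
def partialX {n : ℕ} (i : Fin n) : Poly n →ₗ[ℂ] Poly n :=
  (MvPolynomial.pderiv i).toLinearMap

/-- Exterior multiplication by `eᵢ`. -/
def wedgeE {n : ℕ} (i : Fin n) : Ext n →ₗ[ℂ] Ext n :=
  LinearMap.mulLeft ℂ (ExteriorAlgebra.ι ℂ (Pi.single i (1 : ℂ) : Fin n → ℂ))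

/-- Interior product `i(eᵢ)`. -/
def interE {n : ℕ} (i : Fin n) : Ext n →ₗ[ℂ] Ext n :=
  CliffordAlgebra.contractLeft (Q := (0 : QuadraticForm ℂ (Fin n → ℂ)))
    (LinearMap.proj i : Module.Dual ℂ (Fin n → ℂ))

/-- The exterior derivative `d = ∑ eᵢ ∧ ∂/∂xᵢ`. -/
def extD (n : ℕ) : FormPoly n →ₗ[ℂ] FormPoly n :=
  ∑ i : Fin n, TensorProduct.map (partialX i) (wedgeE i)

/-- The codifferential `d^* = - ∑ i(eᵢ) ∂/∂xᵢ`. -/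
def coD (n : ℕ) : FormPoly n →ₗ[ℂ] FormPoly n :=
  -∑ i : Fin n, TensorProduct.map (partialX i) (interE i)

/-- `x_∧ = ∑ xᵢ eᵢ ∧`. -/
def wedgeX (n : ℕ) : FormPoly n →ₗ[ℂ] FormPoly n :=
  ∑ i : Fin n, TensorProduct.map (mulX i) (wedgeE i)

/-- `i(x) = ∑ xᵢ i(eᵢ)`. -/
def interX (n : ℕ) : FormPoly n →ₗ[ℂ] FormPoly n :=
  ∑ i : Fin n, TensorProduct.map (mulX i) (interE i)

/-- `E = i(x) d - x_∧ d^*`. -/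
def opE (n : ℕ) : FormPoly n →ₗ[ℂ] FormPoly n :=
  interX n ∘ₗ extD n - wedgeX n ∘ₗ coD n

/-! ### The representations of `𝔰𝔬(n)` -/

/-- The complexified Lie algebra `𝔰𝔬(n) ≃ 𝔰𝔭𝔦𝔫(n)`: complex skew-symmetric matrices. -/
abbrev soC (n : ℕ) := LieAlgebra.Orthogonal.so (Fin n) ℂ

section Representations

attribute [local instance] LieRing.ofAssociativeRing

/-- Operators satisfying the commutation relations of the matrix units `E i j` define a
representation of the matrix Lie algebra, `A ↦ ∑ A i j • T i j`. -/
def matrixRep {n : ℕ} {V : Type*} [AddCommGroup V] [Module ℂ V]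
    (T : Fin n → Fin n → Module.End ℂ V)
    (hT : ∀ i j k l, ⁅T i j, T k l⁆ =
      (if j = k then T i l else 0) - (if l = i then T k j else 0)) :
    Matrix (Fin n) (Fin n) ℂ →ₗ⁅ℂ⁆ Module.End ℂ V where
  toFun A := ∑ i, ∑ j, A i j • T i j
  map_add' A B := by simp [add_smul, Finset.sum_add_distrib]
  map_smul' c A := by simp [Finset.smul_sum, smul_smul]
  map_lie' := by
    intro A B
    have h1 : ∀ i j k l, ⁅A i j • T i j, B k l • T k l⁆ =
        (if j = k then (A i j * B k l) • T i l else 0) -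
          (if l = i then (A i j * B k l) • T k j else 0) := by
      intro i j k l
      rw [smul_lie, lie_smul, hT, smul_smul, smul_sub, smul_ite, smul_ite, smul_zero]
    have h2 : ∀ i j k, ∑ l, ⁅A i j • T i j, B k l • T k l⁆ =
        (if j = k then ∑ l, (A i j * B k l) • T i l else 0) - (A i j * B k i) • T k j := by
      intro i j k
      simp only [h1, Finset.sum_sub_distrib, Finset.sum_ite_eq', Finset.mem_univ, if_true]
      split_ifs <;> simp
    have h3 : ⁅∑ i, ∑ j, A i j • T i j, ∑ k, ∑ l, B k l • T k l⁆ =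
        ∑ i, ∑ j, ∑ k, ∑ l, ⁅A i j • T i j, B k l • T k l⁆ := by
      refine (sum_lie _ _ _).trans (Finset.sum_congr rfl fun i _ => ?_)
      refine (sum_lie _ _ _).trans (Finset.sum_congr rfl fun j _ => ?_)
      refine (lie_sum _ _ _).trans (Finset.sum_congr rfl fun k _ => ?_)
      exact lie_sum _ _ _
    rw [h3]
    simp only [h2]
    simp only [Finset.sum_sub_distrib, Finset.sum_ite_eq, Finset.mem_univ, if_true,
      LieRing.of_associative_ring_bracket, Matrix.sub_apply, Matrix.mul_apply, sub_smul,
      Finset.sum_smul]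
    congr 1
    · exact Finset.sum_congr rfl fun i _ => Finset.sum_comm
    · calc ∑ i, ∑ j, ∑ k, (B i k * A k j) • T i j
          = ∑ i, ∑ k, ∑ j, (B i k * A k j) • T i j :=
            Finset.sum_congr rfl fun i _ => Finset.sum_comm
        _ = ∑ k, ∑ i, ∑ j, (B i k * A k j) • T i j := Finset.sum_comm
        _ = ∑ k, ∑ j, ∑ i, (B i k * A k j) • T i j :=
            Finset.sum_congr rfl fun k _ => Finset.sum_comm
        _ = _ := by simp only [mul_comm]

/-- `xᵢ ∂/∂xⱼ` satisfy the relations of the matrix units. -/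
theorem poly_comm {n : ℕ} (i j k l : Fin n) :
    ⁅(mulX i ∘ₗ partialX j : Module.End ℂ (Poly n)), mulX k ∘ₗ partialX l⁆ =
      (if j = k then mulX i ∘ₗ partialX l else 0) -
        (if l = i then mulX k ∘ₗ partialX j else 0) := by
  have h : ∀ (a b : Fin n) (f : Poly n), MvPolynomial.pderiv a (MvPolynomial.X b * f) =
      (if a = b then f else 0) + MvPolynomial.X b * MvPolynomial.pderiv a f := by
    intro a b f
    rw [Derivation.leibniz, smul_eq_mul, smul_eq_mul, MvPolynomial.pderiv_X, Pi.single_apply]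
    by_cases hab : a = b
    · simp [hab, add_comm]
    · simp [hab, Ne.symm hab]
  have hc : ∀ f : Poly n, MvPolynomial.pderiv j (MvPolynomial.pderiv l f) =
      MvPolynomial.pderiv l (MvPolynomial.pderiv j f) := by
    intro f
    have : ⁅(MvPolynomial.pderiv j : Derivation ℂ (Poly n) (Poly n)),
        (MvPolynomial.pderiv l : Derivation ℂ (Poly n) (Poly n))⁆ = 0 := by
      ext a
      simp [Derivation.commutator_apply, MvPolynomial.pderiv_X, Pi.single_apply, apply_ite]
    have h2 := congrArg (fun D : Derivation ℂ (Poly n) (Poly n) => D f) this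
    simpa [Derivation.commutator_apply, sub_eq_zero] using h2
  refine LinearMap.ext fun f => ?_
  simp only [LieRing.of_associative_ring_bracket, LinearMap.sub_apply, Module.End.mul_apply,
    LinearMap.comp_apply, mulX, partialX, LinearMap.mulLeft_apply, Derivation.coeFn_coe,
    h, hc]
  split_ifs <;> simp <;> ring

/-- `eᵢ ∧ i(eⱼ)` satisfy the relations of the matrix units. -/
theorem ext_comm {n : ℕ} (i j k l : Fin n) :
    ⁅(wedgeE i ∘ₗ interE j : Module.End ℂ (Ext n)), wedgeE k ∘ₗ interE l⁆ =
      (if j = k then wedgeE i ∘ₗ interE l else 0) -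
        (if l = i then wedgeE k ∘ₗ interE j else 0) := by
  have h : ∀ (a b : Fin n) (x : Ext n), interE a (wedgeE b x) =
      (if a = b then x else 0) - wedgeE b (interE a x) := by
    intro a b x
    refine (CliffordAlgebra.contractLeft_ι_mul _ _ _).trans ?_
    congr 1
    simp [Pi.single_apply]
  have hi : ∀ x : Ext n, interE j (interE l x) = -interE l (interE j x) := fun x =>
    CliffordAlgebra.contractLeft_comm _ _ _
  have hw : ∀ x : Ext n, wedgeE i (wedgeE k x) = -wedgeE k (wedgeE i x) := by
    intro x
    simp only [wedgeE, LinearMap.mulLeft_apply, ← mul_assoc]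
    rw [← neg_mul, eq_neg_of_add_eq_zero_left (ExteriorAlgebra.ι_add_mul_swap _ _)]
  refine LinearMap.ext fun x => ?_
  simp only [LieRing.of_associative_ring_bracket, LinearMap.sub_apply, Module.End.mul_apply,
    LinearMap.comp_apply, h, map_sub, hi, hw, map_neg, neg_neg]
  split_ifs <;> (simp; try abel)

/-- The representation of `𝔰𝔬(n)` on polynomials: `A` acts by `∑ Aᵢⱼ xᵢ ∂/∂xⱼ`. In particular
`E_{lk} - E_{kl}` acts by `- x_k ∂/∂x_l + x_l ∂/∂x_k`. -/
def polyRep (n : ℕ) : soC n →ₗ⁅ℂ⁆ Module.End ℂ (Poly n) :=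
  (matrixRep (fun i j => mulX i ∘ₗ partialX j) poly_comm).comp (soC n).incl

/-- The representation of `𝔰𝔬(n)` on the exterior algebra, `A` acting by
`∑ Aᵢⱼ eᵢ ∧ i(eⱼ)`, i.e. by the derivation that extends `v ↦ A v`. -/
def extRep (n : ℕ) : soC n →ₗ⁅ℂ⁆ Module.End ℂ (Ext n) :=
  (matrixRep (fun i j => wedgeE i ∘ₗ interE j) ext_comm).comp (soC n).incl

instance instLieRingModulePoly (n : ℕ) : LieRingModule (soC n) (Poly n) :=
  LieRingModule.compLieHom (Poly n) (polyRep n)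

instance instLieModulePoly (n : ℕ) : LieModule ℂ (soC n) (Poly n) :=
  LieModule.compLieHom (Poly n) (polyRep n)

instance instLieRingModuleExt (n : ℕ) : LieRingModule (soC n) (Ext n) :=
  LieRingModule.compLieHom (Ext n) (extRep n)

instance instLieModuleExt (n : ℕ) : LieModule ℂ (soC n) (Ext n) :=
  LieModule.compLieHom (Ext n) (extRep n)

end Representations

/-! ### Highest weights

`m = ⌊n/2⌋` is the rank; weights are `μ : Fin m → ℤ`, and the isotropic vectors
`z_j = e_{2j} + i e_{2j+1}`, `z̄_j = e_{2j} - i e_{2j+1}` (indices from `0`) together with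
`e_{n-1}` when `n` is odd are a weight basis of `ℂⁿ`, of weights `ε_j`, `-ε_j` and `0`. -/

/-- The element `u ∧ v : w ↦ ⟨v, w⟩ u - ⟨u, w⟩ v` of `𝔰𝔬(n)`. -/
def skew {n : ℕ} (u v : Fin n → ℂ) : soC n :=
  ⟨Matrix.vecMulVec u v - Matrix.vecMulVec v u, by
    rw [LieAlgebra.Orthogonal.mem_so]
    simp [Matrix.transpose_sub, Matrix.transpose_vecMulVec]⟩

def zvec {n : ℕ} (j : Fin (n / 2)) : Fin n → ℂ :=
  Pi.single ⟨2 * j, by omega⟩ 1 + Complex.I • Pi.single ⟨2 * j + 1, by omega⟩ 1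

def zbar {n : ℕ} (j : Fin (n / 2)) : Fin n → ℂ :=
  Pi.single ⟨2 * j, by omega⟩ 1 - Complex.I • Pi.single ⟨2 * j + 1, by omega⟩ 1

/-- The standard basis `H_j = ½ z_j ∧ z̄_j` of the Cartan subalgebra; `H_j z_k = δ_{jk} z_k`. -/
def cartan {n : ℕ} (j : Fin (n / 2)) : soC n :=
  (1 / 2 : ℂ) • skew (zvec j) (zbar j)

/-- `v` is a highest weight vector of weight `μ`: it is a nonzero weight vector that is killed by
the root vectors of the positive roots `ε_j - ε_k`, `ε_j + ε_k` (`j < k`) and, for odd `n`,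
`ε_j`. -/
structure IsHighestWeightVector {n : ℕ} (μ : Fin (n / 2) → ℤ) (v : FormPoly n) : Prop where
  ne_zero : v ≠ 0
  weight : ∀ j, ⁅(cartan j : soC n), v⁆ = (μ j : ℂ) • v
  sub_root : ∀ j k, j < k → ⁅(skew (zvec j) (zbar k) : soC n), v⁆ = 0
  add_root : ∀ j k, j < k → ⁅(skew (zvec j) (zvec k) : soC n), v⁆ = 0
  short_root : ∀ (j : Fin (n / 2)) (i : Fin n), (i : ℕ) = 2 * (n / 2) →
    ⁅skew (zvec j) (Pi.single i 1), v⁆ = 0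

/-- `W` is an irreducible representation of `𝔰𝔬(n)` with highest weight `μ`. -/
def IsIrreducibleOfWeight {n : ℕ} (μ : Fin (n / 2) → ℤ)
    (W : LieSubmodule ℂ (soC n) (FormPoly n)) : Prop :=
  LieModule.IsIrreducible ℂ (soC n) W ∧ ∃ v ∈ W, IsHighestWeightVector μ v

/-- The component of highest weight `μ` of `H^q ⊗ Λ^p`: the sum of all irreducible
subrepresentations of `H^q ⊗ Λ^p` with highest weight `μ`. -/
def component (n q p : ℕ) (μ : Fin (n / 2) → ℤ) : LieSubmodule ℂ (soC n) (FormPoly n) :=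
  sSup {W | W.toSubmodule ≤ harmonicForms n q p ∧ IsIrreducibleOfWeight μ W}

/-! ### The weights that occur -/

/-- The weight `(a, 1_k, 0, …, 0)`, cut off after `m = ⌊n/2⌋` entries. -/
def hookWeight (n : ℕ) (a : ℤ) (k : ℕ) : Fin (n / 2) → ℤ := fun j =>
  if (j : ℕ) = 0 then a else if (j : ℕ) ≤ k then 1 else 0

/-- `μ₀ = (q + 1, 1_{p-1}, 0_{m-p})`. -/
def mu0 (n q p : ℕ) : Fin (n / 2) → ℤ := hookWeight n (q + 1) (p - 1)

/-- `μ₁ = (q, 1_p, 0_{m-p-1})`, which is `(q, 1_{m-1})` if `p = m`. -/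
def mu1 (n q p : ℕ) : Fin (n / 2) → ℤ := hookWeight n q p

/-- `μ₁' = (q, 1_{m-2}, -1)`, the mirror image of `μ₁` if `n = 2m` and `p = m - 1`. -/
def mu1' (n q p : ℕ) : Fin (n / 2) → ℤ := fun j =>
  if (j : ℕ) = p then -1 else mu1 n q p j

/-- `μ₂ = (q, 1_{p-2}, 0_{m-p+1})`, for `p ≥ 2`. -/
def mu2 (n q p : ℕ) : Fin (n / 2) → ℤ := hookWeight n q (p - 2)

/-- `μ₃ = (q - 1, 1_{p-1}, 0_{m-p})`. -/
def mu3 (n q p : ℕ) : Fin (n / 2) → ℤ := hookWeight n ((q : ℤ) - 1) (p - 1)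

/-- The highest weights of the irreducible components of `H^q ⊗ Λ^p`. -/
def constituents (n q p : ℕ) : Set (Fin (n / 2) → ℤ) :=
  {μ | μ = mu0 n q p ∨
    (1 ≤ q ∧ μ = mu1 n q p) ∨
    (1 ≤ q ∧ n = 2 * p + 2 ∧ μ = mu1' n q p) ∨
    (1 ≤ q ∧ 2 ≤ p ∧ μ = mu2 n q p) ∨
    ((2 ≤ q ∨ (q = 1 ∧ p = 1)) ∧ μ = mu3 n q p)}

end PFormHarmonic

end

/-! The proof is the method of highest weight vectors, with a positive definite form in place of
general structure theory. Call a form singular if every positive root vector kills it.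

Upper bound. A harmonic singular form of degree `q` is determined by its value at the isotropic
point `P = z̄₀ / 2` (`eq_zero_of_evalForm_of_lie`): once the exterior part of the action is stripped
off, harmonicity and the equations for the root vectors `z₀ ∧ eᵢ` leave only coefficients that
depend on `⟨z₀, x⟩` alone. The root vectors `z_l ∧ eᵢ` with `l ≥ 1` fix `P`, so the value at `P` is
a singular vector of `Λ^p` for the smaller algebra `𝔰𝔬(n - 2)`. Such vectors are found by splitting
off `z₀, z̄₀` and then peeling the factors `z₁, z₂, …` one by one (`IsRootKilled.classification`).
At most five lines remain, one for each of `μ₀, μ₁, μ₁', μ₂, μ₃`. For `q = 0` constancy of the form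
removes all but one of them, and for `q = 1`, `p ≥ 2` a second-order argument removes `μ₃`
(`rootForm_rootForm_evalForm`).

Existence. The form `⟨z₀, x⟩^a ⊗ z₀ ∧ ⋯ ∧ z_{k-1}` with `k ≥ 1` is singular, harmonic, closed and
coclosed. The form itself, its images under `i(x)` and `x_∧`, and a harmonic combination of `x_∧
i(x)` and `|x|²` applied to it give the generators; for `μ₁'` the last factor is `z̄_p`, and for
`μ₃` with `p = q = 1` the starting form is the constant `1`. These operators commute with `𝔰𝔬(n)`,
so singularity and weight persist. The eigenvalue of `E` drops out of Cartan's formula for the Euler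
field and its counterpart for `d^*` (`extD_interX`, `coD_wedgeX`).

Decomposition. In the Fischer form `xᵢ` is adjoint to `∂/∂xᵢ` and `eᵢ ∧` to `i(eᵢ)`. Negative root
vectors are therefore adjoint to positive ones up to sign, and the Cartan subalgebra is
self-adjoint. Hence the generators, having distinct weights, generate mutually orthogonal
subrepresentations (`fischer_genRep`). Every nonzero finite dimensional subrepresentation contains a
singular vector (`exists_isSingular`), which gives irreducibility, and applied to the orthogonal
complement it gives exhaustion. The invariant operator `E` is a scalar on each piece, nonzero except
on `V_{μ₀}`; this identifies the common kernel of `d` and `d^*`. -/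

noncomputable section

namespace PFormHarmonic

variable {n : ℕ}

/-! ### Operators attached to vectors -/

/-- The linear form `⟨u, x⟩`. -/
def linForm (n : ℕ) : (Fin n → ℂ) →ₗ[ℂ] Poly n :=
  Fintype.linearCombination ℂ MvPolynomial.X

/-- The derivative in the direction `u`. -/
def dirDeriv (n : ℕ) : (Fin n → ℂ) →ₗ[ℂ] Derivation ℂ (Poly n) (Poly n) :=
  Fintype.linearCombination ℂ MvPolynomial.pderiv

/-- Exterior multiplication by `u`. -/
def wedgeExt (n : ℕ) : (Fin n → ℂ) →ₗ[ℂ] Module.End ℂ (Ext n) :=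
  LinearMap.mul ℂ (Ext n) ∘ₗ ExteriorAlgebra.ι ℂ

/-- Contraction with `u`. -/
def contractExt (n : ℕ) : (Fin n → ℂ) →ₗ[ℂ] Module.End ℂ (Ext n) :=
  CliffordAlgebra.contractLeft (Q := (0 : QuadraticForm ℂ (Fin n → ℂ))) ∘ₗ
    Fintype.linearCombination ℂ (fun i => (LinearMap.proj i : Module.Dual ℂ (Fin n → ℂ)))

/-- Multiplication of forms by `⟨u, x⟩`. -/
def mulForm (n : ℕ) : (Fin n → ℂ) →ₗ[ℂ] Module.End ℂ (FormPoly n) :=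
  LinearMap.rTensorHom (Ext n) ∘ₗ LinearMap.mul ℂ (Poly n) ∘ₗ linForm n

/-- Coefficientwise derivative in the direction `u`. -/
def derivForm (n : ℕ) : (Fin n → ℂ) →ₗ[ℂ] Module.End ℂ (FormPoly n) where
  toFun u := LinearMap.rTensor (Ext n) (dirDeriv n u).toLinearMap
  map_add' u v := by rw [map_add]; exact LinearMap.rTensor_add _ _ _
  map_smul' c u := by rw [map_smul]; exact LinearMap.rTensor_smul _ _ _

/-- Exterior multiplication of forms by `u`. -/
def wedgeForm (n : ℕ) : (Fin n → ℂ) →ₗ[ℂ] Module.End ℂ (FormPoly n) :=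
  LinearMap.lTensorHom (Poly n) ∘ₗ wedgeExt n

/-- Contraction of forms with `u`. -/
def contractForm (n : ℕ) : (Fin n → ℂ) →ₗ[ℂ] Module.End ℂ (FormPoly n) :=
  LinearMap.lTensorHom (Poly n) ∘ₗ contractExt n

@[simp] theorem mulForm_tmul (u : Fin n → ℂ) (f : Poly n) (ω : Ext n) :
    mulForm n u (f ⊗ₜ ω) = (linForm n u * f) ⊗ₜ ω := rfl

@[simp] theorem derivForm_tmul (u : Fin n → ℂ) (f : Poly n) (ω : Ext n) :
    derivForm n u (f ⊗ₜ ω) = dirDeriv n u f ⊗ₜ ω := rfl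

@[simp] theorem wedgeForm_tmul (u : Fin n → ℂ) (f : Poly n) (ω : Ext n) :
    wedgeForm n u (f ⊗ₜ ω) = f ⊗ₜ wedgeExt n u ω := rfl

@[simp] theorem contractForm_tmul (u : Fin n → ℂ) (f : Poly n) (ω : Ext n) :
    contractForm n u (f ⊗ₜ ω) = f ⊗ₜ contractExt n u ω := rfl

theorem linForm_single (i : Fin n) : linForm n (Pi.single i 1) = MvPolynomial.X i := by
  simp [linForm, Fintype.linearCombination_apply_single]

theorem dirDeriv_single (i : Fin n) : dirDeriv n (Pi.single i 1) = MvPolynomial.pderiv i := by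
  simp [dirDeriv, Fintype.linearCombination_apply_single]

theorem wedgeExt_apply (u : Fin n → ℂ) (ω : Ext n) :
    wedgeExt n u ω = ExteriorAlgebra.ι ℂ u * ω := rfl

theorem wedgeExt_single (i : Fin n) : wedgeExt n (Pi.single i 1) = wedgeE i := rfl

theorem contractExt_single (i : Fin n) : contractExt n (Pi.single i 1) = interE i := by
  simp [contractExt, interE, Fintype.linearCombination_apply_single]

theorem dirDeriv_linForm (u v : Fin n → ℂ) :
    dirDeriv n u (linForm n v) = MvPolynomial.C (u ⬝ᵥ v) := by
  have h : ∀ i, dirDeriv n u (MvPolynomial.X i) = MvPolynomial.C (u i) := by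
    intro i
    have h2 : dirDeriv n u (MvPolynomial.X i) =
        ∑ j, u j • (MvPolynomial.pderiv j (MvPolynomial.X i) : Poly n) := by
      rw [dirDeriv, Fintype.linearCombination_apply, ← Derivation.coeFnAddMonoidHom_apply, map_sum,
        Finset.sum_apply]
      rfl
    rw [h2]
    simp [MvPolynomial.pderiv_X, Pi.single_apply, MvPolynomial.smul_eq_C_mul]
  simp only [linForm, Fintype.linearCombination_apply, map_sum, Derivation.map_smul, h, dotProduct]
  simp only [MvPolynomial.smul_eq_C_mul, mul_comm, map_mul]

theorem dirDeriv_comm (u v : Fin n → ℂ) (f : Poly n) :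
    dirDeriv n u (dirDeriv n v f) = dirDeriv n v (dirDeriv n u f) := by
  have : ⁅dirDeriv n u, dirDeriv n v⁆ = 0 := by
    refine MvPolynomial.derivation_ext fun i => ?_
    rw [Derivation.commutator_apply, ← linForm_single, dirDeriv_linForm, dirDeriv_linForm]
    simp
  have h := congrArg (fun D : Derivation ℂ (Poly n) (Poly n) => D f) this
  simpa [Derivation.commutator_apply, sub_eq_zero] using h

theorem linearCombination_proj (u v : Fin n → ℂ) :
    Fintype.linearCombination ℂ (fun i => (LinearMap.proj i : Module.Dual ℂ (Fin n → ℂ))) u v =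
      u ⬝ᵥ v := by
  simp [Fintype.linearCombination_apply, dotProduct, LinearMap.sum_apply]

/-! ### Canonical (anti)commutation relations -/

theorem contractExt_wedgeExt (u v : Fin n → ℂ) (ω : Ext n) :
    contractExt n u (wedgeExt n v ω) = (u ⬝ᵥ v) • ω - wedgeExt n v (contractExt n u ω) := by
  refine (CliffordAlgebra.contractLeft_ι_mul _ _ _).trans ?_
  rw [linearCombination_proj]
  rfl

theorem contractExt_contractExt (u v : Fin n → ℂ) (ω : Ext n) :
    contractExt n u (contractExt n v ω) = -contractExt n v (contractExt n u ω) :=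
  CliffordAlgebra.contractLeft_comm _ _ _

theorem contractExt_self (u : Fin n → ℂ) (ω : Ext n) :
    contractExt n u (contractExt n u ω) = 0 :=
  CliffordAlgebra.contractLeft_contractLeft _ _

theorem wedgeExt_wedgeExt (u v : Fin n → ℂ) (ω : Ext n) :
    wedgeExt n u (wedgeExt n v ω) = -wedgeExt n v (wedgeExt n u ω) := by
  simp only [wedgeExt_apply, ← mul_assoc]
  rw [← neg_mul, eq_neg_of_add_eq_zero_left (ExteriorAlgebra.ι_add_mul_swap _ _)]

theorem wedgeExt_self (u : Fin n → ℂ) (ω : Ext n) : wedgeExt n u (wedgeExt n u ω) = 0 := by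
  simp only [wedgeExt_apply, ← mul_assoc, ExteriorAlgebra.ι_sq_zero, zero_mul]

theorem derivForm_mulForm (u v : Fin n → ℂ) (φ : FormPoly n) :
    derivForm n u (mulForm n v φ) = (u ⬝ᵥ v) • φ + mulForm n v (derivForm n u φ) := by
  induction φ using TensorProduct.induction_on with
  | zero => simp
  | tmul f ω =>
    simp only [mulForm_tmul, derivForm_tmul, Derivation.leibniz, dirDeriv_linForm, smul_eq_mul]
    rw [TensorProduct.add_tmul, add_comm, TensorProduct.smul_tmul', MvPolynomial.smul_eq_C_mul,
      mul_comm f]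
  | add φ ψ hφ hψ => simp only [map_add, hφ, hψ, smul_add]; abel

theorem mulForm_mulForm (u v : Fin n → ℂ) (φ : FormPoly n) :
    mulForm n u (mulForm n v φ) = mulForm n v (mulForm n u φ) := by
  induction φ using TensorProduct.induction_on with
  | zero => simp
  | tmul f ω => simp only [mulForm_tmul, mul_left_comm]
  | add φ ψ hφ hψ => simp only [map_add, hφ, hψ]

theorem derivForm_derivForm (u v : Fin n → ℂ) (φ : FormPoly n) :
    derivForm n u (derivForm n v φ) = derivForm n v (derivForm n u φ) := by
  induction φ using TensorProduct.induction_on with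
  | zero => simp
  | tmul f ω => simp only [derivForm_tmul, dirDeriv_comm u v]
  | add φ ψ hφ hψ => simp only [map_add, hφ, hψ]

theorem wedgeForm_wedgeForm (u v : Fin n → ℂ) (φ : FormPoly n) :
    wedgeForm n u (wedgeForm n v φ) = -wedgeForm n v (wedgeForm n u φ) := by
  induction φ using TensorProduct.induction_on with
  | zero => simp
  | tmul f ω => simp only [wedgeForm_tmul, wedgeExt_wedgeExt u v, TensorProduct.tmul_neg]
  | add φ ψ hφ hψ => simp only [map_add, hφ, hψ, neg_add]

theorem contractForm_contractForm (u v : Fin n → ℂ) (φ : FormPoly n) :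
    contractForm n u (contractForm n v φ) = -contractForm n v (contractForm n u φ) := by
  induction φ using TensorProduct.induction_on with
  | zero => simp
  | tmul f ω => simp only [contractForm_tmul, contractExt_contractExt u v, TensorProduct.tmul_neg]
  | add φ ψ hφ hψ => simp only [map_add, hφ, hψ, neg_add]

theorem contractForm_wedgeForm (u v : Fin n → ℂ) (φ : FormPoly n) :
    contractForm n u (wedgeForm n v φ) = (u ⬝ᵥ v) • φ - wedgeForm n v (contractForm n u φ) := by
  induction φ using TensorProduct.induction_on with
  | zero => simp
  | tmul f ω =>
    simp only [wedgeForm_tmul, contractForm_tmul, contractExt_wedgeExt, TensorProduct.tmul_sub,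
      TensorProduct.tmul_smul]
  | add φ ψ hφ hψ => simp only [map_add, hφ, hψ, smul_add]; abel

theorem wedgeForm_self (u : Fin n → ℂ) (φ : FormPoly n) :
    wedgeForm n u (wedgeForm n u φ) = 0 := by
  have h := wedgeForm_wedgeForm u u φ
  rw [eq_neg_iff_add_eq_zero, ← two_smul ℂ] at h
  exact (smul_eq_zero.mp h).resolve_left two_ne_zero

theorem contractForm_self (u : Fin n → ℂ) (φ : FormPoly n) :
    contractForm n u (contractForm n u φ) = 0 := by
  have h := contractForm_contractForm u u φ
  rw [eq_neg_iff_add_eq_zero, ← two_smul ℂ] at h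
  exact (smul_eq_zero.mp h).resolve_left two_ne_zero

theorem rTensor_lTensor_comm (S : Module.End ℂ (Poly n)) (T : Module.End ℂ (Ext n))
    (φ : FormPoly n) :
    LinearMap.lTensor (Poly n) T (LinearMap.rTensor (Ext n) S φ) =
      LinearMap.rTensor (Ext n) S (LinearMap.lTensor (Poly n) T φ) := by
  induction φ using TensorProduct.induction_on with
  | zero => simp
  | tmul f ω => rfl
  | add φ ψ hφ hψ => simp only [map_add, hφ, hψ]

theorem wedgeForm_mulForm (u v : Fin n → ℂ) (φ : FormPoly n) :
    wedgeForm n u (mulForm n v φ) = mulForm n v (wedgeForm n u φ) :=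
  rTensor_lTensor_comm _ _ _

theorem wedgeForm_derivForm (u v : Fin n → ℂ) (φ : FormPoly n) :
    wedgeForm n u (derivForm n v φ) = derivForm n v (wedgeForm n u φ) :=
  rTensor_lTensor_comm _ _ _

theorem contractForm_mulForm (u v : Fin n → ℂ) (φ : FormPoly n) :
    contractForm n u (mulForm n v φ) = mulForm n v (contractForm n u φ) :=
  rTensor_lTensor_comm _ _ _

theorem contractForm_derivForm (u v : Fin n → ℂ) (φ : FormPoly n) :
    contractForm n u (derivForm n v φ) = derivForm n v (contractForm n u φ) :=
  rTensor_lTensor_comm _ _ _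

/-! ### The action of `u ∧ v` -/

/-- Bilinearity of `(u, v) ↦ P u ∘ Q v`. It turns the coordinate sum that defines the action of a
rank-one matrix into a coordinate-free product, so that everything below can be computed with
isotropic vectors. -/
theorem sum_vecMulVec_smul {M : Type*} [AddCommGroup M] [Module ℂ M]
    (P : (Fin n → ℂ) →ₗ[ℂ] Module.End ℂ M) (Q : (Fin n → ℂ) →ₗ[ℂ] Module.End ℂ M)
    (u v : Fin n → ℂ) (x : M) :
    ∑ i, ∑ j, (u i * v j) • P (Pi.single i 1) (Q (Pi.single j 1) x) = P u (Q v x) := by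
  have hP : P u = ∑ i, u i • P (Pi.single i 1) := by
    conv_lhs => rw [pi_eq_sum_univ' u]
    simp only [map_sum, map_smul]
  have hQ : Q v = ∑ i, v i • Q (Pi.single i 1) := by
    conv_lhs => rw [pi_eq_sum_univ' v]
    simp only [map_sum, map_smul]
  rw [hP, hQ]
  simp only [LinearMap.sum_apply, LinearMap.smul_apply, map_sum, map_smul, Finset.smul_sum,
    smul_smul, mul_comm]
  exact Finset.sum_comm

def polyMul (n : ℕ) : (Fin n → ℂ) →ₗ[ℂ] Module.End ℂ (Poly n) :=
  LinearMap.mul ℂ (Poly n) ∘ₗ linForm n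

def polyDeriv (n : ℕ) : (Fin n → ℂ) →ₗ[ℂ] Module.End ℂ (Poly n) where
  toFun u := (dirDeriv n u).toLinearMap
  map_add' u v := by rw [map_add]; rfl
  map_smul' c u := by rw [map_smul]; rfl

theorem polyMul_single (i : Fin n) : polyMul n (Pi.single i 1) = mulX i := by
  simp only [polyMul, LinearMap.comp_apply, linForm_single]
  rfl

theorem polyDeriv_single (i : Fin n) : polyDeriv n (Pi.single i 1) = partialX i := by
  change (dirDeriv n _).toLinearMap = _
  rw [dirDeriv_single]
  rfl

theorem skew_lie_poly (u v : Fin n → ℂ) (f : Poly n) :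
    ⁅(skew u v : soC n), f⁆ =
      linForm n u * dirDeriv n v f - linForm n v * dirDeriv n u f := by
  have h : ⁅(skew u v : soC n), f⁆ =
      (∑ i, ∑ j, (Matrix.vecMulVec u v - Matrix.vecMulVec v u) i j •
        (mulX i ∘ₗ partialX j : Module.End ℂ (Poly n))) f := rfl
  rw [h]
  simp only [← polyMul_single, ← polyDeriv_single, LinearMap.sum_apply, LinearMap.smul_apply,
    LinearMap.comp_apply, Matrix.sub_apply, Matrix.vecMulVec_apply, sub_smul,
    Finset.sum_sub_distrib, sum_vecMulVec_smul]
  rfl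

theorem skew_lie_ext (u v : Fin n → ℂ) (ω : Ext n) :
    ⁅(skew u v : soC n), ω⁆ =
      wedgeExt n u (contractExt n v ω) - wedgeExt n v (contractExt n u ω) := by
  have h : ⁅(skew u v : soC n), ω⁆ =
      (∑ i, ∑ j, (Matrix.vecMulVec u v - Matrix.vecMulVec v u) i j •
        (wedgeE i ∘ₗ interE j : Module.End ℂ (Ext n))) ω := rfl
  rw [h]
  simp only [← wedgeExt_single, ← contractExt_single, LinearMap.sum_apply, LinearMap.smul_apply,
    LinearMap.comp_apply, Matrix.sub_apply, Matrix.vecMulVec_apply, sub_smul,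
    Finset.sum_sub_distrib, sum_vecMulVec_smul]

/-- The Leibniz rule separates an orbital part on the coefficients from a spin part on the exterior
factor. All later computations with the representation go through this formula. -/
theorem skew_lie (u v : Fin n → ℂ) (φ : FormPoly n) :
    ⁅(skew u v : soC n), φ⁆ =
      mulForm n u (derivForm n v φ) - mulForm n v (derivForm n u φ) +
        (wedgeForm n u (contractForm n v φ) - wedgeForm n v (contractForm n u φ)) := by
  induction φ using TensorProduct.induction_on with
  | zero => simp
  | tmul f ω =>
    simp only [TensorProduct.LieModule.lie_tmul_right, skew_lie_poly, skew_lie_ext, mulForm_tmul,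
      derivForm_tmul, wedgeForm_tmul, contractForm_tmul, TensorProduct.sub_tmul,
      TensorProduct.tmul_sub]
  | add φ ψ hφ hψ => simp only [map_add, lie_add, hφ, hψ]; abel

/-! ### The standard basis of the exterior algebra -/

/-- The standard basis of the exterior algebra. -/
def extBasis (n : ℕ) : Module.Basis (Finset (Fin n)) ℂ (Ext n) :=
  (Pi.basisFun ℂ (Fin n)).ExteriorAlgebra

theorem extBasis_singleton (i : Fin n) :
    extBasis n {i} = ExteriorAlgebra.ι ℂ (Pi.single i 1 : Fin n → ℂ) := by
  have h := ExteriorAlgebra.basis_apply_powersetCard (Pi.basisFun ℂ (Fin n))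
    (Set.powersetCard.ofSingleton i)
  have h2 : ((Set.powersetCard.ofSingleton i : Set.powersetCard (Fin n) 1) : Finset (Fin n)) =
    {i} := rfl
  rw [h2] at h
  rw [extBasis, h, ExteriorAlgebra.ιMulti_family, ExteriorAlgebra.ιMulti_apply]
  have h3 : (Set.powersetCard.ofFinEmbEquiv.symm (Set.powersetCard.ofSingleton i) : Fin 1 → Fin n) 0
      = i := by
    have h4 := (Set.powersetCard.mem_range_ofFinEmbEquiv_symm_iff_mem
      (Set.powersetCard.ofSingleton i)
      ((Set.powersetCard.ofFinEmbEquiv.symm (Set.powersetCard.ofSingleton i) : Fin 1 → Fin n) 0)).mp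
      ⟨0, rfl⟩
    have h5 : (Set.powersetCard.ofFinEmbEquiv.symm (Set.powersetCard.ofSingleton i) :
      Fin 1 → Fin n) 0 ∈ ({i} : Finset (Fin n)) := h4
    simpa using h5
  simp [h3]

theorem extBasis_empty : extBasis n ∅ = 1 := by
  have h := ExteriorAlgebra.basis_apply_ofCard (Pi.basisFun ℂ (Fin n)) (s := ∅) (n := 0) rfl
  rw [extBasis, h, ExteriorAlgebra.ιMulti_family, ExteriorAlgebra.ιMulti_zero_apply]

/-- The sign is left existential: only its being a unit is ever used. -/
theorem wedgeExt_extBasis_of_notMem {i : Fin n} {S : Finset (Fin n)} (hi : i ∉ S) :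
    ∃ ε : ℤˣ, wedgeExt n (Pi.single i 1) (extBasis n S) = ε • extBasis n (insert i S) := by
  have hd : Disjoint ({i} : Finset (Fin n)) S := Finset.disjoint_singleton_left.mpr hi
  have h := ExteriorAlgebra.basis_mul_of_disjoint (Pi.basisFun ℂ (Fin n))
    (Set.powersetCard.ofCard (s := {i}) (n := 1) rfl) (Set.powersetCard.ofCard (s := S) rfl) hd
  refine ⟨Equiv.Perm.sign (Set.powersetCard.permOfDisjoint
    (s := Set.powersetCard.ofCard (s := {i}) (n := 1) rfl)
    (t := Set.powersetCard.ofCard (s := S) rfl) hd), ?_⟩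
  have hu : insert i S = Finset.disjUnion {i} S hd := by
    rw [Finset.disjUnion_eq_union, Finset.insert_eq]
  rw [wedgeExt_apply, ← extBasis_singleton, hu]
  exact h

theorem wedgeExt_extBasis_of_mem {i : Fin n} {S : Finset (Fin n)} (hi : i ∈ S) :
    wedgeExt n (Pi.single i 1) (extBasis n S) = 0 := by
  rw [wedgeExt_apply, ← extBasis_singleton]
  exact ExteriorAlgebra.basis_mul_of_not_disjoint (Pi.basisFun ℂ (Fin n))
    (Set.powersetCard.ofCard (s := {i}) (n := 1) rfl) (Set.powersetCard.ofCard (s := S) rfl)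
    (fun h => Finset.disjoint_singleton_left.mp h hi)

theorem contractExt_one (u : Fin n → ℂ) : contractExt n u 1 = 0 :=
  CliffordAlgebra.contractLeft_one (Q := (0 : QuadraticForm ℂ (Fin n → ℂ))) _

theorem contractExt_zsmul (u : Fin n → ℂ) (ε : ℤˣ) (ω : Ext n) :
    contractExt n u (ε • ω) = ε • contractExt n u ω := by
  rw [Units.smul_def, Units.smul_def, map_zsmul]

theorem wedgeExt_zsmul (u : Fin n → ℂ) (ε : ℤˣ) (ω : Ext n) :
    wedgeExt n u (ε • ω) = ε • wedgeExt n u ω := by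
  rw [Units.smul_def, Units.smul_def, map_zsmul]

/-- Up to sign `e_S` is an iterated wedge product, and the contraction anticommutes past every
factor other than `eᵢ`. -/
theorem contractExt_extBasis_of_notMem {i : Fin n} {S : Finset (Fin n)} (hi : i ∉ S) :
    contractExt n (Pi.single i 1) (extBasis n S) = 0 := by
  induction S using Finset.induction_on with
  | empty => rw [extBasis_empty, contractExt_one]
  | insert j S hj ih =>
    obtain ⟨ε, hε⟩ := wedgeExt_extBasis_of_notMem hj
    have h : extBasis n (insert j S) = ε⁻¹ • wedgeExt n (Pi.single j 1) (extBasis n S) := by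
      rw [hε, inv_smul_smul]
    rw [Finset.mem_insert, not_or] at hi
    rw [h, contractExt_zsmul, contractExt_wedgeExt, ih hi.2]
    simp [hi.1]

/-- Wedging and contracting produce the same sign. This makes them adjoint to each other and makes
`eᵢ ∧ i(eᵢ)` a projection. -/
theorem contractExt_extBasis_of_mem {i : Fin n} {S : Finset (Fin n)} (hi : i ∈ S) :
    ∃ ε : ℤˣ, wedgeExt n (Pi.single i 1) (extBasis n (S.erase i)) = ε • extBasis n S ∧
      contractExt n (Pi.single i 1) (extBasis n S) = ε • extBasis n (S.erase i) := by
  obtain ⟨ε, hε⟩ := wedgeExt_extBasis_of_notMem (Finset.notMem_erase i S)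
  rw [Finset.insert_erase hi] at hε
  refine ⟨ε, hε, ?_⟩
  have h : extBasis n S = ε⁻¹ • wedgeExt n (Pi.single i 1) (extBasis n (S.erase i)) := by
    rw [hε, inv_smul_smul]
  rw [h, contractExt_zsmul, contractExt_wedgeExt,
    contractExt_extBasis_of_notMem (Finset.notMem_erase i S), Int.units_inv_eq_self]
  simp

/-- The degree operator of the exterior algebra. -/
def extDegree (n : ℕ) : Module.End ℂ (Ext n) :=
  ∑ i, wedgeExt n (Pi.single i 1) ∘ₗ contractExt n (Pi.single i 1)

theorem extDegree_apply (ω : Ext n) : extDegree n ω =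
    ∑ i, wedgeExt n (Pi.single i 1) (contractExt n (Pi.single i 1) ω) := by
  simp [extDegree, LinearMap.sum_apply]

theorem extDegree_extBasis (S : Finset (Fin n)) :
    extDegree n (extBasis n S) = (S.card : ℂ) • extBasis n S := by
  have h : ∀ i, wedgeExt n (Pi.single i 1) (contractExt n (Pi.single i 1) (extBasis n S)) =
      if i ∈ S then extBasis n S else 0 := by
    intro i
    split_ifs with hi
    · obtain ⟨ε, h1, h2⟩ := contractExt_extBasis_of_mem hi
      rw [h2, wedgeExt_zsmul, h1, smul_smul, Int.units_mul_self, one_smul]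
    · rw [contractExt_extBasis_of_notMem hi, map_zero]
  rw [extDegree_apply, Finset.sum_congr rfl fun i _ => h i]
  simp [Nat.cast_smul_eq_nsmul]

theorem extBasis_mem (S : Finset (Fin n)) : extBasis n S ∈ ⋀[ℂ]^S.card (Fin n → ℂ) := by
  have h := ExteriorAlgebra.basis_eq_coe_basis (Pi.basisFun ℂ (Fin n))
    (Set.powersetCard.ofCard (s := S) rfl)
  have h2 : extBasis n S = _ := h
  rw [h2]
  exact Subtype.prop _

theorem sum_dotProduct_smul (u : Fin n → ℂ) {M : Type*} [AddCommGroup M] [Module ℂ M]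
    (T : (Fin n → ℂ) →ₗ[ℂ] Module.End ℂ M) (x : M) :
    ∑ i, ((Pi.single i 1 : Fin n → ℂ) ⬝ᵥ u) • T (Pi.single i 1) x = T u x := by
  conv_rhs => rw [pi_eq_sum_univ' u]
  simp only [map_sum, map_smul, LinearMap.sum_apply, LinearMap.smul_apply, single_one_dotProduct]

theorem extDegree_wedgeExt (u : Fin n → ℂ) (ω : Ext n) :
    extDegree n (wedgeExt n u ω) = wedgeExt n u ω + wedgeExt n u (extDegree n ω) := by
  rw [extDegree_apply, extDegree_apply, map_sum]
  simp only [contractExt_wedgeExt, map_sub, map_smul, Finset.sum_sub_distrib, sum_dotProduct_smul]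
  rw [sub_eq_add_neg, ← Finset.sum_neg_distrib]
  congr 1
  exact Finset.sum_congr rfl fun i _ => by rw [wedgeExt_wedgeExt, neg_neg]

theorem extDegree_contractExt (u : Fin n → ℂ) (ω : Ext n) :
    extDegree n (contractExt n u ω) = contractExt n u (extDegree n ω) - contractExt n u ω := by
  rw [extDegree_apply, extDegree_apply, map_sum]
  simp only [contractExt_wedgeExt, Finset.sum_sub_distrib]
  simp only [dotProduct_comm u, sum_dotProduct_smul]
  rw [sub_right_comm, sub_self, zero_sub, ← Finset.sum_neg_distrib]
  exact Finset.sum_congr rfl fun i _ => by rw [contractExt_contractExt, map_neg]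

theorem extDegree_one : extDegree n 1 = 0 := by
  simp [extDegree_apply, contractExt_one]

theorem extDegree_of_mem {p : ℕ} {ω : Ext n} (h : ω ∈ ⋀[ℂ]^p (Fin n → ℂ)) :
    extDegree n ω = (p : ℂ) • ω := by
  induction p generalizing ω with
  | zero =>
    rw [ExteriorAlgebra.exteriorPower, pow_zero] at h
    obtain ⟨c, rfl⟩ := Submodule.mem_one.mp h
    rw [Algebra.algebraMap_eq_smul_one, map_smul, extDegree_one]
    simp
  | succ p ih =>
    rw [ExteriorAlgebra.exteriorPower, pow_succ'] at h
    refine Submodule.mul_induction_on h ?_ ?_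
    · rintro _ ⟨u, rfl⟩ y hy
      have := extDegree_wedgeExt u y
      rw [ih hy, wedgeExt_apply, wedgeExt_apply] at this
      rw [this, mul_smul_comm]
      push_cast
      rw [add_smul, one_smul, add_comm]
    · intro x y hx hy
      rw [map_add, hx, hy, smul_add]

theorem extBasis_coord_extDegree (S : Finset (Fin n)) :
    (extBasis n).coord S ∘ₗ extDegree n = (S.card : ℂ) • (extBasis n).coord S := by
  refine (extBasis n).ext fun T => ?_
  rw [LinearMap.comp_apply, extDegree_extBasis]
  by_cases hST : T = S
  · simp [hST]
  · simp [hST]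

theorem extBasis_repr_eq_zero {c : ℂ} {ω : Ext n} (h : extDegree n ω = c • ω)
    {S : Finset (Fin n)} (hS : c ≠ S.card) : (extBasis n).repr ω S = 0 := by
  have h2 := LinearMap.congr_fun (extBasis_coord_extDegree S) ω
  rw [LinearMap.comp_apply, h, map_smul, LinearMap.smul_apply, ← sub_eq_zero, ← sub_smul,
    smul_eq_zero] at h2
  exact h2.resolve_left (sub_ne_zero.mpr hS)

/-- The degree operator is diagonal with natural number eigenvalues. The case that matters is degree
`-1`. -/
theorem eq_zero_of_extDegree {c : ℂ} (hc : ∀ k : ℕ, c ≠ k) {ω : Ext n}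
    (h : extDegree n ω = c • ω) : ω = 0 :=
  (extBasis n).ext_elem fun S => by rw [extBasis_repr_eq_zero h (hc _), map_zero, Finsupp.zero_apply]

theorem eq_smul_one_of_extDegree {ω : Ext n} (h : extDegree n ω = 0) : ∃ c : ℂ, ω = c • 1 := by
  refine ⟨(extBasis n).repr ω ∅, (extBasis n).ext_elem fun S => ?_⟩
  rw [← extBasis_empty, map_smul, Module.Basis.repr_self]
  by_cases hS : S = ∅
  · simp [hS]
  · have h0 : extDegree n ω = (0 : ℂ) • ω := by simp [h]
    rw [extBasis_repr_eq_zero h0 (by simpa [eq_comm] using hS)]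
    simp [Ne.symm hS]

/-! ### Positive definite forms attached to a basis -/

section BasisForm

variable {V ι : Type*} [AddCommGroup V] [Module ℂ V] (b : Module.Basis ι ℂ V) (w : ι → ℝ)

/-- The sesquilinear form for which the basis is orthogonal, with squared lengths `w`. -/
def basisForm : V →ₗ⋆[ℂ] V →ₗ[ℂ] ℂ :=
  LinearMap.mk₂'ₛₗ (starRingEnd ℂ) (RingHom.id ℂ)
    (fun φ ψ => (b.repr φ).sum fun i c => (starRingEnd ℂ c) * ((w i : ℂ) * b.repr ψ i))
    (fun φ φ' ψ => by
      rw [map_add]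
      exact Finsupp.sum_add_index' (by simp) (by intro i c d; simp [add_mul]))
    (fun c φ ψ => by
      rw [map_smul, Finsupp.sum_smul_index (by simp), smul_eq_mul, Finsupp.mul_sum]
      simp [mul_assoc])
    (fun φ ψ ψ' => by
      simp only [map_add, Finsupp.add_apply, mul_add]
      exact Finsupp.sum_add)
    (fun c φ ψ => by
      simp only [map_smul, Finsupp.smul_apply, smul_eq_mul, RingHom.id_apply, Finsupp.mul_sum]
      exact Finsupp.sum_congr fun i _ => by ring)

theorem basisForm_apply (φ ψ : V) : basisForm b w φ ψ =
    (b.repr φ).sum fun i c => (starRingEnd ℂ c) * ((w i : ℂ) * b.repr ψ i) := rfl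

theorem basisForm_basis [DecidableEq ι] (i j : ι) :
    basisForm b w (b i) (b j) = if i = j then (w i : ℂ) else 0 := by
  rw [basisForm_apply, b.repr_self, Finsupp.sum_single_index (by simp), b.repr_self,
    Finsupp.single_apply]
  by_cases h : i = j
  · simp [h]
  · simp [h, Ne.symm h]

theorem basisForm_symm (φ ψ : V) :
    starRingEnd ℂ (basisForm b w φ ψ) = basisForm b w ψ φ := by
  classical
  -- The definition sums over the support of the first argument only; enlarging to the union of both
  -- supports makes the expression symmetric.
  have h : ∀ φ ψ : V, basisForm b w φ ψ =
      ∑ i ∈ (b.repr φ).support ∪ (b.repr ψ).support,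
        (starRingEnd ℂ (b.repr φ i)) * ((w i : ℂ) * b.repr ψ i) := by
    intro φ ψ
    rw [basisForm_apply]
    exact Finsupp.sum_of_support_subset _ Finset.subset_union_left _ (by simp)
  rw [h, h, Finset.union_comm, map_sum]
  refine Finset.sum_congr rfl fun i _ => ?_
  simp only [map_mul, Complex.conj_conj, Complex.conj_ofReal]
  ring

theorem basisForm_self (φ : V) : basisForm b w φ φ =
    ((∑ i ∈ (b.repr φ).support, w i * Complex.normSq (b.repr φ i) : ℝ) : ℂ) := by
  rw [basisForm_apply, Finsupp.sum, Complex.ofReal_sum]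
  refine Finset.sum_congr rfl fun i _ => ?_
  rw [Complex.ofReal_mul, Complex.normSq_eq_conj_mul_self]
  ring

theorem basisForm_pos (hw : ∀ i, 0 < w i) {φ : V} (hφ : φ ≠ 0) :
    0 < (basisForm b w φ φ).re := by
  rw [basisForm_self, Complex.ofReal_re]
  refine Finset.sum_pos (fun i hi => mul_pos (hw i) ?_) ?_
  · exact Complex.normSq_pos.mpr (Finsupp.mem_support_iff.mp hi)
  · rw [Finsupp.support_nonempty_iff]
    simpa using hφ

theorem basisForm_adjoint {S T : Module.End ℂ V}
    (h : ∀ i j, basisForm b w (S (b i)) (b j) = basisForm b w (b i) (T (b j))) (φ ψ : V) :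
    basisForm b w (S φ) ψ = basisForm b w φ (T ψ) := by
  induction b.mem_span φ using Submodule.span_induction with
  | mem φ hφ =>
    obtain ⟨i, rfl⟩ := hφ
    induction b.mem_span ψ using Submodule.span_induction with
    | mem ψ hψ => obtain ⟨j, rfl⟩ := hψ; exact h i j
    | zero => simp
    | add x y _ _ hx hy => simp only [map_add, hx, hy]
    | smul c x _ hx => simp only [map_smul, hx]
  | zero => simp
  | add x y _ _ hx hy => simp only [map_add, LinearMap.add_apply, hx, hy]
  | smul c x _ hx => simp only [map_smul, map_smulₛₗ, LinearMap.smul_apply, hx]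

end BasisForm

/-! ### The invariant Hermitian form on polynomial differential forms -/

/-- The basis `x^α ⊗ e_S` of the polynomial differential forms. -/
def formBasis (n : ℕ) : Module.Basis ((Fin n →₀ ℕ) × Finset (Fin n)) ℂ (FormPoly n) :=
  (MvPolynomial.basisMonomials (Fin n) ℂ).tensorProduct (extBasis n)

theorem formBasis_apply (α : Fin n →₀ ℕ) (S : Finset (Fin n)) :
    formBasis n (α, S) = MvPolynomial.monomial α 1 ⊗ₜ extBasis n S := by
  rw [formBasis, Module.Basis.tensorProduct_apply, MvPolynomial.coe_basisMonomials]

/-- The squared length of `x^α ⊗ e_S`. -/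
def formWeight (p : (Fin n →₀ ℕ) × Finset (Fin n)) : ℝ := ∏ i, ((p.1 i).factorial : ℝ)

/-- The Fischer form on polynomial differential forms. -/
def fischer (n : ℕ) : FormPoly n →ₗ⋆[ℂ] FormPoly n →ₗ[ℂ] ℂ :=
  basisForm (formBasis n) formWeight

theorem fischer_symm (φ ψ : FormPoly n) : starRingEnd ℂ (fischer n φ ψ) = fischer n ψ φ :=
  basisForm_symm _ _ _ _

theorem fischer_pos {φ : FormPoly n} (hφ : φ ≠ 0) : 0 < (fischer n φ φ).re :=
  basisForm_pos _ _ (fun p => Finset.prod_pos fun i _ => by positivity) hφ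

/-- The factor `α i + 1` is what `∂/∂xᵢ` produces from `x^(α + eᵢ)`. The factorials are chosen for
this: they make multiplication by `xᵢ` adjoint to `∂/∂xᵢ`. -/
theorem formWeight_add_single (α : Fin n →₀ ℕ) (S T : Finset (Fin n)) (i : Fin n) :
    formWeight (α + Finsupp.single i 1, S) = (α i + 1) * formWeight (α, T) := by
  simp only [formWeight]
  rw [← Finset.mul_prod_erase _ _ (Finset.mem_univ i),
    ← Finset.mul_prod_erase _ (fun i => ((α i).factorial : ℝ)) (Finset.mem_univ i),
    ← mul_assoc]
  congr 1
  · simp [Nat.factorial_succ]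
  · refine Finset.prod_congr rfl fun j hj => ?_
    simp [Finset.ne_of_mem_erase hj]

theorem mulForm_formBasis (i : Fin n) (α : Fin n →₀ ℕ) (S : Finset (Fin n)) :
    mulForm n (Pi.single i 1) (formBasis n (α, S)) =
      formBasis n (α + Finsupp.single i 1, S) := by
  rw [formBasis_apply, formBasis_apply, mulForm_tmul, linForm_single, MvPolynomial.X,
    MvPolynomial.monomial_mul, one_mul, add_comm]

theorem derivForm_formBasis (i : Fin n) (α : Fin n →₀ ℕ) (S : Finset (Fin n)) :
    derivForm n (Pi.single i 1) (formBasis n (α, S)) =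
      (α i : ℂ) • formBasis n (α - Finsupp.single i 1, S) := by
  rw [formBasis_apply, formBasis_apply, derivForm_tmul, dirDeriv_single,
    MvPolynomial.pderiv_monomial, TensorProduct.smul_tmul', MvPolynomial.smul_monomial]
  simp

theorem fischer_formBasis (p p' : (Fin n →₀ ℕ) × Finset (Fin n)) :
    fischer n (formBasis n p) (formBasis n p') = if p = p' then (formWeight p : ℂ) else 0 :=
  basisForm_basis _ _ _ _

theorem fischer_mulForm_single (i : Fin n) (φ ψ : FormPoly n) :
    fischer n (mulForm n (Pi.single i 1) φ) ψ =
      fischer n φ (derivForm n (Pi.single i 1) ψ) := by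
  refine basisForm_adjoint _ _ ?_ φ ψ
  rintro ⟨α, S⟩ ⟨β, T⟩
  change fischer n _ _ = fischer n _ _
  rw [mulForm_formBasis, derivForm_formBasis, map_smul, fischer_formBasis, fischer_formBasis]
  simp only [Prod.mk.injEq, smul_eq_mul]
  by_cases hST : S = T
  · subst hST
    by_cases hβ : α + Finsupp.single i 1 = β
    · subst hβ
      rw [formWeight_add_single α S S]
      simp
    -- If `β i = 0` the truncated difference of exponents is meaningless, but the coefficient `β i`
    -- removes the term.
    · by_cases h0 : β i = 0
      · simp [hβ, h0]
      · have : α ≠ β - Finsupp.single i 1 := by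
          rintro rfl
          exact hβ (Finsupp.sub_add_single_one_cancel h0)
        simp [hβ, this]
  · simp [hST]

theorem wedgeForm_formBasis (i : Fin n) (α : Fin n →₀ ℕ) (S : Finset (Fin n)) :
    wedgeForm n (Pi.single i 1) (formBasis n (α, S)) =
      MvPolynomial.monomial α 1 ⊗ₜ wedgeExt n (Pi.single i 1) (extBasis n S) := by
  rw [formBasis_apply, wedgeForm_tmul]

theorem contractForm_formBasis (i : Fin n) (α : Fin n →₀ ℕ) (S : Finset (Fin n)) :
    contractForm n (Pi.single i 1) (formBasis n (α, S)) =
      MvPolynomial.monomial α 1 ⊗ₜ contractExt n (Pi.single i 1) (extBasis n S) := by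
  rw [formBasis_apply, contractForm_tmul]

theorem tmul_units_smul (f : Poly n) (ε : ℤˣ) (ω : Ext n) :
    f ⊗ₜ[ℂ] (ε • ω) = ((ε : ℤ) : ℂ) • (f ⊗ₜ[ℂ] ω) := by
  rw [Units.smul_def, ← Int.cast_smul_eq_zsmul ℂ, TensorProduct.tmul_smul]

theorem fischer_wedgeForm_single (i : Fin n) (φ ψ : FormPoly n) :
    fischer n (wedgeForm n (Pi.single i 1) φ) ψ =
      fischer n φ (contractForm n (Pi.single i 1) ψ) := by
  refine basisForm_adjoint _ _ ?_ φ ψ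
  rintro ⟨α, S⟩ ⟨β, T⟩
  change fischer n _ _ = fischer n _ _
  rw [wedgeForm_formBasis, contractForm_formBasis]
  by_cases hS : i ∈ S
  · rw [wedgeExt_extBasis_of_mem hS]
    by_cases hT : i ∈ T
    · obtain ⟨ε, -, h⟩ := contractExt_extBasis_of_mem hT
      rw [h, tmul_units_smul, ← formBasis_apply, map_smul, fischer_formBasis]
      have : S ≠ T.erase i := by
        rintro rfl
        simp at hS
      simp [this]
    · rw [contractExt_extBasis_of_notMem hT]
      simp
  · obtain ⟨ε, hε⟩ := wedgeExt_extBasis_of_notMem hS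
    rw [hε, tmul_units_smul, ← formBasis_apply, map_smulₛₗ, LinearMap.smul_apply,
      fischer_formBasis]
    by_cases hT : i ∈ T
    · by_cases hST : insert i S = T
      · obtain ⟨ε', h1, h⟩ := contractExt_extBasis_of_mem hT
        have he : T.erase i = S := by rw [← hST, Finset.erase_insert hS]
        rw [he] at h h1
        have hεε : ε = ε' := by
          rw [hε, hST] at h1
          have h2 := congrArg (fun x => (extBasis n).repr x T) h1
          simp only [Units.smul_def, ← Int.cast_smul_eq_zsmul ℂ, map_smul] at h2
          simpa [Units.val_inj] using h2
        rw [h, tmul_units_smul, ← formBasis_apply, map_smul, fischer_formBasis]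
        subst hεε
        simp [hST, formWeight]
      · have he : S ≠ T.erase i := by
          rintro rfl
          exact hST (Finset.insert_erase hT)
        obtain ⟨ε', -, h⟩ := contractExt_extBasis_of_mem hT
        rw [h, tmul_units_smul, ← formBasis_apply, map_smul, fischer_formBasis]
        simp [hST, he]
    · have hST : insert i S ≠ T := by
        rintro rfl
        simp at hT
      rw [contractExt_extBasis_of_notMem hT]
      simp [hST]

/-- The form is conjugate linear in its first argument, so the coordinates of `u` reappear
conjugated on the other side. -/
theorem fischer_adjoint_of_single (S T : (Fin n → ℂ) →ₗ[ℂ] Module.End ℂ (FormPoly n))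
    (h : ∀ (i : Fin n) (φ ψ : FormPoly n), fischer n (S (Pi.single i 1) φ) ψ =
      fischer n φ (T (Pi.single i 1) ψ)) (u : Fin n → ℂ) (φ ψ : FormPoly n) :
    fischer n (S u φ) ψ = fischer n φ (T (star u) ψ) := by
  conv_lhs => rw [pi_eq_sum_univ' u]
  conv_rhs => rw [pi_eq_sum_univ' (star u)]
  simp only [map_sum, map_smul, LinearMap.sum_apply, LinearMap.smul_apply, map_smulₛₗ, h,
    Pi.star_apply]
  rfl

theorem fischer_mulForm (u : Fin n → ℂ) (φ ψ : FormPoly n) :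
    fischer n (mulForm n u φ) ψ = fischer n φ (derivForm n (star u) ψ) :=
  fischer_adjoint_of_single _ _ fischer_mulForm_single u φ ψ

theorem fischer_wedgeForm (u : Fin n → ℂ) (φ ψ : FormPoly n) :
    fischer n (wedgeForm n u φ) ψ = fischer n φ (contractForm n (star u) ψ) :=
  fischer_adjoint_of_single _ _ fischer_wedgeForm_single u φ ψ

theorem fischer_derivForm (u : Fin n → ℂ) (φ ψ : FormPoly n) :
    fischer n (derivForm n u φ) ψ = fischer n φ (mulForm n (star u) ψ) := by
  rw [← fischer_symm, ← fischer_symm _ φ, fischer_mulForm, star_star]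

theorem fischer_contractForm (u : Fin n → ℂ) (φ ψ : FormPoly n) :
    fischer n (contractForm n u φ) ψ = fischer n φ (wedgeForm n (star u) ψ) := by
  rw [← fischer_symm, ← fischer_symm _ φ, fischer_wedgeForm, star_star]

/-- Conjugation exchanges `z_j` and `z̄_j`. Up to sign this makes positive and negative root vectors
adjoint to each other, and `z_j ∧ z̄_j` is self-adjoint. -/
theorem fischer_skew (u v : Fin n → ℂ) (φ ψ : FormPoly n) :
    fischer n ⁅(skew u v : soC n), φ⁆ ψ =
      fischer n φ ⁅(skew (star v) (star u) : soC n), ψ⁆ := by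
  simp only [skew_lie, map_add, map_sub, LinearMap.add_apply, LinearMap.sub_apply,
    fischer_mulForm, fischer_derivForm, fischer_wedgeForm, fischer_contractForm]

theorem lie_smul_form (A : soC n) (c : ℂ) (φ : FormPoly n) : ⁅A, c • φ⁆ = c • ⁅A, φ⁆ :=
  lie_smul c A φ

/-! ### Contractions of vector operators -/

/-- `∑ P(eᵢ) Q(eᵢ)`. -/
def contraction (P Q : (Fin n → ℂ) →ₗ[ℂ] Module.End ℂ (FormPoly n)) : Module.End ℂ (FormPoly n) :=
  ∑ i, P (Pi.single i 1) ∘ₗ Q (Pi.single i 1)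

theorem contraction_apply (P Q : (Fin n → ℂ) →ₗ[ℂ] Module.End ℂ (FormPoly n)) (φ : FormPoly n) :
    contraction P Q φ = ∑ i, P (Pi.single i 1) (Q (Pi.single i 1) φ) := by
  simp [contraction, LinearMap.sum_apply]

/-- The operators `P(w)` transform like the vectors `w` under `𝔰𝔬(n)`. -/
def IsVectorOperator (P : (Fin n → ℂ) →ₗ[ℂ] Module.End ℂ (FormPoly n)) : Prop :=
  ∀ (u v w : Fin n → ℂ) (φ : FormPoly n), ⁅(skew u v : soC n), P w φ⁆ =
    P w ⁅(skew u v : soC n), φ⁆ + ((w ⬝ᵥ v) • P u φ - (w ⬝ᵥ u) • P v φ)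

theorem isVectorOperator_mulForm : IsVectorOperator (mulForm n) := by
  intro u v w φ
  simp only [skew_lie, derivForm_mulForm, contractForm_mulForm, wedgeForm_mulForm, map_add,
    map_sub, map_smul, dotProduct_comm w, mulForm_mulForm w]
  abel

theorem isVectorOperator_derivForm : IsVectorOperator (derivForm n) := by
  intro u v w φ
  simp only [skew_lie, derivForm_mulForm, contractForm_derivForm, wedgeForm_derivForm, map_add,
    map_sub, derivForm_derivForm w]
  abel

theorem isVectorOperator_wedgeForm : IsVectorOperator (wedgeForm n) := by
  intro u v w φ
  simp only [skew_lie, contractForm_wedgeForm, wedgeForm_mulForm, wedgeForm_derivForm, map_add,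
    map_sub, map_smul, dotProduct_comm w, wedgeForm_wedgeForm w]
  abel

theorem isVectorOperator_contractForm : IsVectorOperator (contractForm n) := by
  intro u v w φ
  simp only [skew_lie, contractForm_wedgeForm, contractForm_mulForm, contractForm_derivForm,
    map_add, map_sub, map_neg, contractForm_contractForm _ w]
  abel

/-- The four correction terms are `P u Q v`, `-P v Q u`, `P v Q u` and `-P u Q v`, and they cancel:
contracting two vector operators with the invariant dot product gives an invariant. -/
theorem IsVectorOperator.lie_contraction {P Q : (Fin n → ℂ) →ₗ[ℂ] Module.End ℂ (FormPoly n)}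
    (hP : IsVectorOperator P) (hQ : IsVectorOperator Q) (u v : Fin n → ℂ) (φ : FormPoly n) :
    ⁅(skew u v : soC n), contraction P Q φ⁆ = contraction P Q ⁅(skew u v : soC n), φ⁆ := by
  have h1 : ∀ a b : Fin n → ℂ, ∑ i, ((Pi.single i 1 : Fin n → ℂ) ⬝ᵥ a) •
      P b (Q (Pi.single i 1) φ) = P b (Q a φ) := by
    intro a b
    rw [← sum_dotProduct_smul a Q φ, map_sum]
    simp only [map_smul]
  rw [contraction_apply, contraction_apply]
  rw [lie_sum]
  simp only [hP u v, hQ u v, map_add, map_sub, map_smul, Finset.sum_add_distrib,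
    Finset.sum_sub_distrib, h1, sum_dotProduct_smul _ P]
  abel

/-- For a skew matrix the double sum meets every pair of indices twice, hence the factor `1 / 2`. -/
theorem soC_eq_sum (A : soC n) :
    A = ∑ i, ∑ j, ((1 / 2 : ℂ) * A.1 i j) •
      (skew (Pi.single i 1) (Pi.single j 1) : soC n) := by
  have hA : A.1.transpose = -A.1 := (LieAlgebra.Orthogonal.mem_so _ _ _).mp A.2
  refine Subtype.ext ?_
  ext a b
  have hab : A.1 b a = -A.1 a b := congrFun (congrFun hA a) b
  have hc : ∀ (s : Finset (Fin n)) (f : Fin n → soC n),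
      ((∑ i ∈ s, f i : soC n) : Matrix (Fin n) (Fin n) ℂ) = ∑ i ∈ s, (f i).1 := by
    intro s f
    exact map_sum (AddMonoidHom.mk' (fun A : soC n => A.1) fun _ _ => rfl) f s
  have hs : ∀ (c : ℂ) (i j : Fin n), ((c • (skew (Pi.single i 1) (Pi.single j 1) : soC n) : soC n) :
      Matrix (Fin n) (Fin n) ℂ) = c • (Matrix.vecMulVec (Pi.single i 1) (Pi.single j 1) -
        Matrix.vecMulVec (Pi.single j 1) (Pi.single i 1)) := fun _ _ _ => rfl
  rw [hc]
  simp only [hc, hs, Matrix.sum_apply, Matrix.smul_apply, Matrix.sub_apply,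
    Matrix.vecMulVec_apply, Pi.single_apply, smul_eq_mul, mul_sub, Finset.sum_sub_distrib]
  have e1 : ∑ x, ∑ y, 1 / 2 * A.1 x y * ((if a = x then (1 : ℂ) else 0) * if b = y then 1 else 0) =
      1 / 2 * A.1 a b := by
    rw [Finset.sum_eq_single a, Finset.sum_eq_single b] <;> simp +contextual [eq_comm]
  have e2 : ∑ x, ∑ y, 1 / 2 * A.1 x y * ((if a = y then (1 : ℂ) else 0) * if b = x then 1 else 0) =
      1 / 2 * A.1 b a := by
    rw [Finset.sum_eq_single b, Finset.sum_eq_single a] <;> simp +contextual [eq_comm]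
  refine Eq.trans ?_ (congrArg₂ (· - ·) e1 e2).symm
  simp only [hab]
  ring

theorem soC_induction {C : soC n → Prop} (skew_mem : ∀ i j, C (skew (Pi.single i 1) (Pi.single j 1)))
    (zero : C 0) (add : ∀ A B, C A → C B → C (A + B)) (smul : ∀ (c : ℂ) A, C A → C (c • A))
    (A : soC n) : C A := by
  rw [soC_eq_sum A]
  refine Finset.sum_induction _ C add zero fun i _ => ?_
  exact Finset.sum_induction _ C add zero fun j _ => smul _ _ (skew_mem i j)

/-- An operator that commutes with the action of `𝔰𝔬(n)`. -/
def IsInvariant (T : Module.End ℂ (FormPoly n)) : Prop :=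
  ∀ (A : soC n) (φ : FormPoly n), ⁅A, T φ⁆ = T ⁅A, φ⁆

theorem IsInvariant.of_skew {T : Module.End ℂ (FormPoly n)}
    (h : ∀ u v φ, ⁅(skew u v : soC n), T φ⁆ = T ⁅(skew u v : soC n), φ⁆) : IsInvariant T := by
  intro A φ
  induction A using soC_induction with
  | skew_mem i j => exact h _ _ _
  | zero => simp
  | add A B hA hB => rw [add_lie, add_lie, map_add, hA, hB]
  | smul c A hA => rw [smul_lie, smul_lie, map_smul, hA]

theorem IsVectorOperator.isInvariant {P Q : (Fin n → ℂ) →ₗ[ℂ] Module.End ℂ (FormPoly n)}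
    (hP : IsVectorOperator P) (hQ : IsVectorOperator Q) : IsInvariant (contraction P Q) :=
  IsInvariant.of_skew (hP.lie_contraction hQ)

theorem IsInvariant.neg {T : Module.End ℂ (FormPoly n)} (h : IsInvariant T) : IsInvariant (-T) :=
  fun A φ => by rw [LinearMap.neg_apply, LinearMap.neg_apply, lie_neg, h]

theorem IsInvariant.sub {S T : Module.End ℂ (FormPoly n)} (hS : IsInvariant S)
    (hT : IsInvariant T) : IsInvariant (S - T) :=
  fun A φ => by rw [LinearMap.sub_apply, LinearMap.sub_apply, lie_sub, hS, hT]

theorem IsInvariant.smul {S : Module.End ℂ (FormPoly n)} (c : ℂ) (hS : IsInvariant S) :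
    IsInvariant (c • S) :=
  fun A φ => by rw [LinearMap.smul_apply, LinearMap.smul_apply, lie_smul_form, hS]

theorem IsInvariant.comp {S T : Module.End ℂ (FormPoly n)} (hS : IsInvariant S)
    (hT : IsInvariant T) : IsInvariant (S ∘ₗ T) :=
  fun A φ => by rw [LinearMap.comp_apply, LinearMap.comp_apply, hS, hT]

/-- The eigenspace of an invariant operator as a subrepresentation. -/
def IsInvariant.eigenspace {T : Module.End ℂ (FormPoly n)} (hT : IsInvariant T) (c : ℂ) :
    LieSubmodule ℂ (soC n) (FormPoly n) where
  toSubmodule := LinearMap.ker (T - c • LinearMap.id)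
  lie_mem := by
    intro A φ hφ
    have h : T φ = c • φ := by simpa [sub_eq_zero] using hφ
    have : T ⁅A, φ⁆ = c • ⁅A, φ⁆ := by rw [← hT, h, lie_smul_form]
    simp [this]

theorem IsInvariant.mem_eigenspace {T : Module.End ℂ (FormPoly n)} (hT : IsInvariant T) {c : ℂ}
    {φ : FormPoly n} : φ ∈ hT.eigenspace c ↔ T φ = c • φ := by
  change φ ∈ LinearMap.ker (T - c • LinearMap.id) ↔ _
  simp [sub_eq_zero]

/-! ### The standard operators as contractions -/

theorem map_eq_comp (S : Module.End ℂ (Poly n)) (T : Module.End ℂ (Ext n)) :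
    TensorProduct.map S T = LinearMap.rTensor (Ext n) S ∘ₗ LinearMap.lTensor (Poly n) T :=
  (LinearMap.rTensor_comp_lTensor _ _ _).symm

theorem mulForm_single (i : Fin n) :
    mulForm n (Pi.single i 1) = LinearMap.rTensor (Ext n) (mulX i) := by
  rw [← polyMul_single]; rfl

theorem derivForm_single (i : Fin n) :
    derivForm n (Pi.single i 1) = LinearMap.rTensor (Ext n) (partialX i) := by
  rw [← polyDeriv_single]; rfl

theorem contractForm_single (i : Fin n) :
    contractForm n (Pi.single i 1) = LinearMap.lTensor (Poly n) (interE i) := by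
  rw [← contractExt_single]; rfl

theorem extD_eq : extD n = contraction (derivForm n) (wedgeForm n) := by
  simp only [extD, contraction, map_eq_comp, derivForm_single]
  rfl

theorem coD_eq : coD n = -contraction (derivForm n) (contractForm n) := by
  simp only [coD, contraction, map_eq_comp, derivForm_single, contractForm_single]

theorem wedgeX_eq : wedgeX n = contraction (mulForm n) (wedgeForm n) := by
  simp only [wedgeX, contraction, map_eq_comp, mulForm_single]
  rfl

theorem interX_eq : interX n = contraction (mulForm n) (contractForm n) := by
  simp only [interX, contraction, map_eq_comp, mulForm_single, contractForm_single]

/-- The Euler operator `∑ xᵢ ∂/∂xᵢ` on forms. -/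
def eulerForm (n : ℕ) : Module.End ℂ (FormPoly n) := contraction (mulForm n) (derivForm n)

/-- The exterior degree operator on forms. -/
def degForm (n : ℕ) : Module.End ℂ (FormPoly n) := contraction (wedgeForm n) (contractForm n)

/-- `∑ ∂²/∂xᵢ²` on forms. -/
def lapForm (n : ℕ) : Module.End ℂ (FormPoly n) := contraction (derivForm n) (derivForm n)

/-- Multiplication of forms by `∑ xᵢ²`. -/
def radForm (n : ℕ) : Module.End ℂ (FormPoly n) := contraction (mulForm n) (mulForm n)

theorem isInvariant_extD : IsInvariant (extD n) :=
  extD_eq (n := n) ▸ isVectorOperator_derivForm.isInvariant isVectorOperator_wedgeForm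

theorem isInvariant_coD : IsInvariant (coD n) :=
  coD_eq (n := n) ▸ (isVectorOperator_derivForm.isInvariant isVectorOperator_contractForm).neg

theorem isInvariant_wedgeX : IsInvariant (wedgeX n) :=
  wedgeX_eq (n := n) ▸ isVectorOperator_mulForm.isInvariant isVectorOperator_wedgeForm

theorem isInvariant_interX : IsInvariant (interX n) :=
  interX_eq (n := n) ▸ isVectorOperator_mulForm.isInvariant isVectorOperator_contractForm

theorem isInvariant_opE : IsInvariant (opE n) :=
  (isInvariant_interX.comp isInvariant_extD).sub (isInvariant_wedgeX.comp isInvariant_coD)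

theorem isInvariant_eulerForm : IsInvariant (eulerForm n) :=
  isVectorOperator_mulForm.isInvariant isVectorOperator_derivForm

theorem isInvariant_degForm : IsInvariant (degForm n) :=
  isVectorOperator_wedgeForm.isInvariant isVectorOperator_contractForm

theorem isInvariant_lapForm : IsInvariant (lapForm n) :=
  isVectorOperator_derivForm.isInvariant isVectorOperator_derivForm

theorem isInvariant_radForm : IsInvariant (radForm n) :=
  isVectorOperator_mulForm.isInvariant isVectorOperator_mulForm

/-! ### Harmonic forms in terms of operators -/

theorem degForm_tmul (f : Poly n) (ω : Ext n) : degForm n (f ⊗ₜ ω) = f ⊗ₜ extDegree n ω := by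
  simp [degForm, contraction_apply, extDegree_apply, TensorProduct.tmul_sum]

theorem eulerForm_tmul (f : Poly n) (ω : Ext n) : eulerForm n (f ⊗ₜ ω) =
    (∑ i, MvPolynomial.X i * MvPolynomial.pderiv i f) ⊗ₜ ω := by
  simp [eulerForm, contraction_apply, TensorProduct.sum_tmul, linForm_single, dirDeriv_single]

theorem lapForm_tmul (f : Poly n) (ω : Ext n) : lapForm n (f ⊗ₜ ω) = -(laplacian n f ⊗ₜ ω) := by
  simp [lapForm, contraction_apply, TensorProduct.sum_tmul, dirDeriv_single, laplacian,
    TensorProduct.neg_tmul, LinearMap.sum_apply]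

theorem coeff_euler (f : Poly n) (α : Fin n →₀ ℕ) :
    MvPolynomial.coeff α (∑ i, MvPolynomial.X i * MvPolynomial.pderiv i f) =
      (α.degree : ℂ) * MvPolynomial.coeff α f := by
  induction f using MvPolynomial.induction_on' with
  | monomial β a =>
    simp only [MvPolynomial.X_mul_pderiv_monomial, ← Finset.sum_smul, MvPolynomial.coeff_smul,
      MvPolynomial.coeff_monomial]
    by_cases h : β = α
    · simp [h, Finsupp.degree_eq_sum]
    · simp [h]
  | add f g hf hg =>
    simp only [map_add, mul_add, Finset.sum_add_distrib, MvPolynomial.coeff_add, hf, hg]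

/-- In characteristic zero Euler's identity characterizes homogeneity, coefficient by coefficient.
-/
theorem isHomogeneous_iff_euler (f : Poly n) (q : ℕ) : f.IsHomogeneous q ↔
    ∑ i, MvPolynomial.X i * MvPolynomial.pderiv i f = (q : ℂ) • f := by
  constructor
  · intro h
    ext α
    rw [coeff_euler, MvPolynomial.coeff_smul, smul_eq_mul]
    by_cases h0 : MvPolynomial.coeff α f = 0
    · simp [h0]
    · have := h h0
      have h3 : α.degree = q := by rwa [Finsupp.degree_eq_weight_one]
      rw [h3]
  · intro h α hα
    have h2 := congrArg (MvPolynomial.coeff α) h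
    rw [coeff_euler, MvPolynomial.coeff_smul, smul_eq_mul] at h2
    have h3 := mul_right_cancel₀ hα h2
    have h4 : α.degree = q := by exact_mod_cast h3
    rwa [Finsupp.degree_eq_weight_one] at h4

/-- The coefficient of `e_S` in a form. -/
def formCoeff (S : Finset (Fin n)) : FormPoly n →ₗ[ℂ] Poly n :=
  (TensorProduct.rid ℂ (Poly n)).toLinearMap ∘ₗ LinearMap.lTensor (Poly n) ((extBasis n).coord S)

theorem formCoeff_tmul (S : Finset (Fin n)) (f : Poly n) (ω : Ext n) :
    formCoeff S (f ⊗ₜ ω) = (extBasis n).repr ω S • f := by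
  simp [formCoeff]

theorem sum_formCoeff (φ : FormPoly n) : ∑ S, formCoeff S φ ⊗ₜ extBasis n S = φ := by
  induction φ using TensorProduct.induction_on with
  | zero => simp
  | tmul f ω =>
    simp only [formCoeff_tmul, TensorProduct.smul_tmul]
    rw [← TensorProduct.tmul_sum, (extBasis n).sum_repr]
  | add φ ψ hφ hψ =>
    simp only [map_add, TensorProduct.add_tmul, Finset.sum_add_distrib, hφ, hψ]

theorem formCoeff_degForm (S : Finset (Fin n)) (φ : FormPoly n) :
    formCoeff S (degForm n φ) = (S.card : ℂ) • formCoeff S φ := by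
  induction φ using TensorProduct.induction_on with
  | zero => simp
  | tmul f ω =>
    rw [degForm_tmul, formCoeff_tmul, formCoeff_tmul, smul_smul]
    congr 1
    exact LinearMap.congr_fun (extBasis_coord_extDegree S) ω
  | add φ ψ hφ hψ => simp only [map_add, smul_add, hφ, hψ]

theorem formCoeff_eulerForm (S : Finset (Fin n)) (φ : FormPoly n) :
    formCoeff S (eulerForm n φ) =
      ∑ i, MvPolynomial.X i * MvPolynomial.pderiv i (formCoeff S φ) := by
  induction φ using TensorProduct.induction_on with
  | zero => simp
  | tmul f ω =>
    rw [eulerForm_tmul, formCoeff_tmul, formCoeff_tmul, Finset.smul_sum]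
    exact Finset.sum_congr rfl fun i _ => by rw [Derivation.map_smul, mul_smul_comm]
  | add φ ψ hφ hψ => simp only [map_add, mul_add, Finset.sum_add_distrib, hφ, hψ]

theorem formCoeff_lapForm (S : Finset (Fin n)) (φ : FormPoly n) :
    formCoeff S (lapForm n φ) = -laplacian n (formCoeff S φ) := by
  induction φ using TensorProduct.induction_on with
  | zero => simp
  | tmul f ω => rw [lapForm_tmul, map_neg, formCoeff_tmul, formCoeff_tmul, map_smul]
  | add φ ψ hφ hψ => simp only [map_add, neg_add, hφ, hψ]

/-- Membership becomes three equations in invariant operators, so later arguments only commute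
operators. For the converse, each coefficient of `e_S` inherits the Euler and Laplace equations, and
the degree equation kills the coefficients with `|S| ≠ p`. -/
theorem mem_harmonicForms_iff {q p : ℕ} {φ : FormPoly n} : φ ∈ harmonicForms n q p ↔
    eulerForm n φ = (q : ℂ) • φ ∧ lapForm n φ = 0 ∧ degForm n φ = (p : ℂ) • φ := by
  constructor
  · rintro ⟨x, rfl⟩
    induction x using TensorProduct.induction_on with
    | zero => simp
    | tmul f ω =>
      obtain ⟨hf1, hf2⟩ := f.2
      have h1 := (isHomogeneous_iff_euler f.1 q).mp hf1
      have h2 : laplacian n f.1 = 0 := hf2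
      have h3 := extDegree_of_mem ω.2
      rw [TensorProduct.mapIncl, TensorProduct.map_tmul]
      simp only [Submodule.subtype_apply, eulerForm_tmul, lapForm_tmul, degForm_tmul, h1, h2, h3]
      simp [TensorProduct.smul_tmul']
    | add x y hx hy =>
      simp only [map_add, hx.1, hy.1, hx.2.1, hy.2.1, hx.2.2, hy.2.2, smul_add, add_zero, and_self]
  · rintro ⟨h1, h2, h3⟩
    rw [← sum_formCoeff φ]
    refine Submodule.sum_mem _ fun S _ => ?_
    have g1 : formCoeff S φ ∈ harmonic n q := by
      refine ⟨?_, ?_⟩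
      · refine (isHomogeneous_iff_euler _ q).mpr ?_
        rw [← formCoeff_eulerForm, h1, map_smul]
      · have := formCoeff_lapForm S φ
        rw [h2, map_zero, eq_comm, neg_eq_zero] at this
        exact this
    by_cases hS : S.card = p
    · have g2 : extBasis n S ∈ ⋀[ℂ]^p (Fin n → ℂ) := hS ▸ extBasis_mem S
      exact ⟨⟨_, g1⟩ ⊗ₜ ⟨_, g2⟩, rfl⟩
    · have h4 := formCoeff_degForm S φ
      rw [h3, map_smul, ← sub_eq_zero, ← sub_smul, smul_eq_zero] at h4
      have h5 : formCoeff S φ = 0 := h4.resolve_left (by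
        refine sub_ne_zero.mpr ?_
        exact_mod_cast Ne.symm hS)
      rw [h5, TensorProduct.zero_tmul]
      exact Submodule.zero_mem _

/-- `H^q ⊗ Λ^p` as a representation. -/
def harmonicRep (n q p : ℕ) : LieSubmodule ℂ (soC n) (FormPoly n) where
  toSubmodule := harmonicForms n q p
  lie_mem := by
    intro A φ hφ
    change _ ∈ harmonicForms n q p
    obtain ⟨h1, h2, h3⟩ := mem_harmonicForms_iff.mp hφ
    rw [mem_harmonicForms_iff, ← isInvariant_eulerForm, ← isInvariant_lapForm,
      ← isInvariant_degForm, h1, h2, h3, lie_smul_form, lie_smul_form, lie_zero]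
    exact ⟨rfl, rfl, rfl⟩

instance finiteDimensional_harmonic (q : ℕ) : FiniteDimensional ℂ (harmonic n q) := by
  have : FiniteDimensional ℂ (MvPolynomial.homogeneousSubmodule (Fin n) ℂ q) := by
    rw [MvPolynomial.homogeneousSubmodule_eq_finsupp_supported]
    have := (Finsupp.finite_of_degree_eq (σ := Fin n) q).to_subtype
    exact Module.Finite.equiv (AddMonoidAlgebra.supportedEquivFinsupp (S := ℂ) (R := ℂ)
      {d : Fin n →₀ ℕ | d.degree = q}).symm
  exact Submodule.finiteDimensional_inf_left _ _

instance finiteDimensional_harmonicForms (q p : ℕ) :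
    FiniteDimensional ℂ (harmonicForms n q p) := by
  rw [harmonicForms]
  infer_instance

/-! ### Commutation relations between the invariant operators -/

theorem extD_apply (φ : FormPoly n) :
    extD n φ = ∑ i, wedgeForm n (Pi.single i 1) (derivForm n (Pi.single i 1) φ) := by
  rw [extD_eq, contraction_apply]
  simp only [wedgeForm_derivForm]

theorem coD_apply (φ : FormPoly n) :
    coD n φ = -∑ i, contractForm n (Pi.single i 1) (derivForm n (Pi.single i 1) φ) := by
  rw [coD_eq, LinearMap.neg_apply, contraction_apply]
  simp only [contractForm_derivForm]

theorem wedgeX_apply (φ : FormPoly n) :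
    wedgeX n φ = ∑ i, mulForm n (Pi.single i 1) (wedgeForm n (Pi.single i 1) φ) := by
  rw [wedgeX_eq, contraction_apply]

theorem interX_apply (φ : FormPoly n) :
    interX n φ = ∑ i, mulForm n (Pi.single i 1) (contractForm n (Pi.single i 1) φ) := by
  rw [interX_eq, contraction_apply]

theorem radForm_apply (φ : FormPoly n) :
    radForm n φ = ∑ i, mulForm n (Pi.single i 1) (mulForm n (Pi.single i 1) φ) :=
  contraction_apply _ _ _

theorem lapForm_apply (φ : FormPoly n) :
    lapForm n φ = ∑ i, derivForm n (Pi.single i 1) (derivForm n (Pi.single i 1) φ) :=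
  contraction_apply _ _ _

theorem eulerForm_apply (φ : FormPoly n) :
    eulerForm n φ = ∑ i, mulForm n (Pi.single i 1) (derivForm n (Pi.single i 1) φ) :=
  contraction_apply _ _ _

theorem degForm_apply (φ : FormPoly n) :
    degForm n φ = ∑ i, wedgeForm n (Pi.single i 1) (contractForm n (Pi.single i 1) φ) :=
  contraction_apply _ _ _

theorem sum_dotProduct_smul' (u : Fin n → ℂ) {M : Type*} [AddCommGroup M] [Module ℂ M]
    (T : (Fin n → ℂ) →ₗ[ℂ] Module.End ℂ M) (x : M) :
    ∑ i, (u ⬝ᵥ (Pi.single i 1 : Fin n → ℂ)) • T (Pi.single i 1) x = T u x := by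
  rw [← sum_dotProduct_smul u T x]
  simp only [dotProduct_comm]

theorem derivForm_wedgeX (u : Fin n → ℂ) (φ : FormPoly n) :
    derivForm n u (wedgeX n φ) = wedgeForm n u φ + wedgeX n (derivForm n u φ) := by
  simp only [wedgeX_apply, map_sum, derivForm_mulForm, Finset.sum_add_distrib,
    sum_dotProduct_smul', wedgeForm_derivForm]

theorem derivForm_interX (u : Fin n → ℂ) (φ : FormPoly n) :
    derivForm n u (interX n φ) = contractForm n u φ + interX n (derivForm n u φ) := by
  simp only [interX_apply, map_sum, derivForm_mulForm, Finset.sum_add_distrib,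
    sum_dotProduct_smul', contractForm_derivForm]

theorem derivForm_radForm (u : Fin n → ℂ) (φ : FormPoly n) :
    derivForm n u (radForm n φ) = (2 : ℂ) • mulForm n u φ + radForm n (derivForm n u φ) := by
  simp only [radForm_apply, map_sum, derivForm_mulForm, map_add, map_smul, Finset.sum_add_distrib,
    sum_dotProduct_smul', two_smul]
  abel

theorem wedgeForm_wedgeX (u : Fin n → ℂ) (φ : FormPoly n) :
    wedgeForm n u (wedgeX n φ) = -wedgeX n (wedgeForm n u φ) := by
  simp only [wedgeX_apply, map_sum, wedgeForm_mulForm, wedgeForm_wedgeForm u, map_neg,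
    Finset.sum_neg_distrib]

theorem wedgeForm_interX (u : Fin n → ℂ) (φ : FormPoly n) :
    wedgeForm n u (interX n φ) = mulForm n u φ - interX n (wedgeForm n u φ) := by
  simp only [interX_apply, map_sum, wedgeForm_mulForm, contractForm_wedgeForm, map_sub, map_smul,
    Finset.sum_sub_distrib, sum_dotProduct_smul, sub_sub_cancel]

theorem contractForm_wedgeX (u : Fin n → ℂ) (φ : FormPoly n) :
    contractForm n u (wedgeX n φ) = mulForm n u φ - wedgeX n (contractForm n u φ) := by
  simp only [wedgeX_apply, map_sum, contractForm_mulForm, contractForm_wedgeForm, map_sub,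
    map_smul, Finset.sum_sub_distrib, sum_dotProduct_smul']

theorem contractForm_interX (u : Fin n → ℂ) (φ : FormPoly n) :
    contractForm n u (interX n φ) = -interX n (contractForm n u φ) := by
  simp only [interX_apply, map_sum, contractForm_mulForm, contractForm_contractForm u, map_neg,
    Finset.sum_neg_distrib]

theorem mulForm_wedgeX (u : Fin n → ℂ) (φ : FormPoly n) :
    mulForm n u (wedgeX n φ) = wedgeX n (mulForm n u φ) := by
  simp only [wedgeX_apply, map_sum, wedgeForm_mulForm, mulForm_mulForm u]

theorem mulForm_interX (u : Fin n → ℂ) (φ : FormPoly n) :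
    mulForm n u (interX n φ) = interX n (mulForm n u φ) := by
  simp only [interX_apply, map_sum, contractForm_mulForm, mulForm_mulForm u]

theorem mulForm_radForm (u : Fin n → ℂ) (φ : FormPoly n) :
    mulForm n u (radForm n φ) = radForm n (mulForm n u φ) := by
  simp only [radForm_apply, map_sum, mulForm_mulForm u]

theorem wedgeForm_radForm (u : Fin n → ℂ) (φ : FormPoly n) :
    wedgeForm n u (radForm n φ) = radForm n (wedgeForm n u φ) := by
  simp only [radForm_apply, map_sum, wedgeForm_mulForm]

theorem contractForm_radForm (u : Fin n → ℂ) (φ : FormPoly n) :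
    contractForm n u (radForm n φ) = radForm n (contractForm n u φ) := by
  simp only [radForm_apply, map_sum, contractForm_mulForm]

theorem single_dotProduct_self (i : Fin n) :
    (Pi.single i 1 : Fin n → ℂ) ⬝ᵥ Pi.single i 1 = 1 := by simp

/-- Cartan's formula: the Lie derivative along the Euler field counts polynomial degree plus form
degree. -/
theorem extD_interX (φ : FormPoly n) :
    extD n (interX n φ) = eulerForm n φ + degForm n φ - interX n (extD n φ) := by
  simp only [extD_apply, derivForm_interX, map_add, wedgeForm_interX, Finset.sum_add_distrib,
    Finset.sum_sub_distrib, map_sum, eulerForm_apply, degForm_apply]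
  abel

theorem extD_wedgeX (φ : FormPoly n) : extD n (wedgeX n φ) = -wedgeX n (extD n φ) := by
  simp only [extD_apply, derivForm_wedgeX, map_add, wedgeForm_self, wedgeForm_wedgeX, map_sum,
    zero_add, Finset.sum_neg_distrib]

theorem coD_interX (φ : FormPoly n) : coD n (interX n φ) = -interX n (coD n φ) := by
  simp only [coD_apply, derivForm_interX, map_add, contractForm_self, contractForm_interX, map_sum,
    map_neg, zero_add, Finset.sum_neg_distrib]

/-- The Hodge dual of Cartan's formula; the form degree is replaced by the number `n - p` of missing
directions. -/
theorem coD_wedgeX (φ : FormPoly n) : coD n (wedgeX n φ) =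
    -(eulerForm n φ + (n : ℂ) • φ - degForm n φ) - wedgeX n (coD n φ) := by
  simp only [coD_apply, derivForm_wedgeX, map_add, contractForm_wedgeForm, contractForm_wedgeX,
    map_sum, map_neg, Finset.sum_add_distrib, Finset.sum_sub_distrib, eulerForm_apply,
    degForm_apply, single_dotProduct_self, one_smul, Finset.sum_const, Finset.card_univ,
    Fintype.card_fin, Nat.cast_smul_eq_nsmul]
  abel

theorem interX_wedgeX (φ : FormPoly n) :
    interX n (wedgeX n φ) = radForm n φ - wedgeX n (interX n φ) := by
  rw [interX_apply, interX_apply, radForm_apply, map_sum, ← Finset.sum_sub_distrib]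
  simp only [contractForm_wedgeX, map_sub, mulForm_wedgeX]

theorem extD_radForm (φ : FormPoly n) :
    extD n (radForm n φ) = (2 : ℂ) • wedgeX n φ + radForm n (extD n φ) := by
  simp only [extD_apply, derivForm_radForm, map_add, map_smul, wedgeForm_radForm, map_sum,
    Finset.sum_add_distrib, wedgeX_apply, wedgeForm_mulForm, Finset.smul_sum]

theorem coD_radForm (φ : FormPoly n) :
    coD n (radForm n φ) = -((2 : ℂ) • interX n φ) + radForm n (coD n φ) := by
  simp only [coD_apply, derivForm_radForm, map_add, map_smul, contractForm_radForm, map_sum,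
    Finset.sum_add_distrib, interX_apply, contractForm_mulForm, ← Finset.smul_sum, map_neg,
    neg_add]

/-- Consequently `x_∧` keeps closed harmonic forms harmonic; by the next lemma `i(x)` does so for
coclosed ones. -/
theorem lapForm_wedgeX (φ : FormPoly n) :
    lapForm n (wedgeX n φ) = (2 : ℂ) • extD n φ + wedgeX n (lapForm n φ) := by
  simp only [lapForm_apply, derivForm_wedgeX, map_add, map_sum, Finset.sum_add_distrib,
    extD_apply, two_smul, ← wedgeForm_derivForm]
  abel

theorem lapForm_interX (φ : FormPoly n) :
    lapForm n (interX n φ) = -((2 : ℂ) • coD n φ) + interX n (lapForm n φ) := by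
  simp only [lapForm_apply, derivForm_interX, map_add, map_sum, Finset.sum_add_distrib,
    coD_apply, two_smul, ← contractForm_derivForm]
  abel

theorem lapForm_radForm (φ : FormPoly n) : lapForm n (radForm n φ) =
    (2 * n : ℂ) • φ + (4 : ℂ) • eulerForm n φ + radForm n (lapForm n φ) := by
  simp only [lapForm_apply, derivForm_radForm, map_add, map_smul, derivForm_mulForm, map_sum,
    Finset.sum_add_distrib, eulerForm_apply, single_dotProduct_self, one_smul, smul_add,
    Finset.sum_const, Finset.card_univ, Fintype.card_fin, ← Nat.cast_smul_eq_nsmul ℂ,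
    ← Finset.smul_sum]
  module

theorem eulerForm_wedgeX (φ : FormPoly n) :
    eulerForm n (wedgeX n φ) = wedgeX n φ + wedgeX n (eulerForm n φ) := by
  simp only [eulerForm_apply, derivForm_wedgeX, map_add, map_sum, Finset.sum_add_distrib,
    mulForm_wedgeX, ← wedgeX_apply]

theorem eulerForm_interX (φ : FormPoly n) :
    eulerForm n (interX n φ) = interX n φ + interX n (eulerForm n φ) := by
  simp only [eulerForm_apply, derivForm_interX, map_add, map_sum, Finset.sum_add_distrib,
    mulForm_interX, ← interX_apply]

theorem eulerForm_radForm (φ : FormPoly n) :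
    eulerForm n (radForm n φ) = (2 : ℂ) • radForm n φ + radForm n (eulerForm n φ) := by
  simp only [eulerForm_apply, derivForm_radForm, map_add, map_smul, map_sum,
    Finset.sum_add_distrib, mulForm_radForm, ← Finset.smul_sum, ← radForm_apply]

theorem degForm_wedgeX (φ : FormPoly n) :
    degForm n (wedgeX n φ) = wedgeX n φ + wedgeX n (degForm n φ) := by
  simp only [degForm_apply, contractForm_wedgeX, map_sub, map_sum, wedgeForm_wedgeX,
    wedgeForm_mulForm, sub_neg_eq_add, Finset.sum_add_distrib]
  rw [← wedgeX_apply]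

theorem degForm_interX (φ : FormPoly n) :
    degForm n (interX n φ) = -interX n φ + interX n (degForm n φ) := by
  simp only [degForm_apply, contractForm_interX, map_neg, map_sum, Finset.sum_sub_distrib,
    wedgeForm_interX, ← interX_apply, neg_sub]
  abel

theorem degForm_radForm (φ : FormPoly n) :
    degForm n (radForm n φ) = radForm n (degForm n φ) := by
  simp only [degForm_apply, contractForm_radForm, map_sum, wedgeForm_radForm]

theorem opE_apply (φ : FormPoly n) :
    opE n φ = interX n (extD n φ) - wedgeX n (coD n φ) := rfl

/-! ### Evaluation at a point -/

/-- Evaluation of a form at the point `P`. -/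
def evalForm (P : Fin n → ℂ) : FormPoly n →ₗ[ℂ] Ext n :=
  (TensorProduct.lid ℂ (Ext n)).toLinearMap ∘ₗ
    LinearMap.rTensor (Ext n) (MvPolynomial.aeval P).toLinearMap

theorem evalForm_tmul (P : Fin n → ℂ) (f : Poly n) (ω : Ext n) :
    evalForm P (f ⊗ₜ ω) = MvPolynomial.aeval P f • ω := by
  simp [evalForm]

theorem aeval_linForm (P u : Fin n → ℂ) : MvPolynomial.aeval P (linForm n u) = u ⬝ᵥ P := by
  simp [linForm, Fintype.linearCombination_apply, dotProduct]

theorem evalForm_mulForm (P u : Fin n → ℂ) (φ : FormPoly n) :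
    evalForm P (mulForm n u φ) = (u ⬝ᵥ P) • evalForm P φ := by
  induction φ using TensorProduct.induction_on with
  | zero => simp
  | tmul f ω => rw [mulForm_tmul, evalForm_tmul, evalForm_tmul, map_mul, aeval_linForm, mul_smul]
  | add φ ψ hφ hψ => simp only [map_add, smul_add, hφ, hψ]

theorem evalForm_wedgeForm (P u : Fin n → ℂ) (φ : FormPoly n) :
    evalForm P (wedgeForm n u φ) = wedgeExt n u (evalForm P φ) := by
  induction φ using TensorProduct.induction_on with
  | zero => simp
  | tmul f ω => rw [wedgeForm_tmul, evalForm_tmul, evalForm_tmul, map_smul]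
  | add φ ψ hφ hψ => simp only [map_add, hφ, hψ]

theorem evalForm_contractForm (P u : Fin n → ℂ) (φ : FormPoly n) :
    evalForm P (contractForm n u φ) = contractExt n u (evalForm P φ) := by
  induction φ using TensorProduct.induction_on with
  | zero => simp
  | tmul f ω => rw [contractForm_tmul, evalForm_tmul, evalForm_tmul, map_smul]
  | add φ ψ hφ hψ => simp only [map_add, hφ, hψ]

theorem evalForm_wedgeX (P : Fin n → ℂ) (φ : FormPoly n) :
    evalForm P (wedgeX n φ) = wedgeExt n P (evalForm P φ) := by
  simp only [wedgeX_apply, map_sum, evalForm_mulForm, evalForm_wedgeForm, sum_dotProduct_smul]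

theorem evalForm_interX (P : Fin n → ℂ) (φ : FormPoly n) :
    evalForm P (interX n φ) = contractExt n P (evalForm P φ) := by
  simp only [interX_apply, map_sum, evalForm_mulForm, evalForm_contractForm, sum_dotProduct_smul]

theorem evalForm_radForm (P : Fin n → ℂ) (φ : FormPoly n) :
    evalForm P (radForm n φ) = (P ⬝ᵥ P) • evalForm P φ := by
  simp only [radForm_apply, map_sum, evalForm_mulForm, smul_smul, ← Finset.sum_smul,
    single_one_dotProduct]
  rfl

theorem evalForm_degForm (P : Fin n → ℂ) (φ : FormPoly n) :
    evalForm P (degForm n φ) = extDegree n (evalForm P φ) := by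
  simp only [degForm_apply, map_sum, evalForm_wedgeForm, evalForm_contractForm, extDegree_apply]

/-! ### The isotropic vectors -/

/-- `z_j = e_{2j} + i e_{2j+1}`, indexed by natural numbers. -/
def isoVec (n j : ℕ) : Fin n → ℂ := fun i =>
  if (i : ℕ) = 2 * j then 1 else if (i : ℕ) = 2 * j + 1 then Complex.I else 0

/-- `z̄_j = e_{2j} - i e_{2j+1}`, indexed by natural numbers. -/
def isoBar (n j : ℕ) : Fin n → ℂ := fun i =>
  if (i : ℕ) = 2 * j then 1 else if (i : ℕ) = 2 * j + 1 then -Complex.I else 0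

theorem isoVec_eq {j : ℕ} (hj : 2 * j + 1 < n) : isoVec n j =
    Pi.single ⟨2 * j, by omega⟩ 1 + Complex.I • Pi.single ⟨2 * j + 1, hj⟩ 1 := by
  ext i
  simp only [isoVec, Pi.add_apply, Pi.smul_apply, Pi.single_apply, Fin.ext_iff, smul_eq_mul]
  split_ifs <;> first | omega | simp

theorem isoBar_eq {j : ℕ} (hj : 2 * j + 1 < n) : isoBar n j =
    Pi.single ⟨2 * j, by omega⟩ 1 - Complex.I • Pi.single ⟨2 * j + 1, hj⟩ 1 := by
  ext i
  simp only [isoBar, Pi.sub_apply, Pi.smul_apply, Pi.single_apply, Fin.ext_iff, smul_eq_mul]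
  split_ifs <;> first | omega | simp

theorem zvec_eq (j : Fin (n / 2)) : zvec j = isoVec n j := (isoVec_eq (by omega)).symm

theorem zbar_eq (j : Fin (n / 2)) : zbar j = isoBar n j := (isoBar_eq (by omega)).symm

theorem star_isoVec (j : ℕ) : star (isoVec n j) = isoBar n j := by
  ext i
  simp only [isoVec, isoBar, Pi.star_apply]
  split_ifs <;> simp

theorem star_isoBar (j : ℕ) : star (isoBar n j) = isoVec n j := by
  rw [← star_isoVec, star_star]

theorem isoVec_dotProduct {j : ℕ} (hj : 2 * j + 1 < n) (w : Fin n → ℂ) :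
    isoVec n j ⬝ᵥ w = w ⟨2 * j, by omega⟩ + Complex.I * w ⟨2 * j + 1, hj⟩ := by
  rw [isoVec_eq hj, add_dotProduct, smul_dotProduct]
  simp

theorem isoBar_dotProduct {j : ℕ} (hj : 2 * j + 1 < n) (w : Fin n → ℂ) :
    isoBar n j ⬝ᵥ w = w ⟨2 * j, by omega⟩ - Complex.I * w ⟨2 * j + 1, hj⟩ := by
  rw [isoBar_eq hj, sub_dotProduct, smul_dotProduct]
  simp

theorem isoVec_dotProduct_isoVec {j : ℕ} (hj : 2 * j + 1 < n) (k : ℕ) :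
    isoVec n j ⬝ᵥ isoVec n k = 0 := by
  rw [isoVec_dotProduct hj]
  simp only [isoVec]
  split_ifs <;> first | omega | simp

theorem isoBar_dotProduct_isoBar {j : ℕ} (hj : 2 * j + 1 < n) (k : ℕ) :
    isoBar n j ⬝ᵥ isoBar n k = 0 := by
  rw [isoBar_dotProduct hj]
  simp only [isoBar]
  split_ifs <;> first | omega | simp

theorem isoBar_dotProduct_isoVec {j : ℕ} (hj : 2 * j + 1 < n) (k : ℕ) :
    isoBar n j ⬝ᵥ isoVec n k = if j = k then 2 else 0 := by
  rw [isoBar_dotProduct hj]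
  simp only [isoVec]
  split_ifs <;> first | omega | (simp; try norm_num)

theorem isoVec_dotProduct_isoBar {j : ℕ} (hj : 2 * j + 1 < n) (k : ℕ) :
    isoVec n j ⬝ᵥ isoBar n k = if j = k then 2 else 0 := by
  rw [isoVec_dotProduct hj]
  simp only [isoBar]
  split_ifs <;> first | omega | (simp; try norm_num)

theorem isoVec_dotProduct_single {j : ℕ} {i : Fin n} (hi : (i : ℕ) < 2 * j ∨ 2 * j + 2 ≤ i) :
    isoVec n j ⬝ᵥ Pi.single i 1 = 0 := by
  rw [dotProduct_single_one]
  simp only [isoVec]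
  split_ifs <;> first | omega | rfl

theorem isoBar_dotProduct_single {j : ℕ} {i : Fin n} (hi : (i : ℕ) < 2 * j ∨ 2 * j + 2 ≤ i) :
    isoBar n j ⬝ᵥ Pi.single i 1 = 0 := by
  rw [dotProduct_single_one]
  simp only [isoBar]
  split_ifs <;> first | omega | rfl

theorem single_dotProduct_isoVec {j : ℕ} {i : Fin n} (hi : (i : ℕ) < 2 * j ∨ 2 * j + 2 ≤ i) :
    Pi.single i 1 ⬝ᵥ isoVec n j = 0 := by
  rw [dotProduct_comm, isoVec_dotProduct_single hi]

theorem single_dotProduct_isoBar {j : ℕ} {i : Fin n} (hi : (i : ℕ) < 2 * j ∨ 2 * j + 2 ≤ i) :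
    Pi.single i 1 ⬝ᵥ isoBar n j = 0 := by
  rw [dotProduct_comm, isoBar_dotProduct_single hi]

theorem single_even_eq {j : ℕ} (hj : 2 * j + 1 < n) :
    (Pi.single ⟨2 * j, by omega⟩ 1 : Fin n → ℂ) = (1 / 2 : ℂ) • (isoVec n j + isoBar n j) := by
  rw [isoVec_eq hj, isoBar_eq hj]
  module

theorem single_odd_eq {j : ℕ} (hj : 2 * j + 1 < n) :
    (Pi.single ⟨2 * j + 1, hj⟩ 1 : Fin n → ℂ) =
      (-Complex.I / 2) • (isoVec n j - isoBar n j) := by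
  rw [isoVec_eq hj, isoBar_eq hj]
  have : ∀ x y : Fin n → ℂ, (-Complex.I / 2) • (x + Complex.I • y - (x - Complex.I • y)) =
      (-(Complex.I * Complex.I)) • y := by intro x y; module
  rw [this, Complex.I_mul_I]
  simp

/-- Separate the indices `2j`, `2j + 1` from the larger ones. -/
theorem sum_eq_pair_add {M : Type*} [AddCommMonoid M] {j : ℕ} (hj : 2 * j + 1 < n) (f : Fin n → M)
    (hf : ∀ i : Fin n, (i : ℕ) < 2 * j → f i = 0) :
    ∑ i, f i = f ⟨2 * j, by omega⟩ + f ⟨2 * j + 1, hj⟩ +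
      ∑ i ∈ Finset.univ.filter (fun i : Fin n => 2 * j + 2 ≤ (i : ℕ)), f i := by
  rw [← Finset.sum_filter_add_sum_filter_not Finset.univ (fun i : Fin n => 2 * j + 2 ≤ (i : ℕ)),
    add_comm]
  congr 1
  rw [← Finset.sum_pair (by simp : (⟨2 * j, Nat.lt_of_succ_lt hj⟩ : Fin n) ≠ ⟨2 * j + 1, hj⟩)]
  symm
  refine Finset.sum_subset ?_ ?_
  · intro i hi
    simp only [Finset.mem_insert, Finset.mem_singleton, Fin.ext_iff] at hi
    simp only [Finset.mem_filter, Finset.mem_univ, true_and]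
    omega
  · intro i hi hi2
    simp only [Finset.mem_filter, Finset.mem_univ, true_and] at hi
    simp only [Finset.mem_insert, Finset.mem_singleton, Fin.ext_iff] at hi2
    exact hf i (by omega)

theorem card_filter_ge (j : ℕ) :
    (Finset.univ.filter (fun i : Fin n => j ≤ (i : ℕ))).card = n - j := by
  rw [Finset.card_filter, Fin.sum_univ_eq_sum_range (fun i => if j ≤ i then 1 else 0) n,
    ← Finset.card_filter]
  have h : (Finset.range n).filter (fun i => j ≤ i) = Finset.Ico j n := by
    ext i; simp [and_comm]
  rw [h, Nat.card_Ico]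

/-- A product of operators over a pair in terms of isotropic vectors. -/
theorem pair_eq_iso {M : Type*} [AddCommGroup M] [Module ℂ M]
    (P Q : (Fin n → ℂ) →ₗ[ℂ] Module.End ℂ M) {j : ℕ} (hj : 2 * j + 1 < n) (x : M) :
    P (Pi.single ⟨2 * j, by omega⟩ 1) (Q (Pi.single ⟨2 * j, by omega⟩ 1) x) +
      P (Pi.single ⟨2 * j + 1, hj⟩ 1) (Q (Pi.single ⟨2 * j + 1, hj⟩ 1) x) =
    (1 / 2 : ℂ) • (P (isoVec n j) (Q (isoBar n j) x) + P (isoBar n j) (Q (isoVec n j) x)) := by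
  rw [isoVec_eq hj, isoBar_eq hj]
  simp only [map_add, map_sub, map_smul, LinearMap.add_apply, LinearMap.sub_apply,
    LinearMap.smul_apply]
  generalize P (Pi.single ⟨2 * j, by omega⟩ 1) (Q (Pi.single ⟨2 * j, by omega⟩ 1) x) = a
  generalize P (Pi.single ⟨2 * j + 1, hj⟩ 1) (Q (Pi.single ⟨2 * j + 1, hj⟩ 1) x) = b
  generalize P (Pi.single ⟨2 * j, by omega⟩ 1) (Q (Pi.single ⟨2 * j + 1, hj⟩ 1) x) = c
  generalize P (Pi.single ⟨2 * j + 1, hj⟩ 1) (Q (Pi.single ⟨2 * j, by omega⟩ 1) x) = d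
  have : (1 / 2 : ℂ) • (a + Complex.I • d - Complex.I • (c + Complex.I • b) +
      (a - Complex.I • d + Complex.I • (c - Complex.I • b))) =
      a + (-(Complex.I * Complex.I)) • b := by module
  rw [this, Complex.I_mul_I]
  simp

/-! ### Positivity arguments -/

theorem fischer_self_nonneg (φ : FormPoly n) : 0 ≤ (fischer n φ φ).re := by
  by_cases h : φ = 0
  · simp [h]
  · exact (fischer_pos h).le

theorem eq_zero_of_fischer {φ : FormPoly n} (h : (fischer n φ φ).re ≤ 0) : φ = 0 := by
  by_contra h0
  exact absurd (fischer_pos h0) (not_lt.mpr h)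

theorem fischer_mulForm_right (u : Fin n → ℂ) (φ ψ : FormPoly n) :
    fischer n φ (mulForm n u ψ) = fischer n (derivForm n (star u) φ) ψ := by
  rw [fischer_derivForm, star_star]

theorem star_single (i : Fin n) : star (Pi.single i 1 : Fin n → ℂ) = Pi.single i 1 := by
  ext k
  simp only [Pi.star_apply, Pi.single_apply]
  split_ifs <;> simp

/-- The commutator of `∂` along `z̄_j` with multiplication by `⟨z_j, x⟩` is `2`. Pairing with `ψ`
gives `2 ‖ψ‖² + ‖∂ψ‖² = 0`, since multiplication by `⟨z_j, x⟩` is adjoint to that derivative. -/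
theorem mulForm_isoVec_injective {j : ℕ} (hj : 2 * j + 1 < n) {ψ : FormPoly n}
    (h : mulForm n (isoVec n j) ψ = 0) : ψ = 0 := by
  have h2 := derivForm_mulForm (isoBar n j) (isoVec n j) ψ
  rw [h, map_zero, isoBar_dotProduct_isoVec hj, if_pos rfl] at h2
  have h3 := congrArg (fischer n ψ) h2
  rw [map_zero, map_add, map_smul, fischer_mulForm_right, star_isoVec, smul_eq_mul] at h3
  have h4 := congrArg Complex.re h3
  rw [Complex.zero_re, Complex.add_re, Complex.mul_re, Complex.re_ofNat, Complex.im_ofNat,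
    zero_mul, sub_zero] at h4
  have := fischer_self_nonneg (derivForm n (isoBar n j) ψ)
  exact eq_zero_of_fischer (by linarith)

/-- If `(n - 2) g + ∑_{i ≥ 2} xᵢ ∂ᵢ g + ⟨z₀, x⟩ ∂_{z̄₀} g = 0` then `g = 0`. -/
theorem eq_zero_of_weighted_euler (hn : 2 < n) {g : FormPoly n}
    (h : ((n - 2 : ℕ) : ℂ) • g + (∑ i ∈ Finset.univ.filter (fun i : Fin n => 2 ≤ (i : ℕ)),
      mulForm n (Pi.single i 1) (derivForm n (Pi.single i 1) g)) +
      mulForm n (isoVec n 0) (derivForm n (isoBar n 0) g) = 0) : g = 0 := by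
  -- After pairing with `g` every term is a nonnegative multiple of a squared length, and the first
  -- one has the coefficient `n - 2 > 0`.
  have h3 := congrArg (fischer n g) h
  rw [map_zero, map_add, map_add, map_smul, fischer_mulForm_right, star_isoVec, smul_eq_mul,
    map_sum] at h3
  simp only [fischer_mulForm_right, star_single] at h3
  have h4 := congrArg Complex.re h3
  rw [Complex.zero_re, Complex.add_re, Complex.add_re, Complex.re_sum] at h4
  have h5 : (((n - 2 : ℕ) : ℂ) * fischer n g g).re = ((n - 2 : ℕ) : ℝ) * (fischer n g g).re := by
    rw [← Complex.ofReal_natCast, Complex.re_ofReal_mul]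
  rw [h5] at h4
  have e1 := fischer_self_nonneg (derivForm n (isoBar n 0) g)
  have e2 : 0 ≤ ∑ i ∈ Finset.univ.filter (fun i : Fin n => 2 ≤ (i : ℕ)),
      (fischer n (derivForm n (Pi.single i 1) g) (derivForm n (Pi.single i 1) g)).re :=
    Finset.sum_nonneg fun i _ => fischer_self_nonneg _
  have e3 : (0 : ℝ) < ((n - 2 : ℕ) : ℝ) := by
    exact_mod_cast (by omega : 0 < n - 2)
  refine eq_zero_of_fischer ?_
  by_contra hc
  push Not at hc
  have := mul_pos e3 hc
  linarith

/-! ### Determination of singular harmonic forms by one value. -/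

theorem eulerForm_derivForm (u : Fin n → ℂ) (φ : FormPoly n) :
    eulerForm n (derivForm n u φ) = derivForm n u (eulerForm n φ) - derivForm n u φ := by
  simp only [eulerForm_apply, map_sum, derivForm_mulForm, Finset.sum_add_distrib,
    sum_dotProduct_smul', derivForm_derivForm u, add_sub_cancel_left]

theorem eulerForm_wedgeForm (u : Fin n → ℂ) (φ : FormPoly n) :
    eulerForm n (wedgeForm n u φ) = wedgeForm n u (eulerForm n φ) := by
  simp only [eulerForm_apply, map_sum, wedgeForm_mulForm, wedgeForm_derivForm]

theorem eulerForm_contractForm (u : Fin n → ℂ) (φ : FormPoly n) :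
    eulerForm n (contractForm n u φ) = contractForm n u (eulerForm n φ) := by
  simp only [eulerForm_apply, map_sum, contractForm_mulForm, contractForm_derivForm]

theorem lapForm_wedgeForm (u : Fin n → ℂ) (φ : FormPoly n) :
    lapForm n (wedgeForm n u φ) = wedgeForm n u (lapForm n φ) := by
  simp only [lapForm_apply, map_sum, wedgeForm_derivForm]

theorem lapForm_contractForm (u : Fin n → ℂ) (φ : FormPoly n) :
    lapForm n (contractForm n u φ) = contractForm n u (lapForm n φ) := by
  simp only [lapForm_apply, map_sum, contractForm_derivForm]

theorem eq_zero_of_evalForm_of_euler_zero {P : Fin n → ℂ} {ψ : FormPoly n}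
    (h1 : eulerForm n ψ = 0) (h2 : evalForm P ψ = 0) : ψ = 0 := by
  have h3 : ∀ S, ∃ c : ℂ, formCoeff S ψ = MvPolynomial.C c := by
    intro S
    have h4 : (formCoeff S ψ).IsHomogeneous 0 := by
      rw [isHomogeneous_iff_euler, ← formCoeff_eulerForm, h1, map_zero]
      simp
    rw [← MvPolynomial.totalDegree_zero_iff_isHomogeneous] at h4
    exact ⟨_, MvPolynomial.totalDegree_eq_zero_iff_eq_C.mp h4⟩
  choose c hc using h3
  have h5 := sum_formCoeff ψ
  simp only [hc] at h5
  rw [← h5] at h2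
  simp only [map_sum, evalForm_tmul, MvPolynomial.algHom_C, Algebra.algebraMap_self,
    RingHom.id_apply] at h2
  have h6 := (Fintype.linearIndependent_iff.mp (extBasis n).linearIndependent) c h2
  rw [← h5]
  simp [h6]

/-- A form that depends on `⟨z₀, x⟩` only and vanishes at `z̄₀ / 2` is zero. -/
theorem eq_zero_of_evalForm (hn : 2 < n) (q : ℕ) {ψ : FormPoly n}
    (h1 : eulerForm n ψ = (q : ℂ) • ψ) (h2 : derivForm n (isoVec n 0) ψ = 0)
    (h3 : ∀ i : Fin n, 2 ≤ (i : ℕ) → derivForm n (Pi.single i 1) ψ = 0)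
    (h4 : evalForm ((1 / 2 : ℂ) • isoBar n 0) ψ = 0) : ψ = 0 := by
  induction q generalizing ψ with
  | zero => exact eq_zero_of_evalForm_of_euler_zero (by simpa using h1) h4
  | succ q ih =>
    have h0 : 2 * 0 + 1 < n := by omega
    -- In the basis `z₀, z̄₀, e₂, e₃, …` only one term of the Euler operator survives. The factor `1
    -- / 2` is the inverse of `⟨z₀, z̄₀⟩`.
    have h5 : eulerForm n ψ =
        (1 / 2 : ℂ) • mulForm n (isoVec n 0) (derivForm n (isoBar n 0) ψ) := by
      rw [eulerForm_apply, sum_eq_pair_add h0 _ (fun i hi => by omega), pair_eq_iso _ _ h0, h2,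
        map_zero, add_zero, Finset.sum_eq_zero, add_zero]
      intro i hi
      rw [h3 i (by simpa using hi), map_zero]
    have h6 : derivForm n (isoBar n 0) ψ = 0 := by
      refine ih ?_ ?_ ?_ ?_
      · rw [eulerForm_derivForm, h1, map_smul]
        push_cast
        module
      · rw [derivForm_derivForm, h2, map_zero]
      · intro i hi
        rw [derivForm_derivForm, h3 i hi, map_zero]
      -- At the evaluation point `⟨z₀, x⟩ = 1`, so the Euler identity transfers the vanishing of `ψ`
      -- to its derivative.
      · have h7 := congrArg (evalForm ((1 / 2 : ℂ) • isoBar n 0)) (h5.symm.trans h1)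
        rw [map_smul, map_smul, h4, smul_zero, evalForm_mulForm, dotProduct_smul,
          isoVec_dotProduct_isoBar h0, if_pos rfl, smul_smul, smul_eq_zero] at h7
        exact h7.resolve_left (by norm_num)
    rw [h6, map_zero, smul_zero, h1, smul_eq_zero] at h5
    exact h5.resolve_left (by exact_mod_cast Nat.succ_ne_zero q)

/-- A harmonic homogeneous form whose coefficients are killed by the root vectors `z₀ ∧ eᵢ` and
vanish at `z̄₀ / 2` is zero. -/
theorem eq_zero_of_evalForm_of_root (hn : 2 < n) (q : ℕ) {ψ : FormPoly n}
    (h1 : eulerForm n ψ = (q : ℂ) • ψ) (h2 : lapForm n ψ = 0)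
    (h3 : ∀ i : Fin n, 2 ≤ (i : ℕ) → mulForm n (isoVec n 0) (derivForm n (Pi.single i 1) ψ) =
      mulForm n (Pi.single i 1) (derivForm n (isoVec n 0) ψ))
    (h4 : evalForm ((1 / 2 : ℂ) • isoBar n 0) ψ = 0) : ψ = 0 := by
  have h0 : 2 * 0 + 1 < n := by omega
  -- Write `g` for the derivative of `ψ` along `z₀`. Multiplying the Laplace equation by `⟨z₀, x⟩²`
  -- and replacing `⟨z₀, x⟩ ∂ᵢψ` by `xᵢ g` leaves `⟨z₀, x⟩` times the positive expression in `g`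
  -- that was shown to vanish only for `g = 0`.
  have hg : derivForm n (isoVec n 0) ψ = 0 := by
    refine eq_zero_of_weighted_euler hn (mulForm_isoVec_injective h0 ?_)
    have e : ∀ i : Fin n, 2 ≤ (i : ℕ) → mulForm n (isoVec n 0) (mulForm n (isoVec n 0)
        (derivForm n (Pi.single i 1) (derivForm n (Pi.single i 1) ψ))) =
        mulForm n (isoVec n 0) (derivForm n (isoVec n 0) ψ + mulForm n (Pi.single i 1)
          (derivForm n (Pi.single i 1) (derivForm n (isoVec n 0) ψ))) := by
      intro i hi
      have := derivForm_mulForm (Pi.single i 1) (isoVec n 0) (derivForm n (Pi.single i 1) ψ)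
      rw [single_dotProduct_isoVec (by omega), zero_smul, zero_add, h3 i hi, derivForm_mulForm,
        single_dotProduct_self, one_smul] at this
      rw [← this]
    have h5 : mulForm n (isoVec n 0) (mulForm n (isoVec n 0) (lapForm n ψ)) = 0 := by
      rw [h2, map_zero, map_zero]
    rw [lapForm_apply, sum_eq_pair_add h0 _ (fun i hi => by omega), pair_eq_iso _ _ h0,
      map_add, map_add, map_sum, map_sum, Finset.sum_congr rfl (fun i hi => e i (by simpa using hi)),
      derivForm_derivForm (isoVec n 0), ← two_smul ℂ, smul_smul] at h5
    rw [map_add, map_add, map_smul, map_sum]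
    simp only [map_add, Finset.sum_add_distrib, Finset.sum_const] at h5
    rw [card_filter_ge, ← Nat.cast_smul_eq_nsmul ℂ] at h5
    rw [← h5]
    norm_num
    abel
  -- With `g = 0` the root equations give `⟨z₀, x⟩ ∂ᵢψ = 0`, so `ψ` depends on `⟨z₀, x⟩` only.
  refine eq_zero_of_evalForm hn q h1 hg (fun i hi => ?_) h4
  refine mulForm_isoVec_injective h0 ?_
  rw [h3 i hi, hg, map_zero]

/-- A form that is killed by the root vectors `z₀ ∧ eᵢ` is determined by its value at `z̄₀ / 2`. -/
theorem eq_zero_of_evalForm_of_lie (hn : 2 < n) (q : ℕ) {φ : FormPoly n}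
    (h1 : eulerForm n φ = (q : ℂ) • φ) (h2 : lapForm n φ = 0)
    (h3 : ∀ i : Fin n, 2 ≤ (i : ℕ) → ⁅(skew (isoVec n 0) (Pi.single i 1) : soC n), φ⁆ = 0)
    (h4 : evalForm ((1 / 2 : ℂ) • isoBar n 0) φ = 0) : φ = 0 := by
  set z := isoVec n 0
  have hzz : z ⬝ᵥ z = 0 := isoVec_dotProduct_isoVec (by omega) 0
  -- If `T` acts on the exterior factor and annihilates the spin part of the root equations, then `T
  -- φ` satisfies the purely orbital equations. This is used for `z ∧ i(z)`, `i(z)`, `z ∧` and the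
  -- identity in turn; each vanishing removes the spin terms that obstruct the next choice.
  have key : ∀ T : Module.End ℂ (FormPoly n), (∀ ψ, eulerForm n (T ψ) = T (eulerForm n ψ)) →
      (∀ ψ, lapForm n (T ψ) = T (lapForm n ψ)) →
      (∀ u ψ, mulForm n u (T ψ) = T (mulForm n u ψ)) →
      (∀ u ψ, derivForm n u (T ψ) = T (derivForm n u ψ)) →
      evalForm ((1 / 2 : ℂ) • isoBar n 0) (T φ) = 0 →
      (∀ i : Fin n, 2 ≤ (i : ℕ) → T (wedgeForm n z (contractForm n (Pi.single i 1) φ) -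
        wedgeForm n (Pi.single i 1) (contractForm n z φ)) = 0) → T φ = 0 := by
    intro T t1 t2 t3 t4 t5 t6
    refine eq_zero_of_evalForm_of_root hn q ?_ ?_ ?_ t5
    · rw [t1, h1, map_smul]
    · rw [t2, h2, map_zero]
    · intro i hi
      have h5 := congrArg T (h3 i hi)
      rw [skew_lie, map_add, t6 i hi, add_zero, map_zero, map_sub, sub_eq_zero] at h5
      rw [t4, t4, t3, t3, h5]
  have a1 : wedgeForm n z (contractForm n z φ) = 0 := by
    refine key (wedgeForm n z ∘ₗ contractForm n z) ?_ ?_ ?_ ?_ ?_ ?_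
    · intro ψ; simp only [LinearMap.comp_apply, eulerForm_wedgeForm, eulerForm_contractForm]
    · intro ψ; simp only [LinearMap.comp_apply, lapForm_wedgeForm, lapForm_contractForm]
    · intro u ψ; simp only [LinearMap.comp_apply, wedgeForm_mulForm, contractForm_mulForm]
    · intro u ψ; simp only [LinearMap.comp_apply, wedgeForm_derivForm, contractForm_derivForm]
    · rw [LinearMap.comp_apply, evalForm_wedgeForm, evalForm_contractForm, h4, map_zero, map_zero]
    · intro i hi
      have hz : z ⬝ᵥ Pi.single i 1 = 0 := isoVec_dotProduct_single (by omega)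
      simp only [LinearMap.comp_apply, map_sub, contractForm_wedgeForm, hzz, hz, zero_smul,
        zero_sub, map_neg, wedgeForm_self, contractForm_self, map_zero, neg_zero, sub_zero]
  have a2 : contractForm n z φ = 0 := by
    refine key (contractForm n z) (eulerForm_contractForm z) (lapForm_contractForm z) ?_ ?_ ?_ ?_
    · intro u ψ; rw [contractForm_mulForm]
    · intro u ψ; rw [contractForm_derivForm]
    · rw [evalForm_contractForm, h4, map_zero]
    · intro i hi
      have hz : z ⬝ᵥ Pi.single i 1 = 0 := isoVec_dotProduct_single (by omega)
      have hz' : Pi.single i 1 ⬝ᵥ z = 0 := single_dotProduct_isoVec (by omega)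
      have a3 := contractForm_wedgeForm (Pi.single i 1) z (contractForm n z φ)
      rw [a1, map_zero, hz', zero_smul, zero_sub, contractForm_contractForm, map_neg, neg_neg] at a3
      rw [map_sub, contractForm_wedgeForm, contractForm_wedgeForm, hzz, hz, contractForm_self,
        ← a3]
      simp
  have a3 : wedgeForm n z φ = 0 := by
    refine key (wedgeForm n z) (eulerForm_wedgeForm z) (lapForm_wedgeForm z) ?_ ?_ ?_ ?_
    · intro u ψ; rw [wedgeForm_mulForm]
    · intro u ψ; rw [wedgeForm_derivForm]
    · rw [evalForm_wedgeForm, h4, map_zero]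
    · intro i hi
      rw [a2, map_zero, sub_zero, wedgeForm_self]
  refine key LinearMap.id (fun _ => rfl) (fun _ => rfl) (fun _ _ => rfl) (fun _ _ => rfl) h4 ?_
  intro i hi
  have a4 := contractForm_wedgeForm (Pi.single i 1) z φ
  rw [a3, map_zero, single_dotProduct_isoVec (by omega), zero_smul, zero_sub, zero_eq_neg] at a4
  rw [LinearMap.id_apply, a2, a4, map_zero, sub_zero]

/-! ### Highest weight vectors in the exterior algebra -/

/-- The action of `z_l ∧ eᵢ` on the exterior algebra. -/
def rootExt (n l : ℕ) (i : Fin n) : Module.End ℂ (Ext n) :=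
  wedgeExt n (isoVec n l) ∘ₗ contractExt n (Pi.single i 1) -
    wedgeExt n (Pi.single i 1) ∘ₗ contractExt n (isoVec n l)

theorem rootExt_apply (l : ℕ) (i : Fin n) (ω : Ext n) : rootExt n l i ω =
    wedgeExt n (isoVec n l) (contractExt n (Pi.single i 1) ω) -
      wedgeExt n (Pi.single i 1) (contractExt n (isoVec n l) ω) := rfl

theorem rootExt_wedgeExt {l : ℕ} {i : Fin n} {u : Fin n → ℂ} (h1 : isoVec n l ⬝ᵥ u = 0)
    (h2 : Pi.single i 1 ⬝ᵥ u = 0) (ω : Ext n) :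
    rootExt n l i (wedgeExt n u ω) = wedgeExt n u (rootExt n l i ω) := by
  simp only [rootExt_apply, contractExt_wedgeExt, h1, h2, zero_smul, zero_sub, map_neg, map_sub,
    wedgeExt_wedgeExt u]

theorem rootExt_contractExt {l : ℕ} {i : Fin n} {u : Fin n → ℂ} (h1 : u ⬝ᵥ isoVec n l = 0)
    (h2 : u ⬝ᵥ Pi.single i 1 = 0) (ω : Ext n) :
    rootExt n l i (contractExt n u ω) = contractExt n u (rootExt n l i ω) := by
  simp only [rootExt_apply, contractExt_wedgeExt, h1, h2, zero_smul, zero_sub, map_neg, map_sub,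
    contractExt_contractExt u, neg_neg]

/-- `ω` is killed by the root vectors `z_l ∧ eᵢ` with `j ≤ l`, `2 l + 2 ≤ i`. -/
def IsRootKilled (j : ℕ) (ω : Ext n) : Prop :=
  ∀ l, j ≤ l → ∀ i : Fin n, 2 * l + 2 ≤ (i : ℕ) → rootExt n l i ω = 0

/-- `ω` is a highest weight vector of degree `k` that only involves the vectors `eᵢ`,
`2 j ≤ i`. -/
structure IsTailSingular (j : ℕ) (k : ℂ) (ω : Ext n) : Prop where
  contract : ∀ i : Fin n, (i : ℕ) < 2 * j → contractExt n (Pi.single i 1) ω = 0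
  degree : extDegree n ω = k • ω
  root : IsRootKilled j ω

/-- The vector `z ∧ i(z) ω` is killed both by `eᵢ ∧` and by `i(eᵢ)` for an index `i ≥ 2 j + 2`, and
the anticommutator of these is `1`; so it vanishes. Then `z ∧` annihilates every summand of the
degree operator applied to `ω`, which leaves `k (z ∧ ω) = 0`. -/
theorem IsTailSingular.wedge_eq_zero {j k : ℕ} {ω : Ext n} (h : IsTailSingular j k ω)
    (hj : 2 * j + 2 < n) (hk : 1 ≤ k) : wedgeExt n (isoVec n j) ω = 0 ∧
      wedgeExt n (isoVec n j) (contractExt n (isoVec n j) ω) = 0 := by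
  have hj' : 2 * j + 1 < n := by omega
  set z := isoVec n j
  have hr : ∀ i : Fin n, 2 * j + 2 ≤ (i : ℕ) →
      wedgeExt n z (contractExt n (Pi.single i 1) ω) =
        wedgeExt n (Pi.single i 1) (contractExt n z ω) := by
    intro i hi
    have := h.root j le_rfl i hi
    rwa [rootExt_apply, sub_eq_zero] at this
  have hξ : wedgeExt n z (contractExt n z ω) = 0 := by
    set i : Fin n := ⟨2 * j + 2, hj⟩
    have hi : 2 * j + 2 ≤ (i : ℕ) := le_rfl
    have hzi : z ⬝ᵥ Pi.single i 1 = 0 := isoVec_dotProduct_single (Or.inr hi)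
    have hiz : Pi.single i 1 ⬝ᵥ z = 0 := single_dotProduct_isoVec (Or.inr hi)
    have hzz : z ⬝ᵥ z = 0 := isoVec_dotProduct_isoVec hj' j
    have e1 := congrArg (contractExt n z) (hr i hi)
    rw [contractExt_wedgeExt, contractExt_wedgeExt, hzz, hzi, zero_smul, zero_smul,
      contractExt_self, map_zero, contractExt_contractExt, map_neg] at e1
    have e2 := congrArg (wedgeExt n z) (hr i hi)
    rw [wedgeExt_self, wedgeExt_wedgeExt] at e2
    have e3 := contractExt_wedgeExt (Pi.single i 1) (Pi.single i 1)
      (wedgeExt n z (contractExt n z ω))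
    have e4 : wedgeExt n (Pi.single i 1) (wedgeExt n z (contractExt n z ω)) = 0 := by
      rw [zero_eq_neg] at e2; exact e2
    have e5 : contractExt n (Pi.single i 1) (wedgeExt n z (contractExt n z ω)) = 0 := by
      rw [contractExt_wedgeExt, hiz, zero_smul, zero_sub, neg_eq_zero]
      simpa using e1
    rw [e4, e5, map_zero, map_zero, single_dotProduct_self, one_smul, sub_zero] at e3
    exact e3.symm
  refine ⟨?_, hξ⟩
  have e1 := congrArg (wedgeExt n z) h.degree
  rw [extDegree_apply, sum_eq_pair_add hj' _
    (fun i hi => by rw [h.contract i hi, map_zero]), pair_eq_iso _ _ hj', map_add, map_sum,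
    Finset.sum_eq_zero, add_zero, map_smul, map_add, wedgeExt_self, zero_add, wedgeExt_wedgeExt,
    hξ, map_zero, neg_zero, smul_zero, map_smul, eq_comm, smul_eq_zero] at e1
  · refine e1.resolve_left ?_
    exact_mod_cast (by omega : k ≠ 0)
  · intro i hi
    have hi' : 2 * j + 2 ≤ (i : ℕ) := by simpa using hi
    rw [wedgeExt_wedgeExt, hr i hi', wedgeExt_self, neg_zero]

/-- If `η = i(z) ω` were nonzero, it would contain `z` and every `eᵢ` with `i ≥ 2 j + 2` as a
factor, hence have degree `n - 2 j - 1`. Its degree is `k - 1`, and the bound `k + 2 j < n` excludes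
equality. -/
theorem IsTailSingular.contract_eq_zero {j k : ℕ} {ω : Ext n} (h : IsTailSingular j k ω)
    (hj : 2 * j + 2 < n) (hk : 1 ≤ k) (hkn : k + 2 * j < n) :
    contractExt n (isoVec n j) ω = 0 := by
  obtain ⟨h1, h2⟩ := h.wedge_eq_zero hj hk
  have hj' : 2 * j + 1 < n := by omega
  set z := isoVec n j
  set η := contractExt n z ω
  have hd : extDegree n η = ((k : ℂ) - 1) • η := by
    rw [extDegree_contractExt, h.degree, map_smul, sub_smul, one_smul]
  have hη : ∀ i : Fin n, 2 * j + 2 ≤ (i : ℕ) →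
      wedgeExt n (Pi.single i 1) (contractExt n (Pi.single i 1) η) = η := by
    intro i hi
    have e0 := h.root j le_rfl i hi
    have e1 := contractExt_wedgeExt (Pi.single i 1) z ω
    rw [h1, map_zero, single_dotProduct_isoVec (Or.inr hi), zero_smul, zero_sub, zero_eq_neg] at e1
    rw [rootExt_apply, e1, zero_sub, neg_eq_zero] at e0
    have e2 := contractExt_wedgeExt (Pi.single i 1) (Pi.single i 1) η
    rw [e0, map_zero, single_dotProduct_self, one_smul] at e2
    exact (sub_eq_zero.mp e2.symm).symm
  have hz : wedgeExt n z (contractExt n (isoBar n j) η) = (2 : ℂ) • η := by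
    have e2 := contractExt_wedgeExt (isoBar n j) z η
    rw [h2, map_zero, isoBar_dotProduct_isoVec hj', if_pos rfl] at e2
    exact (sub_eq_zero.mp e2.symm).symm
  have hlow : ∀ i : Fin n, (i : ℕ) < 2 * j →
      wedgeExt n (Pi.single i 1) (contractExt n (Pi.single i 1) η) = 0 := by
    intro i hi
    rw [contractExt_contractExt, h.contract i hi, map_zero, neg_zero, map_zero]
  rw [extDegree_apply, sum_eq_pair_add hj' _ hlow, pair_eq_iso _ _ hj', hz, contractExt_self,
    map_zero, add_zero, Finset.sum_congr rfl (fun i hi => hη i (by simpa using hi)),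
    Finset.sum_const, card_filter_ge, ← Nat.cast_smul_eq_nsmul ℂ, smul_smul, ← add_smul,
    ← sub_eq_zero, ← sub_smul, smul_eq_zero] at hd
  refine hd.resolve_left ?_
  rw [Nat.cast_sub (by omega)]
  push_cast
  intro h0
  have h3 : (n : ℂ) = ((k + 2 * j : ℕ) : ℂ) := by
    push_cast
    linear_combination h0
  have h4 : n = k + 2 * j := by exact_mod_cast h3
  omega

/-- Since `z ∧ ω = 0` and `⟨z̄, z⟩ = 2`, the form `B = i(z̄) ω / 2` satisfies `ω = z ∧ B`. It is
free of `z` and `z̄` because `i(z) ω = 0`. -/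
theorem IsTailSingular.peel {j k : ℕ} {ω : Ext n} (h : IsTailSingular j ((k + 1 : ℕ) : ℂ) ω)
    (hj : 2 * j + 2 < n) (hkn : k + 1 + 2 * j < n) :
    ∃ B, IsTailSingular (j + 1) (k : ℂ) B ∧ ω = wedgeExt n (isoVec n j) B := by
  have hj' : 2 * j + 1 < n := by omega
  have h1 := (h.wedge_eq_zero hj (by omega)).1
  have h2 := h.contract_eq_zero hj (by omega) hkn
  refine ⟨(1 / 2 : ℂ) • contractExt n (isoBar n j) ω, ⟨?_, ?_, ?_⟩, ?_⟩
  · have hz : contractExt n (isoVec n j) (contractExt n (isoBar n j) ω) = 0 := by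
      rw [contractExt_contractExt, h2, map_zero, neg_zero]
    intro i hi
    rw [map_smul]
    rcases Nat.lt_or_ge i (2 * j) with hlt | hge
    · rw [contractExt_contractExt, h.contract i hlt, map_zero, neg_zero, smul_zero]
    · rcases (by omega : (i : ℕ) = 2 * j ∨ (i : ℕ) = 2 * j + 1) with hi2 | hi2
      · have : i = ⟨2 * j, by omega⟩ := Fin.ext hi2
        rw [this, single_even_eq hj', map_smul, map_add, LinearMap.smul_apply,
          LinearMap.add_apply, hz, contractExt_self]
        simp
      · have : i = ⟨2 * j + 1, hj'⟩ := Fin.ext hi2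
        rw [this, single_odd_eq hj', map_smul, map_sub, LinearMap.smul_apply,
          LinearMap.sub_apply, hz, contractExt_self]
        simp
  · rw [map_smul, extDegree_contractExt, h.degree, map_smul]
    push_cast
    module
  · intro l hl i hi
    rw [map_smul, rootExt_contractExt, h.root l (by omega) i hi, map_zero, smul_zero]
    · rw [isoBar_dotProduct_isoVec hj', if_neg (by omega)]
    · exact isoBar_dotProduct_single (Or.inr (by omega))
  · have e2 := contractExt_wedgeExt (isoBar n j) (isoVec n j) ω
    rw [h1, map_zero, isoBar_dotProduct_isoVec hj', if_pos rfl] at e2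
    rw [map_smul, ← sub_eq_zero.mp e2.symm, smul_smul]
    norm_num

/-- `τ ↦ z_j ∧ z_{j+1} ∧ ⋯ ∧ z_{j+s-1} ∧ τ`. -/
def chain (n : ℕ) : ℕ → ℕ → Module.End ℂ (Ext n)
  | _, 0 => LinearMap.id
  | j, s + 1 => wedgeExt n (isoVec n j) ∘ₗ chain n (j + 1) s

@[simp] theorem chain_zero (j : ℕ) (τ : Ext n) : chain n j 0 τ = τ := rfl

theorem chain_succ (j s : ℕ) (τ : Ext n) :
    chain n j (s + 1) τ = wedgeExt n (isoVec n j) (chain n (j + 1) s τ) := rfl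

theorem chain_succ' (j s : ℕ) (τ : Ext n) :
    chain n j (s + 1) τ = chain n j s (wedgeExt n (isoVec n (j + s)) τ) := by
  induction s generalizing j with
  | zero => rfl
  | succ s ih => rw [chain_succ, ih, chain_succ, add_right_comm, add_assoc]

/-- With a tail of degree at most `1`, the bound `2 (j + s) < n` leaves enough room for each of the
`s` peeling steps. -/
theorem IsTailSingular.eq_chain {k : ℕ} (hk : k ≤ 1) (s : ℕ) {j : ℕ} {ω : Ext n}
    (h : IsTailSingular j ((k + s : ℕ) : ℂ) ω) (hs : 2 * (j + s) < n ∨ s = 0) :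
    ∃ B, IsTailSingular (j + s) (k : ℂ) B ∧ ω = chain n j s B := by
  induction s generalizing j ω with
  | zero => exact ⟨ω, h, rfl⟩
  | succ s ih =>
    have hs' := hs.resolve_right (Nat.succ_ne_zero s)
    obtain ⟨B, hB, rfl⟩ := h.peel (k := k + s) (by omega) (by omega)
    obtain ⟨C, hC, rfl⟩ := ih hB (Or.inl (by omega))
    exact ⟨C, by rwa [add_right_comm, add_assoc] at hC, rfl⟩

theorem IsTailSingular.eq_smul_one {j : ℕ} {ω : Ext n} (h : IsTailSingular j 0 ω) :
    ∃ c : ℂ, ω = c • 1 :=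
  eq_smul_one_of_extDegree (by rw [h.degree, zero_smul])

/-- For odd `n` the index after the last isotropic pair gives the anisotropic vector `e_{n-1}`. This
convention lets one formula for the chain cover the `μ₁` generator also when `n = 2 p + 1`. -/
theorem isoVec_last {j : ℕ} (hj : n = 2 * j + 1) :
    isoVec n j = Pi.single ⟨2 * j, by omega⟩ 1 := by
  ext i
  simp only [isoVec, Pi.single_apply, Fin.ext_iff]
  split_ifs <;> first | omega | rfl

/-- With one or at least three directions left, only `z_j` can occur. With exactly two left there is
no root vector to exclude `z̄_j`; this is the origin of `μ₁'`. -/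
theorem IsTailSingular.eq_tail {j : ℕ} (hj : 2 * j < n) {ω : Ext n} (h : IsTailSingular j 1 ω) :
    ∃ a a' : ℂ, ω = a • wedgeExt n (isoVec n j) 1 + a' • wedgeExt n (isoBar n j) 1 ∧
      (n ≠ 2 * j + 2 → a' = 0) := by
  rcases (by omega : n = 2 * j + 1 ∨ n = 2 * j + 2 ∨ 2 * j + 2 < n) with hn | hn | hn
  · obtain ⟨c, hc⟩ := eq_smul_one_of_extDegree
      (ω := contractExt n (Pi.single ⟨2 * j, hj⟩ 1) ω)
      (by rw [extDegree_contractExt, h.degree, one_smul, sub_self])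
    refine ⟨c, 0, ?_, fun _ => rfl⟩
    have h2 := h.degree
    rw [one_smul, extDegree_apply, Finset.sum_eq_single (⟨2 * j, hj⟩ : Fin n), hc] at h2
    · rw [isoVec_last hn, ← map_smul, h2, zero_smul, add_zero]
    · intro i _ hi
      rw [h.contract i (by
        have := i.2
        have : (i : ℕ) ≠ 2 * j := fun h => hi (Fin.ext h)
        omega), map_zero]
    · simp
  · have hj' : 2 * j + 1 < n := by omega
    obtain ⟨c, hc⟩ := eq_smul_one_of_extDegree
      (ω := contractExt n (isoVec n j) ω)
      (by rw [extDegree_contractExt, h.degree, one_smul, sub_self])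
    obtain ⟨d, hd⟩ := eq_smul_one_of_extDegree
      (ω := contractExt n (isoBar n j) ω)
      (by rw [extDegree_contractExt, h.degree, one_smul, sub_self])
    refine ⟨1 / 2 * d, 1 / 2 * c, ?_, fun h => absurd hn h⟩
    have h2 := h.degree
    rw [one_smul, extDegree_apply, sum_eq_pair_add hj' _
      (fun i hi => by rw [h.contract i hi, map_zero]), pair_eq_iso _ _ hj', hc, hd,
      Finset.sum_eq_zero, add_zero] at h2
    · rw [← h2, map_smul, map_smul]
      module
    · intro i hi
      have := i.2
      have : 2 * j + 2 ≤ (i : ℕ) := by simpa using hi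
      omega
  · have h' : IsTailSingular j ((0 + 1 : ℕ) : ℂ) ω := by simpa using h
    obtain ⟨B, hB, rfl⟩ := h'.peel hn (by omega)
    obtain ⟨c, rfl⟩ := eq_smul_one_of_extDegree (ω := B) (by rw [hB.degree]; simp)
    exact ⟨c, 0, by rw [map_smul, zero_smul, add_zero], fun _ => rfl⟩

/-- Multiply the two resolutions `i(z) z̄ ∧ + z̄ ∧ i(z) = 2` and `i(z̄) z ∧ + z ∧ i(z̄) = 2`. The
four terms are the components of `ω` with neither, one or both of `z, z̄`, and in each of them
`i(z̄) i(z)` produces a form free of both. -/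
theorem eq_sum_components (hn : 1 < n) (ω : Ext n) :
    let z := isoVec n 0
    let zb := isoBar n 0
    ω = (1 / 4 : ℂ) • (
      -contractExt n zb (contractExt n z (wedgeExt n z (wedgeExt n zb ω))) +
      wedgeExt n z (contractExt n zb (contractExt n z (wedgeExt n zb ω))) -
      wedgeExt n zb (contractExt n zb (contractExt n z (wedgeExt n z ω))) -
      wedgeExt n z (wedgeExt n zb (contractExt n zb (contractExt n z ω)))) := by
  intro z zb
  have h0 : 2 * 0 + 1 < n := by omega
  have h1 : z ⬝ᵥ z = 0 := isoVec_dotProduct_isoVec h0 0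
  have h2 : zb ⬝ᵥ zb = 0 := isoBar_dotProduct_isoBar h0 0
  have h3 : z ⬝ᵥ zb = 2 := by rw [isoVec_dotProduct_isoBar h0, if_pos rfl]
  have h4 : zb ⬝ᵥ z = 2 := by rw [isoBar_dotProduct_isoVec h0, if_pos rfl]
  have e1 : ∀ x, wedgeExt n zb (wedgeExt n z x) = -wedgeExt n z (wedgeExt n zb x) :=
    wedgeExt_wedgeExt zb z
  have e2 : ∀ x, contractExt n zb (contractExt n z x) = -contractExt n z (contractExt n zb x) :=
    contractExt_contractExt zb z
  simp only [contractExt_wedgeExt, map_sub, map_smul, h1, h2, h3, h4, zero_smul, zero_sub,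
    e1, e2, map_neg]
  module

theorem isTailSingular_contract_pair (hn : 1 < n) {c : ℂ} {ω : Ext n} (h1 : IsRootKilled 1 ω)
    (h2 : extDegree n ω = (c + 2) • ω) :
    IsTailSingular 1 c (contractExt n (isoBar n 0) (contractExt n (isoVec n 0) ω)) := by
  have h0 : 2 * 0 + 1 < n := by omega
  refine ⟨?_, ?_, ?_⟩
  · intro i hi
    rcases (by omega : (i : ℕ) = 2 * 0 ∨ (i : ℕ) = 2 * 0 + 1) with hi2 | hi2
    · have : i = ⟨2 * 0, by omega⟩ := Fin.ext hi2
      rw [this, single_even_eq h0, map_smul, map_add, LinearMap.smul_apply,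
        LinearMap.add_apply, contractExt_self, contractExt_contractExt, contractExt_self]
      simp
    · have : i = ⟨2 * 0 + 1, h0⟩ := Fin.ext hi2
      rw [this, single_odd_eq h0, map_smul, map_sub, LinearMap.smul_apply,
        LinearMap.sub_apply, contractExt_self, contractExt_contractExt, contractExt_self]
      simp
  · simp only [extDegree_contractExt, h2, map_sub, map_smul]
    module
  · intro l hl i hi
    have a1 : isoBar n 0 ⬝ᵥ isoVec n l = 0 := by
      rw [isoBar_dotProduct_isoVec h0, if_neg (by omega)]
    have a2 : isoVec n 0 ⬝ᵥ isoVec n l = 0 := isoVec_dotProduct_isoVec h0 l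
    rw [rootExt_contractExt a1 (isoBar_dotProduct_single (Or.inr (by omega))),
      rootExt_contractExt a2 (isoVec_dotProduct_single (Or.inr (by omega))), h1 l hl i hi,
      map_zero, map_zero]

theorem IsRootKilled.wedge_isoVec_zero (hn : 1 < n) {ω : Ext n} (h : IsRootKilled 1 ω) :
    IsRootKilled 1 (wedgeExt n (isoVec n 0) ω) := by
  intro l hl i hi
  have h0 : 2 * 0 + 1 < n := by omega
  rw [rootExt_wedgeExt, h l hl i hi, map_zero]
  · rw [dotProduct_comm, isoVec_dotProduct_isoVec h0]
  · exact single_dotProduct_isoVec (Or.inr (by omega))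

theorem IsRootKilled.wedge_isoBar_zero (hn : 1 < n) {ω : Ext n} (h : IsRootKilled 1 ω) :
    IsRootKilled 1 (wedgeExt n (isoBar n 0) ω) := by
  intro l hl i hi
  have h0 : 2 * 0 + 1 < n := by omega
  rw [rootExt_wedgeExt, h l hl i hi, map_zero]
  · rw [dotProduct_comm, isoBar_dotProduct_isoVec h0, if_neg (by omega)]
  · exact single_dotProduct_isoBar (Or.inr (by omega))

/-- The highest weight vectors for `𝔰𝔬(n - 2)` in `Λ^{p+1}`. -/
theorem IsRootKilled.classification {p : ℕ} (hpn : 2 * (p + 1) < n) {ω : Ext n}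
    (h1 : IsRootKilled 1 ω) (h2 : extDegree n ω = ((p + 1 : ℕ) : ℂ) • ω) :
    ∃ a a' b c d : ℂ, ω = a • chain n 1 (p + 1) 1 +
      a' • chain n 1 p (wedgeExt n (isoBar n (p + 1)) 1) +
      b • wedgeExt n (isoVec n 0) (chain n 1 p 1) + c • wedgeExt n (isoBar n 0) (chain n 1 p 1) +
      d • wedgeExt n (isoBar n 0) (wedgeExt n (isoVec n 0) (chain n 1 (p - 1) 1)) ∧
      (n ≠ 2 * (p + 1) + 2 → a' = 0) ∧ (p = 0 → d = 0) := by
  have hn : 1 < n := by omega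
  push_cast at h2
  -- `A, B, C, D` are the coefficients of `1`, `z₀`, `z̄₀` and `z₀ ∧ z̄₀` up to scalars, of degrees
  -- `p + 1, p, p, p - 1`. Each is singular for `𝔰𝔬(n - 2)`.
  have hA := isTailSingular_contract_pair hn (c := ((1 + p : ℕ) : ℂ))
    ((h1.wedge_isoBar_zero hn).wedge_isoVec_zero hn) (by
    rw [extDegree_wedgeExt, extDegree_wedgeExt, h2]; simp only [map_smul, map_add]; push_cast; module)
  have hB := isTailSingular_contract_pair hn (c := ((0 + p : ℕ) : ℂ)) (h1.wedge_isoBar_zero hn) (by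
    rw [extDegree_wedgeExt, h2, map_smul]; push_cast; module)
  have hC := isTailSingular_contract_pair hn (c := ((0 + p : ℕ) : ℂ)) (h1.wedge_isoVec_zero hn) (by
    rw [extDegree_wedgeExt, h2, map_smul]; push_cast; module)
  have hD := isTailSingular_contract_pair hn (c := (p : ℂ) - 1) h1 (by rw [h2]; module)
  obtain ⟨A, hA1, hA2⟩ := hA.eq_chain le_rfl p (Or.inl (by omega))
  obtain ⟨B, hB1, hB2⟩ := hB.eq_chain zero_le_one p (Or.inl (by omega))
  obtain ⟨C, hC1, hC2⟩ := hC.eq_chain zero_le_one p (Or.inl (by omega))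
  obtain ⟨a, a', rfl, ha'⟩ := IsTailSingular.eq_tail (n := n) (j := 1 + p) (by omega) (by simpa using hA1)
  obtain ⟨b, rfl⟩ := IsTailSingular.eq_smul_one (n := n) (j := 1 + p) (by simpa using hB1)
  obtain ⟨c, rfl⟩ := IsTailSingular.eq_smul_one (n := n) (j := 1 + p) (by simpa using hC1)
  obtain ⟨d, hd, hd0⟩ : ∃ d : ℂ, contractExt n (isoBar n 0) (contractExt n (isoVec n 0) ω) =
      d • chain n 1 (p - 1) 1 ∧ (p = 0 → d = 0) := by
    -- For `p = 0` the degree of `D` is `-1`, so it vanishes, whereas `chain n 1 (p - 1)` would be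
    -- read with the truncated length `0`.
    rcases Nat.eq_zero_or_pos p with rfl | hp
    · refine ⟨0, ?_, fun _ => rfl⟩
      rw [zero_smul]
      refine eq_zero_of_extDegree (fun k hk => ?_) hD.degree
      have h3 : ((k + 1 : ℕ) : ℂ) = 0 := by
        push_cast
        rw [← hk]
        simp
      exact Nat.succ_ne_zero k (by exact_mod_cast h3)
    · have hD' : IsTailSingular 1 ((0 + (p - 1) : ℕ) : ℂ)
          (contractExt n (isoBar n 0) (contractExt n (isoVec n 0) ω)) := by
        rw [zero_add, Nat.cast_sub hp, Nat.cast_one]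
        exact hD
      obtain ⟨D, hD1, hD2⟩ := hD'.eq_chain zero_le_one (p - 1) (Or.inl (by omega))
      obtain ⟨d, rfl⟩ := IsTailSingular.eq_smul_one (j := 1 + (p - 1)) (by simpa using hD1)
      exact ⟨d, by rw [hD2, map_smul], by omega⟩
  have key := eq_sum_components hn ω
  simp only [hA2, hB2, hC2, hd, map_smul, map_add] at key
  have hc1 : chain n 1 p (wedgeExt n (isoVec n (1 + p)) 1) = chain n 1 (p + 1) 1 :=
    (chain_succ' 1 p 1).symm
  rw [hc1, wedgeExt_wedgeExt (isoVec n 0) (isoBar n 0)] at key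
  refine ⟨-(1 / 4) * a, -(1 / 4) * a', (1 / 4) * b, -(1 / 4) * c, (1 / 4) * d, ?_, ?_, ?_⟩
  · rw [key, add_comm 1 p]
    module
  · intro h
    rw [ha' (by omega), mul_zero]
  · intro h
    rw [hd0 h, mul_zero]

/-! ### Chains of isotropic vectors -/

/-- Vectors with distinct indices have disjoint supports; no bound on the indices is needed, so the
truncated last vector is covered. -/
theorem isoBar_dotProduct_isoVec_of_ne {j k : ℕ} (hjk : j ≠ k) :
    isoBar n j ⬝ᵥ isoVec n k = 0 := by
  refine Finset.sum_eq_zero fun i _ => ?_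
  simp only [isoBar, isoVec]
  split_ifs <;> first | omega | simp

theorem isoBar_dotProduct_isoVec_self_ne_zero {j : ℕ} (hj : 2 * j < n) :
    isoBar n j ⬝ᵥ isoVec n j ≠ 0 := by
  rcases (by omega : n = 2 * j + 1 ∨ 2 * j + 1 < n) with h | h
  · rw [isoVec_last h, dotProduct_single_one]
    simp [isoBar]
  · rw [isoBar_dotProduct_isoVec h, if_pos rfl]
    exact two_ne_zero

theorem contractExt_chain {u : Fin n → ℂ} {τ : Ext n} (h : contractExt n u τ = 0) (s j : ℕ)
    (hu : ∀ k, j ≤ k → k < j + s → u ⬝ᵥ isoVec n k = 0) : contractExt n u (chain n j s τ) = 0 := by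
  induction s generalizing j with
  | zero => exact h
  | succ s ih =>
    rw [chain_succ, contractExt_wedgeExt, hu j le_rfl (by omega), zero_smul, zero_sub,
      ih (j + 1) (fun k h1 h2 => hu k (by omega) (by omega)), map_zero, neg_zero]

theorem wedgeExt_chain_of_mem {l : ℕ} (τ : Ext n) (s j : ℕ) (h1 : j ≤ l) (h2 : l < j + s) :
    wedgeExt n (isoVec n l) (chain n j s τ) = 0 := by
  induction s generalizing j with
  | zero => omega
  | succ s ih =>
    rw [chain_succ]
    rcases Nat.eq_or_lt_of_le h1 with rfl | h
    · rw [wedgeExt_self]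
    · rw [wedgeExt_wedgeExt, ih (j + 1) h (by omega), map_zero, neg_zero]

theorem wedgeExt_ne_zero {u v : Fin n → ℂ} (h : v ⬝ᵥ u ≠ 0) {ω : Ext n} (h1 : ω ≠ 0)
    (h2 : contractExt n v ω = 0) : wedgeExt n u ω ≠ 0 := by
  intro h0
  have h3 := contractExt_wedgeExt v u ω
  rw [h0, h2, map_zero, map_zero, sub_zero, eq_comm, smul_eq_zero] at h3
  exact h3.elim h h1

/-- Contraction with `z̄_j` recovers the rest of the chain. The bound `n + 1` admits `e_{n-1}` as
the last factor in odd dimension. -/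
theorem chain_ne_zero {τ : Ext n} (hτ : τ ≠ 0) (s j : ℕ) (hs : 2 * (j + s) ≤ n + 1)
    (h : ∀ k, j ≤ k → k < j + s → contractExt n (isoBar n k) τ = 0) : chain n j s τ ≠ 0 := by
  induction s generalizing j with
  | zero => exact hτ
  | succ s ih =>
    rw [chain_succ]
    refine wedgeExt_ne_zero (isoBar_dotProduct_isoVec_self_ne_zero (by omega))
      (ih (j + 1) (by omega) fun k h1 h2 => h k (by omega) (by omega)) ?_
    exact contractExt_chain (h j le_rfl (by omega)) _ _
      fun k h1 _ => isoBar_dotProduct_isoVec_of_ne (by omega)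

theorem extDegree_chain {τ : Ext n} {c : ℂ} (hτ : extDegree n τ = c • τ) (s j : ℕ) :
    extDegree n (chain n j s τ) = (c + s) • chain n j s τ := by
  induction s generalizing j with
  | zero => simp [hτ]
  | succ s ih =>
    rw [chain_succ, extDegree_wedgeExt, ih, map_smul]
    push_cast
    module

/-- The action of `z_j ∧ z̄_j` on the exterior algebra. -/
def cartanExt (n j : ℕ) : Module.End ℂ (Ext n) :=
  wedgeExt n (isoVec n j) ∘ₗ contractExt n (isoBar n j) -
    wedgeExt n (isoBar n j) ∘ₗ contractExt n (isoVec n j)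

theorem cartanExt_apply (j : ℕ) (ω : Ext n) : cartanExt n j ω =
    wedgeExt n (isoVec n j) (contractExt n (isoBar n j) ω) -
      wedgeExt n (isoBar n j) (contractExt n (isoVec n j) ω) := rfl

theorem cartanExt_wedgeExt (j : ℕ) (u : Fin n → ℂ) (ω : Ext n) :
    cartanExt n j (wedgeExt n u ω) = (isoBar n j ⬝ᵥ u) • wedgeExt n (isoVec n j) ω -
      (isoVec n j ⬝ᵥ u) • wedgeExt n (isoBar n j) ω + wedgeExt n u (cartanExt n j ω) := by
  simp only [cartanExt_apply, contractExt_wedgeExt, map_sub, map_smul, wedgeExt_wedgeExt u]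
  module

theorem cartanExt_one (j : ℕ) : cartanExt n j 1 = 0 := by
  simp [cartanExt_apply, contractExt_one]

/-- `cartanExt` lacks the factor `1 / 2` of `cartan`, so each factor `z_l` contributes `2`. -/
theorem cartanExt_chain {l : ℕ} (hl : 2 * l + 1 < n) {τ : Ext n} {c : ℂ}
    (hτ : cartanExt n l τ = c • τ) (s j : ℕ) : cartanExt n l (chain n j s τ) =
      (c + if j ≤ l ∧ l < j + s then 2 else 0) • chain n j s τ := by
  induction s generalizing j with
  | zero => rw [chain_zero, hτ, if_neg (by omega), add_zero]
  | succ s ih =>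
    rw [chain_succ, cartanExt_wedgeExt, ih, isoBar_dotProduct_isoVec hl,
      isoVec_dotProduct_isoVec hl, zero_smul, sub_zero, map_smul]
    by_cases h : l = j
    · subst h
      rw [if_pos rfl, if_neg (by omega), if_pos (by omega)]
      module
    · rw [if_neg h, zero_smul, zero_add]
      congr 3
      simp only [eq_iff_iff]
      omega

/-- For `l < s` the chain contains `z_l`, so both `z_l ∧` and `i(z_l)` annihilate it. For `l ≥ s`
the root vector passes through the chain and meets `τ`. -/
theorem isRootKilled_chain {τ : Ext n} {s : ℕ} (h1 : IsRootKilled s τ)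
    (h2 : ∀ l < s, 2 * l + 1 < n → contractExt n (isoVec n l) τ = 0) :
    IsRootKilled 0 (chain n 0 s τ) := by
  intro l _ i hi
  have hl : 2 * l + 1 < n := by omega
  rcases Nat.lt_or_ge l s with h | h
  · have h3 : contractExt n (isoVec n l) (chain n 0 s τ) = 0 :=
      contractExt_chain (h2 l h hl) _ _ fun k _ _ => isoVec_dotProduct_isoVec hl k
    have h4 : wedgeExt n (isoVec n l) (chain n 0 s τ) = 0 :=
      wedgeExt_chain_of_mem τ s 0 (Nat.zero_le l) (by omega)
    have h5 := contractExt_wedgeExt (Pi.single i 1) (isoVec n l) (chain n 0 s τ)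
    rw [h4, map_zero, single_dotProduct_isoVec (Or.inr hi), zero_smul, zero_sub, zero_eq_neg] at h5
    rw [rootExt_apply, h3, h5, map_zero, sub_zero]
  · have h4 : ∀ t j : ℕ, j + t ≤ l → rootExt n l i (chain n j t τ) =
        chain n j t (rootExt n l i τ) := by
      intro t
      induction t with
      | zero => intros; rfl
      | succ t ih =>
        intro j hj
        rw [chain_succ, rootExt_wedgeExt (isoVec_dotProduct_isoVec hl j)
          (single_dotProduct_isoVec (by omega)), ih (j + 1) (by omega), chain_succ]
    rw [h4 s 0 (by omega), h1 l h i hi, map_zero]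

theorem isRootKilled_one (j : ℕ) : IsRootKilled j (1 : Ext n) := by
  intro l _ i _
  simp [rootExt_apply, contractExt_one]

/-! ### Singular vectors and weights -/

/-- `φ` is killed by the root vectors of all positive roots. -/
def IsSingular (φ : FormPoly n) : Prop :=
  ∀ (l : ℕ) (i : Fin n), 2 * l + 2 ≤ (i : ℕ) →
    ⁅(skew (isoVec n l) (Pi.single i 1) : soC n), φ⁆ = 0

/-- `φ` is a weight vector of weight `w`. -/
def HasWeight (w : Fin (n / 2) → ℤ) (φ : FormPoly n) : Prop :=
  ∀ j, ⁅(cartan j : soC n), φ⁆ = (w j : ℂ) • φ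

theorem skew_add_left (u u' v : Fin n → ℂ) : (skew (u + u') v : soC n) = skew u v + skew u' v :=
  Subtype.ext (by simp [skew, Matrix.add_vecMulVec, Matrix.vecMulVec_add]; abel)

theorem skew_smul_left (c : ℂ) (u v : Fin n → ℂ) : (skew (c • u) v : soC n) = c • skew u v :=
  Subtype.ext (by simp [skew, Matrix.smul_vecMulVec, Matrix.vecMulVec_smul, smul_sub])

theorem skew_swap (u v : Fin n → ℂ) : (skew u v : soC n) = -skew v u :=
  Subtype.ext (by simp [skew])

theorem skew_self (u : Fin n → ℂ) : (skew u u : soC n) = 0 :=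
  Subtype.ext (by simp [skew])

/-- `skew` as a bilinear map. -/
def skewHom (n : ℕ) : (Fin n → ℂ) →ₗ[ℂ] (Fin n → ℂ) →ₗ[ℂ] soC n :=
  LinearMap.mk₂ ℂ skew skew_add_left skew_smul_left
    (fun u v v' => by
      rw [skew_swap, skew_add_left, neg_add, ← skew_swap, ← skew_swap])
    (fun c u v => by rw [skew_swap, skew_smul_left, ← smul_neg, ← skew_swap])

theorem skewHom_apply (u v : Fin n → ℂ) : skewHom n u v = skew u v := rfl

theorem lie_cartan (j : Fin (n / 2)) (φ : FormPoly n) : ⁅(cartan j : soC n), φ⁆ =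
    (1 / 2 : ℂ) • ⁅(skew (isoVec n j) (isoBar n j) : soC n), φ⁆ := by
  rw [cartan, zvec_eq, zbar_eq]
  exact smul_lie _ _ _

theorem IsSingular.map {T : Module.End ℂ (FormPoly n)} (hT : IsInvariant T) {φ : FormPoly n}
    (h : IsSingular φ) : IsSingular (T φ) := fun l i hi => by rw [hT, h l i hi, map_zero]

theorem HasWeight.map {T : Module.End ℂ (FormPoly n)} (hT : IsInvariant T) {φ : FormPoly n}
    {w : Fin (n / 2) → ℤ} (h : HasWeight w φ) : HasWeight w (T φ) :=
  fun j => by rw [hT, h j, map_smul]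

/-! ### The forms `⟨z₀, x⟩^a ⊗ η` -/

/-- The form `⟨z₀, x⟩^a ⊗ η`. -/
def powForm (a : ℕ) (η : Ext n) : FormPoly n := (linForm n (isoVec n 0) ^ a) ⊗ₜ η

theorem derivForm_powForm (w : Fin n → ℂ) (a : ℕ) (η : Ext n) : derivForm n w (powForm a η) =
    ((a : ℂ) * (w ⬝ᵥ isoVec n 0)) • powForm (a - 1) η := by
  rw [powForm, derivForm_tmul, Derivation.leibniz_pow, dirDeriv_linForm, powForm,
    TensorProduct.smul_tmul', smul_eq_mul, ← MvPolynomial.C_mul', MvPolynomial.C_mul, mul_comm _ (MvPolynomial.C _), nsmul_eq_mul,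
    map_natCast, mul_assoc]

theorem mulForm_powForm (a : ℕ) (η : Ext n) : mulForm n (isoVec n 0) (powForm a η) =
    powForm (a + 1) η := by
  rw [powForm, mulForm_tmul, ← pow_succ', powForm]

theorem wedgeForm_powForm (w : Fin n → ℂ) (a : ℕ) (η : Ext n) :
    wedgeForm n w (powForm a η) = powForm a (wedgeExt n w η) := rfl

theorem contractForm_powForm (w : Fin n → ℂ) (a : ℕ) (η : Ext n) :
    contractForm n w (powForm a η) = powForm a (contractExt n w η) := rfl

theorem powForm_smul (a : ℕ) (c : ℂ) (η : Ext n) : powForm a (c • η) = c • powForm a η :=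
  TensorProduct.tmul_smul _ _ _

theorem powForm_zero (a : ℕ) : powForm a (0 : Ext n) = 0 := TensorProduct.tmul_zero _ _

theorem powForm_sub (a : ℕ) (η η' : Ext n) : powForm a (η - η') = powForm a η - powForm a η' :=
  TensorProduct.tmul_sub _ _ _

theorem skew_lie_powForm_of_orthogonal {u v : Fin n → ℂ} (hu : u ⬝ᵥ isoVec n 0 = 0)
    (hv : v ⬝ᵥ isoVec n 0 = 0) (a : ℕ) (η : Ext n) :
    ⁅(skew u v : soC n), powForm a η⁆ =
      powForm a (wedgeExt n u (contractExt n v η) - wedgeExt n v (contractExt n u η)) := by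
  rw [skew_lie, derivForm_powForm, derivForm_powForm, hu, hv, powForm_sub]
  simp only [mul_zero, zero_smul, map_zero, sub_zero, zero_add]
  rfl

theorem isSingular_powForm {η : Ext n} (h : IsRootKilled 0 η) (a : ℕ) :
    IsSingular (powForm a η) := by
  intro l i hi
  rw [skew_lie_powForm_of_orthogonal (isoVec_dotProduct_isoVec (by omega) 0)
    (single_dotProduct_isoVec (by omega)), ← rootExt_apply, h l (Nat.zero_le l) i hi, powForm_zero]

theorem hasWeight_powForm {w : Fin (n / 2) → ℤ} {a : ℕ} {η : Ext n}
    (h : ∀ j : Fin (n / 2), cartanExt n j η =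
      (2 * ((w j : ℂ) - if (j : ℕ) = 0 then (a : ℂ) else 0)) • η) : HasWeight w (powForm a η) := by
  intro j
  have hj : 2 * (j : ℕ) + 1 < n := by omega
  have h1 : wedgeForm n (isoVec n j) (contractForm n (isoBar n j) (powForm a η)) -
      wedgeForm n (isoBar n j) (contractForm n (isoVec n j) (powForm a η)) =
      (2 * ((w j : ℂ) - if (j : ℕ) = 0 then (a : ℂ) else 0)) • powForm a η := by
    rw [← powForm_smul, ← h j, cartanExt_apply, powForm_sub]
    rfl
  rw [lie_cartan, skew_lie, derivForm_powForm, derivForm_powForm, h1,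
    isoVec_dotProduct_isoVec hj, isoBar_dotProduct_isoVec hj, mul_zero, zero_smul, map_zero,
    sub_zero, map_smul]
  rcases Nat.eq_zero_or_pos (j : ℕ) with h0 | h0
  · rw [h0, if_pos rfl, if_pos rfl, mulForm_powForm]
    rcases Nat.eq_zero_or_pos a with rfl | ha
    · simp only [Nat.cast_zero, zero_mul, zero_smul]
      module
    · rw [Nat.sub_add_cancel ha]
      module
  · rw [if_neg h0.ne', if_neg h0.ne', mul_zero, zero_smul]
    module

/-- A harmonic form of degrees `a`, `k` that is closed and coclosed. -/
structure IsBaseForm (a k : ℂ) (φ : FormPoly n) : Prop where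
  extD : extD n φ = 0
  coD : coD n φ = 0
  lap : lapForm n φ = 0
  euler : eulerForm n φ = a • φ
  deg : degForm n φ = k • φ

/-- All derivatives of `⟨z₀, x⟩^a` point in the direction `z₀`. So `d` and `d^*` reduce to multiples
of `z₀ ∧` and `i(z₀)`, and the Laplacian to a multiple of `⟨z₀, z₀⟩ = 0`. The alternative `a = 0`
admits the constant `1`. -/
theorem isBaseForm_powForm (hn : 1 < n) {a : ℕ} {k : ℂ} {η : Ext n} (h1 : extDegree n η = k • η)
    (h2 : a = 0 ∨ wedgeExt n (isoVec n 0) η = 0 ∧ contractExt n (isoVec n 0) η = 0) :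
    IsBaseForm (a : ℂ) k (powForm a η) := by
  have h0 : 2 * 0 + 1 < n := by omega
  have h3 : ∀ (T : (Fin n → ℂ) →ₗ[ℂ] Module.End ℂ (FormPoly n)),
      ∑ i, T (Pi.single i 1) (derivForm n (Pi.single i 1) (powForm a η)) =
      (a : ℂ) • T (isoVec n 0) (powForm (a - 1) η) := by
    intro T
    simp only [derivForm_powForm, map_smul, mul_smul, ← Finset.smul_sum, sum_dotProduct_smul]
  refine ⟨?_, ?_, ?_, ?_, ?_⟩
  · rw [extD_apply, h3, wedgeForm_powForm]
    rcases h2 with rfl | h2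
    · rw [Nat.cast_zero, zero_smul]
    · rw [h2.1, powForm_zero, smul_zero]
  · rw [coD_apply, h3, contractForm_powForm, neg_eq_zero]
    rcases h2 with rfl | h2
    · rw [Nat.cast_zero, zero_smul]
    · rw [h2.2, powForm_zero, smul_zero]
  · rw [lapForm_apply, h3, derivForm_powForm, isoVec_dotProduct_isoVec h0, mul_zero, zero_smul,
      smul_zero]
  · rw [eulerForm_apply, h3, mulForm_powForm]
    rcases Nat.eq_zero_or_pos a with rfl | ha
    · rw [Nat.cast_zero, zero_smul, zero_smul]
    · rw [Nat.sub_add_cancel ha]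
  · rw [powForm, degForm_tmul, h1, TensorProduct.tmul_smul]

/-- `(n + 2 a) x_∧ i(x) - (a + k) |x|²`, which maps closed and coclosed harmonic forms of degrees
`a`, `k` to harmonic forms. -/
def mixForm (n : ℕ) (a k : ℂ) : Module.End ℂ (FormPoly n) :=
  ((n : ℂ) + 2 * a) • (wedgeX n ∘ₗ interX n) - (a + k) • radForm n

theorem mixForm_apply (a k : ℂ) (φ : FormPoly n) : mixForm n a k φ =
    ((n : ℂ) + 2 * a) • wedgeX n (interX n φ) - (a + k) • radForm n φ := rfl

theorem isInvariant_mixForm (a k : ℂ) : IsInvariant (mixForm n a k) :=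
  ((isInvariant_wedgeX.comp isInvariant_interX).smul _).sub (isInvariant_radForm.smul _)

namespace IsBaseForm

variable {a k : ℂ} {φ : FormPoly n}

theorem opE_self (h : IsBaseForm a k φ) : opE n φ = 0 := by
  rw [opE_apply, h.extD, h.coD, map_zero, map_zero, sub_zero]

/-- Cartan's formula gives `d i(x) φ = (a + k) φ` as `φ` is closed, while `i(x) φ` remains coclosed.
The next lemma is the dual computation. -/
theorem opE_interX (h : IsBaseForm a k φ) : opE n (interX n φ) = (a + k) • interX n φ := by
  rw [opE_apply, extD_interX, coD_interX, h.extD, h.coD, h.euler, h.deg, ← add_smul, map_zero,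
    neg_zero, map_zero, sub_zero, sub_zero, map_smul]

theorem opE_wedgeX (h : IsBaseForm a k φ) :
    opE n (wedgeX n φ) = (a + n - k) • wedgeX n φ := by
  rw [opE_apply, extD_wedgeX, coD_wedgeX, h.extD, h.coD, h.euler, h.deg, ← add_smul, ← sub_smul,
    map_zero, neg_zero, map_zero, sub_zero, map_neg, map_smul, zero_sub, neg_neg]

theorem opE_mixForm (h : IsBaseForm a k φ) :
    opE n (mixForm n a k φ) = ((n : ℂ) + 2 * a + 2) • mixForm n a k φ := by
  simp only [opE_apply, mixForm_apply, map_sub, map_smul, extD_wedgeX, coD_wedgeX, extD_interX,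
    coD_interX, extD_radForm, coD_radForm, eulerForm_interX, degForm_interX, interX_wedgeX,
    h.extD, h.coD, h.euler, h.deg, map_add, map_neg, map_zero]
  module

theorem harmonic_interX {q p : ℕ} (h : IsBaseForm a k φ) (hq : (q : ℂ) = a + 1)
    (hp : (p : ℂ) = k - 1) : interX n φ ∈ harmonicForms n q p := by
  rw [mem_harmonicForms_iff, eulerForm_interX, lapForm_interX, degForm_interX, h.coD, h.lap,
    h.euler, h.deg, hq, hp]
  simp only [map_smul, map_zero]
  refine ⟨?_, ?_, ?_⟩ <;> module

theorem harmonic_wedgeX {q p : ℕ} (h : IsBaseForm a k φ) (hq : (q : ℂ) = a + 1)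
    (hp : (p : ℂ) = k + 1) : wedgeX n φ ∈ harmonicForms n q p := by
  rw [mem_harmonicForms_iff, eulerForm_wedgeX, lapForm_wedgeX, degForm_wedgeX, h.extD, h.lap,
    h.euler, h.deg, hq, hp]
  simp only [map_smul, map_zero]
  refine ⟨?_, ?_, ?_⟩ <;> module

/-- On such `φ` the operator `∑ ∂²/∂xᵢ²` sends `x_∧ i(x) φ` to `2 (a + k) φ` and `|x|² φ` to `(2 n +
4 a) φ`; the coefficients of `mixForm` are those that cancel. -/
theorem harmonic_mixForm {q p : ℕ} (h : IsBaseForm a k φ) (hq : (q : ℂ) = a + 2)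
    (hp : (p : ℂ) = k) : mixForm n a k φ ∈ harmonicForms n q p := by
  rw [mem_harmonicForms_iff, hq, hp]
  simp only [mixForm_apply, map_sub, map_smul, eulerForm_wedgeX, eulerForm_interX,
    eulerForm_radForm, lapForm_wedgeX, lapForm_interX, lapForm_radForm, degForm_wedgeX,
    degForm_interX, degForm_radForm, extD_interX, h.extD, h.coD, h.lap, h.euler, h.deg,
    map_add, map_neg, map_zero]
  refine ⟨?_, ?_, ?_⟩ <;> module

end IsBaseForm

/-- The normalization of the point `z̄₀ / 2` makes `⟨z₀, x⟩` equal to `1` there. -/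
theorem evalForm_powForm (hn : 1 < n) (a : ℕ) (η : Ext n) :
    evalForm ((1 / 2 : ℂ) • isoBar n 0) (powForm a η) = η := by
  rw [powForm, evalForm_tmul, map_pow, aeval_linForm, dotProduct_smul,
    isoVec_dotProduct_isoBar (by omega), if_pos rfl, smul_eq_mul]
  norm_num

/-! ### The highest weight vectors -/

/-- `v` is a highest weight vector of weight `w` in `H^q ⊗ Λ^p` on which `E` is `c`. -/
structure IsGenerator (n q p : ℕ) (w : Fin (n / 2) → ℤ) (c : ℂ) (v : FormPoly n) : Prop where
  singular : IsSingular v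
  weight : HasWeight w v
  eigen : opE n v = c • v
  mem : v ∈ harmonicForms n q p
  ne_zero : v ≠ 0

theorem isSingular_chain_one (a s : ℕ) : IsSingular (powForm a (chain n 0 s 1)) :=
  isSingular_powForm (isRootKilled_chain (isRootKilled_one s) fun _ _ _ => contractExt_one _) a

theorem hasWeight_chain_one {a s k : ℕ} {b : ℤ} (h1 : b = a + if 0 < s then 1 else 0)
    (h2 : ∀ j, 1 ≤ j → j < n / 2 → (j < s ↔ j ≤ k)) :
    HasWeight (hookWeight n b k) (powForm a (chain n 0 s 1)) := by
  refine hasWeight_powForm fun j => ?_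
  rw [cartanExt_chain (by omega) (c := 0) (by rw [cartanExt_one, zero_smul])]
  congr 1
  have h3 := h2 j
  rcases Nat.eq_zero_or_pos (j : ℕ) with h0 | h0
  · simp only [hookWeight, h0, h1, if_true]
    rcases Nat.eq_zero_or_pos s with rfl | hs
    · simp
    · simp [hs]
  · simp only [hookWeight, if_neg h0.ne']
    by_cases h4 : (j : ℕ) ≤ k
    · rw [if_pos h4, if_pos ⟨Nat.zero_le _, by have := (h3 h0 j.2).mpr h4; omega⟩]
      norm_num
    · rw [if_neg h4, if_neg (by have := (h3 h0 j.2).not.mpr h4; omega)]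
      norm_num

theorem isBaseForm_chain (hn : 1 < n) {τ : Ext n} {c : ℂ} (h1 : extDegree n τ = c • τ)
    (h2 : contractExt n (isoVec n 0) τ = 0) (a : ℕ) {s : ℕ} (hs : 1 ≤ s) :
    IsBaseForm (a : ℂ) (c + s) (powForm a (chain n 0 s τ)) := by
  refine isBaseForm_powForm hn (extDegree_chain h1 _ _) (Or.inr ⟨?_, ?_⟩)
  · exact wedgeExt_chain_of_mem τ s 0 le_rfl (by omega)
  · exact contractExt_chain h2 _ _ fun k _ _ => isoVec_dotProduct_isoVec (by omega) k

theorem isBaseForm_chain_one (hn : 1 < n) (a : ℕ) {s : ℕ} (hs : 1 ≤ s) :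
    IsBaseForm (a : ℂ) s (powForm a (chain n 0 s 1)) := by
  have := isBaseForm_chain hn (τ := 1) (c := 0) (by rw [extDegree_one, zero_smul])
    (contractExt_one _) a hs
  rwa [zero_add] at this

theorem ne_zero_of_evalForm {P : Fin n → ℂ} {φ : FormPoly n} {c : ℂ} {ω : Ext n}
    (h : evalForm P φ = c • ω) (hc : c ≠ 0) (hω : ω ≠ 0) : φ ≠ 0 := by
  rintro rfl
  rw [map_zero, eq_comm, smul_eq_zero] at h
  exact h.elim hc hω

theorem evalForm_interX_chain (hn : 1 < n) (a s : ℕ) {τ : Ext n}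
    (hτ : contractExt n (isoBar n 0) τ = 0) :
    evalForm ((1 / 2 : ℂ) • isoBar n 0) (interX n (powForm a (chain n 0 (s + 1) τ))) =
      chain n 1 s τ := by
  rw [evalForm_interX, evalForm_powForm hn, chain_succ, map_smul, LinearMap.smul_apply,
    contractExt_wedgeExt, isoBar_dotProduct_isoVec (by omega), if_pos rfl,
    contractExt_chain hτ _ _ fun k _ _ => isoBar_dotProduct_isoVec_of_ne (by omega)]
  rw [map_zero, sub_zero, smul_smul]
  norm_num

theorem evalForm_wedgeX_powForm (hn : 1 < n) (a : ℕ) (η : Ext n) :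
    evalForm ((1 / 2 : ℂ) • isoBar n 0) (wedgeX n (powForm a η)) =
      (1 / 2 : ℂ) • wedgeExt n (isoBar n 0) η := by
  rw [evalForm_wedgeX, evalForm_powForm hn, map_smul, LinearMap.smul_apply]

/-- The point is isotropic, so the term with `|x|²` drops out. -/
theorem evalForm_mixForm (hn : 1 < n) (a s : ℕ) (b k : ℂ) :
    evalForm ((1 / 2 : ℂ) • isoBar n 0) (mixForm n b k (powForm a (chain n 0 (s + 1) 1))) =
      ((n + 2 * b) / 2) • wedgeExt n (isoBar n 0) (chain n 1 s 1) := by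
  rw [mixForm_apply, map_sub, map_smul, map_smul, evalForm_wedgeX, evalForm_radForm,
    evalForm_interX_chain hn _ _ (contractExt_one _), smul_dotProduct, dotProduct_smul,
    isoBar_dotProduct_isoBar (by omega), map_smul, LinearMap.smul_apply, smul_smul]
  simp only [smul_zero, zero_smul, sub_zero]
  congr 1
  ring

theorem chain_one_ne_zero {j s : ℕ} (hs : 2 * (j + s) ≤ n + 1) : chain n j s (1 : Ext n) ≠ 0 := by
  have : Nontrivial (Ext n) := ⟨⟨0, 1, by
    rw [← extBasis_empty]; exact ((extBasis n).ne_zero _).symm⟩⟩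
  exact chain_ne_zero one_ne_zero s j hs fun k _ _ => contractExt_one _

theorem contractExt_wedgeExt_one (u v : Fin n → ℂ) :
    contractExt n u (wedgeExt n v 1) = (u ⬝ᵥ v) • 1 := by
  rw [contractExt_wedgeExt, contractExt_one, map_zero, sub_zero]

theorem wedgeExt_isoBar_chain_ne_zero {j s k : ℕ} (hjs : 2 * (j + s) ≤ n + 1)
    (hk : 2 * k + 1 < n) : wedgeExt n (isoBar n k) (chain n j s 1) ≠ 0 := by
  refine wedgeExt_ne_zero (v := isoVec n k) ?_ (chain_one_ne_zero hjs) ?_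
  · rw [isoVec_dotProduct_isoBar hk, if_pos rfl]
    exact two_ne_zero
  · exact contractExt_chain (contractExt_one _) _ _ fun l _ _ => isoVec_dotProduct_isoVec hk l

theorem chain_isoBar_ne_zero {s p : ℕ} (hp : 1 ≤ p) (hn : n = 2 * p + 2) (hs : 1 + s = p) :
    chain n 1 s (wedgeExt n (isoBar n p) 1) ≠ 0 := by
  refine chain_ne_zero (wedgeExt_isoBar_chain_ne_zero (j := 0) (s := 0) (by omega) (by omega)) _ _
    (by omega) fun k _ _ => ?_
  rw [chain_zero, contractExt_wedgeExt_one, isoBar_dotProduct_isoBar (by omega), zero_smul]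

theorem isGenerator_zero {p : ℕ} (hp : 1 ≤ p) (hpn : 2 * p < n) (q : ℕ) :
    IsGenerator n q p (mu0 n q p) 0 (powForm q (chain n 0 p 1)) where
  singular := isSingular_chain_one _ _
  weight := hasWeight_chain_one (by rw [if_pos (by omega)]) fun j _ _ => by omega
  eigen := by rw [zero_smul]; exact (isBaseForm_chain_one (by omega) q hp).opE_self
  mem := by
    have h := isBaseForm_chain_one (n := n) (by omega) q hp
    exact mem_harmonicForms_iff.mpr ⟨h.euler, h.lap, h.deg⟩
  ne_zero := ne_zero_of_evalForm (c := 1) (by rw [one_smul]; exact evalForm_powForm (by omega) _ _)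
    one_ne_zero (chain_one_ne_zero (by omega))

theorem isGenerator_one {p q : ℕ} (hp : 1 ≤ p) (hpn : 2 * p < n) (hq : 1 ≤ q) :
    IsGenerator n q p (mu1 n q p) (q + p) (interX n (powForm (q - 1) (chain n 0 (p + 1) 1))) where
  singular := (isSingular_chain_one _ _).map isInvariant_interX
  weight := HasWeight.map isInvariant_interX
    (hasWeight_chain_one (by rw [if_pos (by omega)]; omega) fun j _ _ => by omega)
  eigen := by
    rw [(isBaseForm_chain_one (by omega) (q - 1) (by omega)).opE_interX]
    congr 1
    push_cast [Nat.cast_sub hq]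
    ring
  mem := (isBaseForm_chain_one (by omega) (q - 1) (by omega)).harmonic_interX
    (by push_cast [Nat.cast_sub hq]; ring) (by push_cast; ring)
  ne_zero := ne_zero_of_evalForm (c := 1)
    (by rw [one_smul]; exact evalForm_interX_chain (by omega) _ _ (contractExt_one _))
    one_ne_zero (chain_one_ne_zero (by omega))

/-- Replacing the last factor `z_p` of the chain by `z̄_p` reverses the sign of the last weight
coordinate. -/
theorem isGenerator_two {p q : ℕ} (hp : 1 ≤ p) (hpn : 2 * p < n) (hq : 1 ≤ q)
    (hn : n = 2 * p + 2) :
    IsGenerator n q p (mu1' n q p) (q + p)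
      (interX n (powForm (q - 1) (chain n 0 p (wedgeExt n (isoBar n p) 1)))) := by
  have hb : IsBaseForm ((q - 1 : ℕ) : ℂ) (1 + p)
      (powForm (q - 1) (chain n 0 p (wedgeExt n (isoBar n p) 1))) := by
    refine isBaseForm_chain (by omega) ?_ ?_ _ hp
    · rw [extDegree_wedgeExt, extDegree_one, map_zero, add_zero, one_smul]
    · rw [contractExt_wedgeExt_one, isoVec_dotProduct_isoBar (by omega), if_neg (by omega),
        zero_smul]
  refine ⟨?_, ?_, ?_, ?_, ?_⟩
  · refine (isSingular_powForm (isRootKilled_chain ?_ ?_) _).map isInvariant_interX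
    -- For `n = 2 p + 2` no index `i ≥ 2 l + 2` exists once `l ≥ p`, so the tail `z̄_p` meets no
    -- root condition.
    · intro l hl i hi
      omega
    · intro l hl hl2
      rw [contractExt_wedgeExt_one, isoVec_dotProduct_isoBar (by omega), if_neg (by omega),
        zero_smul]
  · refine HasWeight.map isInvariant_interX (hasWeight_powForm fun j => ?_)
    rw [cartanExt_chain (by omega) (c := if (j : ℕ) = p then -2 else 0)]
    · congr 1
      simp only [mu1', mu1, hookWeight]
      have := j.2
      push_cast [Nat.cast_sub hq]
      split_ifs <;> first | omega | ring
    · rw [cartanExt_wedgeExt, cartanExt_one, isoBar_dotProduct_isoBar (by omega),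
        isoVec_dotProduct_isoBar (by omega), map_zero, zero_smul, zero_sub, add_zero]
      by_cases h : (j : ℕ) = p
      · rw [if_pos h, if_pos h, h, neg_smul]
      · rw [if_neg h, if_neg h, zero_smul, zero_smul, neg_zero]
  · rw [hb.opE_interX]
    congr 1
    push_cast [Nat.cast_sub hq]
    ring
  · exact hb.harmonic_interX (by push_cast [Nat.cast_sub hq]; ring) (by ring)
  · obtain ⟨s, rfl⟩ : ∃ s, p = s + 1 := ⟨p - 1, by omega⟩
    have h1 : contractExt n (isoBar n 0) (wedgeExt n (isoBar n (s + 1)) 1) = 0 := by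
      rw [contractExt_wedgeExt_one, isoBar_dotProduct_isoBar (by omega), zero_smul]
    exact ne_zero_of_evalForm (c := 1)
      (by rw [one_smul]; exact evalForm_interX_chain (by omega) _ _ h1)
      one_ne_zero (chain_isoBar_ne_zero hp hn (by omega))

theorem isGenerator_three {p q : ℕ} (hp : 1 ≤ p) (hpn : 2 * p < n) (hq : 1 ≤ q)
    (hp2 : 2 ≤ p) :
    IsGenerator n q p (mu2 n q p) (n + q - p)
      (wedgeX n (powForm (q - 1) (chain n 0 (p - 1) 1))) where
  singular := (isSingular_chain_one _ _).map isInvariant_wedgeX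
  weight := HasWeight.map isInvariant_wedgeX
    (hasWeight_chain_one (by rw [if_pos (by omega)]; omega) fun j _ _ => by omega)
  eigen := by
    rw [(isBaseForm_chain_one (by omega) (q - 1) (by omega)).opE_wedgeX]
    congr 1
    push_cast [Nat.cast_sub hq, Nat.cast_sub hp]
    ring
  mem := (isBaseForm_chain_one (by omega) (q - 1) (by omega)).harmonic_wedgeX
    (by push_cast [Nat.cast_sub hq]; ring) (by push_cast [Nat.cast_sub hp]; ring)
  ne_zero := by
    refine ne_zero_of_evalForm (evalForm_wedgeX_powForm (by omega) _ _) (by norm_num)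
      (ω := wedgeExt n (isoBar n 0) (chain n 0 (p - 1) 1)) ?_
    exact wedgeExt_isoBar_chain_ne_zero (by omega) (by omega)

theorem isGenerator_four {p q : ℕ} (hp : 1 ≤ p) (hpn : 2 * p < n) (hq : 2 ≤ q) :
    IsGenerator n q p (mu3 n q p) (n + 2 * q - 2)
      (mixForm n ((q - 2 : ℕ) : ℂ) p (powForm (q - 2) (chain n 0 p 1))) where
  singular := (isSingular_chain_one _ _).map (isInvariant_mixForm _ _)
  weight := HasWeight.map (isInvariant_mixForm _ _)
    (hasWeight_chain_one (by rw [if_pos (by omega)]; omega) fun j _ _ => by omega)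
  eigen := by
    rw [(isBaseForm_chain_one (by omega) (q - 2) hp).opE_mixForm]
    congr 1
    push_cast [Nat.cast_sub hq]
    ring
  mem := (isBaseForm_chain_one (by omega) (q - 2) hp).harmonic_mixForm
    (by push_cast [Nat.cast_sub hq]; ring) rfl
  ne_zero := by
    obtain ⟨s, rfl⟩ : ∃ s, p = s + 1 := ⟨p - 1, by omega⟩
    refine ne_zero_of_evalForm (evalForm_mixForm (by omega) _ _ _ _) ?_
      (wedgeExt_isoBar_chain_ne_zero (by omega) (by omega))
    refine div_ne_zero ?_ two_ne_zero
    exact_mod_cast (by omega : n + 2 * (q - 2) ≠ 0)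

/-- Here `μ₃ = 0`, and `q - 2` is not available as a polynomial degree. The invariant form `∑ xᵢ eᵢ`
takes the place of `mixForm`. -/
theorem isGenerator_four_one (hn : 2 < n) :
    IsGenerator n 1 1 (mu3 n 1 1) n (wedgeX n (powForm 0 1)) := by
  have hb : IsBaseForm ((0 : ℕ) : ℂ) 0 (powForm 0 (1 : Ext n)) :=
    isBaseForm_powForm (by omega) (by rw [extDegree_one, zero_smul]) (Or.inl rfl)
  refine ⟨?_, ?_, ?_, ?_, ?_⟩
  · exact (isSingular_chain_one 0 0).map isInvariant_wedgeX
  · exact HasWeight.map isInvariant_wedgeX (hasWeight_chain_one (s := 0) (by simp) (by omega))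
  · rw [hb.opE_wedgeX]
    simp
  · exact hb.harmonic_wedgeX (by simp) (by simp)
  · refine ne_zero_of_evalForm (evalForm_wedgeX_powForm (by omega) _ _) (by norm_num)
      (ω := wedgeExt n (isoBar n 0) 1) ?_
    exact wedgeExt_isoBar_chain_ne_zero (j := 0) (s := 0) (by omega) (by omega)

/-! ### The highest weight vectors span the singular vectors -/

/-- The weights `μ₀, μ₁, μ₁', μ₂, μ₃`. -/
def genWeight (n q p : ℕ) : Fin 5 → Fin (n / 2) → ℤ
  | 0 => mu0 n q p
  | 1 => mu1 n q p
  | 2 => mu1' n q p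
  | 3 => mu2 n q p
  | 4 => mu3 n q p

/-- The eigenvalues of `E`. -/
def genValue (n q p : ℕ) : Fin 5 → ℂ
  | 0 => 0
  | 1 => q + p
  | 2 => q + p
  | 3 => n + q - p
  | 4 => n + 2 * q - 2

/-- The conditions under which a weight occurs. -/
def GenOccurs (n q p : ℕ) : Fin 5 → Prop
  | 0 => True
  | 1 => 1 ≤ q
  | 2 => 1 ≤ q ∧ n = 2 * p + 2
  | 3 => 1 ≤ q ∧ 2 ≤ p
  | 4 => 2 ≤ q ∨ (q = 1 ∧ p = 1)

/-- The highest weight vectors. -/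
def genForm (n q p : ℕ) : Fin 5 → FormPoly n
  | 0 => powForm q (chain n 0 p 1)
  | 1 => interX n (powForm (q - 1) (chain n 0 (p + 1) 1))
  | 2 => interX n (powForm (q - 1) (chain n 0 p (wedgeExt n (isoBar n p) 1)))
  | 3 => wedgeX n (powForm (q - 1) (chain n 0 (p - 1) 1))
  | 4 => if q = 1 then wedgeX n (powForm 0 1)
    else mixForm n ((q - 2 : ℕ) : ℂ) p (powForm (q - 2) (chain n 0 p 1))

theorem isGenerator_genForm {p q : ℕ} (hp : 1 ≤ p) (hpn : 2 * p < n) :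
    ∀ i, GenOccurs n q p i →
      IsGenerator n q p (genWeight n q p i) (genValue n q p i) (genForm n q p i)
  | 0, _ => isGenerator_zero hp hpn q
  | 1, h => isGenerator_one hp hpn h
  | 2, h => isGenerator_two hp hpn h.1 h.2
  | 3, h => isGenerator_three hp hpn h.1 h.2
  | 4, h => by
    rcases h with h | ⟨rfl, rfl⟩
    · rw [genForm, if_neg (by omega)]
      exact isGenerator_four hp hpn h
    · have h1 : genValue n 1 1 4 = n := by simp [genValue]
      rw [h1, genForm, if_pos rfl]
      exact isGenerator_four_one (by omega)

theorem mem_constituents_iff {q p : ℕ} {μ : Fin (n / 2) → ℤ} : μ ∈ constituents n q p ↔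
    ∃ i, GenOccurs n q p i ∧ μ = genWeight n q p i := by
  simp [constituents, Fin.exists_fin_succ, GenOccurs, genWeight, and_assoc]

/-- The directions of the values of the highest weight vectors at `z̄₀ / 2`. -/
def genExt (n p : ℕ) : Fin 5 → Ext n
  | 0 => wedgeExt n (isoVec n 0) (chain n 1 (p - 1) 1)
  | 1 => chain n 1 p 1
  | 2 => chain n 1 (p - 1) (wedgeExt n (isoBar n p) 1)
  | 3 => wedgeExt n (isoBar n 0) (wedgeExt n (isoVec n 0) (chain n 1 (p - 2) 1))
  | 4 => wedgeExt n (isoBar n 0) (chain n 1 (p - 1) 1)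

theorem evalForm_genForm {p q : ℕ} (hp : 1 ≤ p) (hpn : 2 * p < n) :
    ∀ i, GenOccurs n q p i → ∃ c : ℂ, c ≠ 0 ∧
      evalForm ((1 / 2 : ℂ) • isoBar n 0) (genForm n q p i) = c • genExt n p i := by
  obtain ⟨s, rfl⟩ : ∃ s, p = s + 1 := ⟨p - 1, by omega⟩
  have h1 : 1 < n := by omega
  intro i h
  match i, h with
  | 0, _ => exact ⟨1, one_ne_zero, by rw [one_smul]; exact evalForm_powForm h1 _ _⟩
  | 1, _ =>
    exact ⟨1, one_ne_zero, by
      rw [one_smul]; exact evalForm_interX_chain h1 _ _ (contractExt_one _)⟩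
  | 2, _ =>
    refine ⟨1, one_ne_zero, ?_⟩
    have h2 : contractExt n (isoBar n 0) (wedgeExt n (isoBar n (s + 1)) 1) = 0 := by
      rw [contractExt_wedgeExt_one, isoBar_dotProduct_isoBar (by omega), zero_smul]
    rw [one_smul]
    exact evalForm_interX_chain h1 _ _ h2
  | 3, h =>
    obtain ⟨t, rfl⟩ : ∃ t, s = t + 1 := ⟨s - 1, by have := h.2; omega⟩
    exact ⟨1 / 2, by norm_num, evalForm_wedgeX_powForm h1 _ _⟩
  | 4, h =>
    by_cases hq : q = 1
    · rcases h with h | ⟨_, h⟩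
      · omega
      · obtain rfl : s = 0 := by omega
        refine ⟨1 / 2, by norm_num, ?_⟩
        rw [genForm, if_pos hq]
        exact evalForm_wedgeX_powForm h1 _ _
    · rw [genForm, if_neg hq]
      refine ⟨_, ?_, evalForm_mixForm h1 _ _ _ _⟩
      refine div_ne_zero ?_ two_ne_zero
      exact_mod_cast (by omega : n + 2 * (q - 2) ≠ 0)

/-! ### Values of singular forms at the base point. -/

theorem evalForm_skew_lie (P u v : Fin n → ℂ) (φ : FormPoly n) :
    evalForm P ⁅(skew u v : soC n), φ⁆ = (u ⬝ᵥ P) • evalForm P (derivForm n v φ) -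
      (v ⬝ᵥ P) • evalForm P (derivForm n u φ) +
      (wedgeExt n u (contractExt n v (evalForm P φ)) -
        wedgeExt n v (contractExt n u (evalForm P φ))) := by
  rw [skew_lie]
  simp only [map_add, map_sub, evalForm_mulForm, evalForm_wedgeForm, evalForm_contractForm]

/-- For `l ≥ 1` the vectors `z_l` and `eᵢ` are orthogonal to the point, so the orbital part of the
root vector vanishes there and only its action on the exterior factor is left. -/
theorem isRootKilled_evalForm {φ : FormPoly n} (h : IsSingular φ) :
    IsRootKilled 1 (evalForm ((1 / 2 : ℂ) • isoBar n 0) φ) := by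
  intro l hl i hi
  have h1 := congrArg (evalForm ((1 / 2 : ℂ) • isoBar n 0)) (h l i hi)
  rwa [evalForm_skew_lie, dotProduct_smul, dotProduct_smul, isoVec_dotProduct_isoBar (by omega),
    if_neg (by omega), single_dotProduct_isoBar (by omega), smul_zero, zero_smul, zero_smul,
    sub_zero, zero_add, ← rootExt_apply, map_zero] at h1

/-- Pairing the Euler operator with `φ` gives the sum of the squared lengths of its partial
derivatives. -/
theorem derivForm_eq_zero_of_eulerForm {φ : FormPoly n} (h : eulerForm n φ = 0)
    (u : Fin n → ℂ) : derivForm n u φ = 0 := by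
  have h1 := congrArg (fun x => (fischer n φ x).re) h
  simp only [eulerForm_apply, map_sum, fischer_mulForm_right, star_single, Complex.re_sum,
    map_zero, Complex.zero_re] at h1
  rw [Finset.sum_eq_zero_iff_of_nonneg fun i _ => fischer_self_nonneg _] at h1
  rw [← sum_dotProduct_smul u (derivForm n) φ]
  refine Finset.sum_eq_zero fun i hi => ?_
  rw [eq_zero_of_fischer (h1 i hi).le, smul_zero]

/-- A form of degree `0` in `x` is constant, so its value is singular for all of `𝔰𝔬(n)`, and the
peeling may start at `z₀`. -/
theorem evalForm_of_eulerForm_zero {p : ℕ} (hpn : 2 * p < n) {φ : FormPoly n}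
    (h : IsSingular φ) (h1 : eulerForm n φ = 0) (h2 : degForm n φ = (p : ℂ) • φ) :
    ∃ b : ℂ, evalForm ((1 / 2 : ℂ) • isoBar n 0) φ = b • chain n 0 p 1 := by
  have h3 : IsTailSingular 0 ((0 + p : ℕ) : ℂ) (evalForm ((1 / 2 : ℂ) • isoBar n 0) φ) := by
    refine ⟨fun i hi => by omega, ?_, fun l _ i hi => ?_⟩
    · rw [← evalForm_degForm, h2, map_smul, zero_add]
    · have h4 := congrArg (evalForm ((1 / 2 : ℂ) • isoBar n 0)) (h l i hi)
      rwa [evalForm_skew_lie, derivForm_eq_zero_of_eulerForm h1, derivForm_eq_zero_of_eulerForm h1,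
        map_zero, smul_zero, smul_zero, sub_zero, zero_add, ← rootExt_apply] at h4
  obtain ⟨B, hB, h4⟩ := h3.eq_chain zero_le_one p (Or.inl (by omega))
  obtain ⟨b, rfl⟩ := IsTailSingular.eq_smul_one (n := n) (j := 0 + p) (by simpa using hB)
  exact ⟨b, by rw [h4, map_smul]⟩

/-- The action of `u ∧ v` on the exterior factor. -/
def rootForm (n : ℕ) (u v : Fin n → ℂ) : Module.End ℂ (Ext n) :=
  wedgeExt n u ∘ₗ contractExt n v - wedgeExt n v ∘ₗ contractExt n u

theorem rootForm_apply (u v : Fin n → ℂ) (ω : Ext n) : rootForm n u v ω =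
    wedgeExt n u (contractExt n v ω) - wedgeExt n v (contractExt n u ω) := rfl

theorem IsSingular.skew_isoBar (hn : 4 < n) {φ : FormPoly n} (h : IsSingular φ) :
    ⁅(skew (isoVec n 0) (isoBar n 1) : soC n), φ⁆ = 0 := by
  have h1 := h 0 ⟨2, by omega⟩ le_rfl
  have h2 := h 0 ⟨3, by omega⟩ (by simp)
  rw [isoBar_eq (by omega), ← skewHom_apply, map_sub, map_smul, skewHom_apply, skewHom_apply]
  refine (sub_lie _ _ _).trans ?_
  refine (congrArg₂ _ h1 ((smul_lie _ _ _).trans (congrArg _ h2))).trans ?_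
  simp

/-- Let `X = z₀ ∧ z̄₁`, a positive root vector. For coefficients linear in `x`, differentiating `X φ
= 0` along `z̄₁` shows that the spin action of `X` kills `∂φ`; evaluating `X φ = 0` at the point
shows that the value of `∂φ` is minus the spin action of `X` on the value of `φ`. Hence the square
of this action kills the value. This is the obstruction to `μ₃` for `q = 1`, `p ≥ 2`. -/
theorem rootForm_rootForm_evalForm (hn : 4 < n) {φ : FormPoly n} (h : IsSingular φ)
    (h1 : eulerForm n φ = φ) : rootForm n (isoVec n 0) (isoBar n 1)
      (rootForm n (isoVec n 0) (isoBar n 1) (evalForm ((1 / 2 : ℂ) • isoBar n 0) φ)) = 0 := by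
  have hz : isoBar n 1 ⬝ᵥ isoVec n 0 = 0 := isoBar_dotProduct_isoVec_of_ne (by omega)
  have hw : isoBar n 1 ⬝ᵥ isoBar n 1 = 0 := isoBar_dotProduct_isoBar (by omega) 1
  have h2 := h.skew_isoBar hn
  have h3 : ∀ u, derivForm n u (derivForm n (isoBar n 1) φ) = 0 :=
    derivForm_eq_zero_of_eulerForm (by rw [eulerForm_derivForm, h1, sub_self])
  have h4 := congrArg (derivForm n (isoBar n 1)) h2
  rw [skew_lie] at h4
  simp only [map_add, map_sub, derivForm_mulForm, hz, hw, zero_smul, zero_add,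
    derivForm_derivForm (isoBar n 1) (isoVec n 0), h3, map_zero, sub_zero,
    ← wedgeForm_derivForm, ← contractForm_derivForm] at h4
  have h5 := congrArg (evalForm ((1 / 2 : ℂ) • isoBar n 0)) h4
  rw [map_sub, evalForm_wedgeForm, evalForm_wedgeForm, evalForm_contractForm,
    evalForm_contractForm, map_zero, ← rootForm_apply] at h5
  have h6 := congrArg (evalForm ((1 / 2 : ℂ) • isoBar n 0)) h2
  rw [evalForm_skew_lie, ← rootForm_apply, dotProduct_smul, dotProduct_smul,
    isoVec_dotProduct_isoBar (by omega), if_pos rfl, isoBar_dotProduct_isoBar (by omega),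
    smul_zero, zero_smul, sub_zero, smul_eq_mul, map_zero] at h6
  norm_num at h6
  rw [add_comm, ← eq_neg_iff_add_eq_zero] at h6
  rw [h6, map_neg, h5, neg_zero]

/-- Each application of `z ∧ w` inserts a `z` or replaces a `z̄` by `w`. Only the component with
`z̄` and without `z` survives two applications. -/
theorem rootForm_rootForm_wedge {z w zb : Fin n → ℂ} (h1 : z ⬝ᵥ z = 0) (h2 : w ⬝ᵥ w = 0)
    (h3 : w ⬝ᵥ z = 0) (h4 : w ⬝ᵥ zb = 0) (h5 : z ⬝ᵥ zb = 2) {A B C D : Ext n}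
    (hA : contractExt n z A = 0) (hB : contractExt n z B = 0) (hC : contractExt n z C = 0)
    (hD : contractExt n z D = 0) :
    rootForm n z w (rootForm n z w (A + wedgeExt n z B + wedgeExt n zb C +
      wedgeExt n zb (wedgeExt n z D))) = (4 : ℂ) • wedgeExt n z (wedgeExt n w (contractExt n w C)) := by
  have h3' : z ⬝ᵥ w = 0 := by rw [dotProduct_comm, h3]
  have e1 : ∀ x, wedgeExt n w (wedgeExt n z x) = -wedgeExt n z (wedgeExt n w x) :=
    wedgeExt_wedgeExt w z
  have e2 : ∀ x, wedgeExt n zb (wedgeExt n z x) = -wedgeExt n z (wedgeExt n zb x) :=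
    wedgeExt_wedgeExt zb z
  have e3 : ∀ x, contractExt n z (contractExt n w x) = -contractExt n w (contractExt n z x) :=
    contractExt_contractExt z w
  simp only [rootForm_apply, map_add, map_sub, map_smul, map_neg, contractExt_wedgeExt, h1, h2, h3,
    h3', h4, h5, e1, e2, e3, hA, hB, hC, hD, zero_smul, map_zero, wedgeExt_self, contractExt_self,
    neg_zero, sub_zero, zero_sub, smul_zero, add_zero, zero_add, sub_self, neg_neg]
  module

theorem contractExt_isoVec_chain (hn : 1 < n) (s : ℕ) :
    contractExt n (isoVec n 0) (chain n 1 s 1) = 0 :=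
  contractExt_chain (contractExt_one _) _ _ fun l _ _ => isoVec_dotProduct_isoVec (by omega) l

/-- The values of the singular vectors at `z̄₀ / 2`. -/
theorem IsSingular.evalForm_eq {p q : ℕ} (hp : 1 ≤ p) (hpn : 2 * p < n) {φ : FormPoly n}
    (h : IsSingular φ) (h1 : eulerForm n φ = (q : ℂ) • φ) (h2 : degForm n φ = (p : ℂ) • φ) :
    ∃ t : Fin 5 → ℂ, evalForm ((1 / 2 : ℂ) • isoBar n 0) φ = ∑ i, t i • genExt n p i ∧
      ∀ i, ¬ GenOccurs n q p i → t i = 0 := by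
  obtain ⟨s, rfl⟩ : ∃ s, p = s + 1 := ⟨p - 1, by omega⟩
  have hn : 1 < n := by omega
  rcases Nat.eq_zero_or_pos q with rfl | hq
  · obtain ⟨b, hb⟩ := evalForm_of_eulerForm_zero hpn h (by rw [h1, Nat.cast_zero, zero_smul]) h2
    refine ⟨fun i => if i = 0 then b else 0, ?_, fun i hi => if_neg ?_⟩
    · rw [hb, Finset.sum_eq_single 0 (fun i _ hi => by simp [hi]) (by simp)]
      rfl
    · rintro rfl
      exact hi trivial
  · obtain ⟨a, a', b, c, d, hm, ha', hd⟩ := (isRootKilled_evalForm h).classification hpn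
      (by rw [← evalForm_degForm, h2, map_smul])
    -- The coefficients are reordered to follow `μ₀, μ₁, μ₁', μ₂, μ₃`.
    refine ⟨![b, a, a', d, c], ?_, ?_⟩
    · rw [hm, Fin.sum_univ_five]
      simp only [genExt, Matrix.cons_val]
      rw [Nat.add_sub_cancel, show s + 1 - 2 = s - 1 by omega]
      abel
    · intro i hi
      match i, hi with
      | 0, hi => exact absurd trivial hi
      | 1, hi => exact absurd hq hi
      | 2, hi => exact ha' fun h0 => hi ⟨hq, h0⟩
      | 3, hi => exact hd (by by_contra h0; exact hi ⟨hq, by omega⟩)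
      | 4, hi =>
        -- What remains is `q = 1`, `p ≥ 2`. The doubled spin action of `z₀ ∧ z̄₁` isolates the
        -- coefficient `c`, and the vector multiplying it is nonzero because the chain there begins
        -- with `z₁`.
        have hi' : ¬ (2 ≤ q ∨ (q = 1 ∧ s + 1 = 1)) := hi
        obtain rfl : q = 1 := by omega
        obtain ⟨t, rfl⟩ : ∃ t, s = t + 1 := ⟨s - 1, by omega⟩
        have h3 := rootForm_rootForm_evalForm (by omega) h (by rw [h1, Nat.cast_one, one_smul])
        have h4 : a • chain n 1 (t + 1 + 1) 1 +
            a' • chain n 1 (t + 1) (wedgeExt n (isoBar n (t + 1 + 1)) 1) +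
            b • wedgeExt n (isoVec n 0) (chain n 1 (t + 1) 1) +
            c • wedgeExt n (isoBar n 0) (chain n 1 (t + 1) 1) +
            d • wedgeExt n (isoBar n 0) (wedgeExt n (isoVec n 0) (chain n 1 (t + 1 - 1) 1)) =
            (a • chain n 1 (t + 1 + 1) 1 +
              a' • chain n 1 (t + 1) (wedgeExt n (isoBar n (t + 1 + 1)) 1)) +
            wedgeExt n (isoVec n 0) (b • chain n 1 (t + 1) 1) +
            wedgeExt n (isoBar n 0) (c • chain n 1 (t + 1) 1) +
            wedgeExt n (isoBar n 0) (wedgeExt n (isoVec n 0) (d • chain n 1 (t + 1 - 1) 1)) := by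
          simp only [map_smul]
        rw [hm, h4, rootForm_rootForm_wedge (isoVec_dotProduct_isoVec (by omega) 0)
          (isoBar_dotProduct_isoBar (by omega) 1) (isoBar_dotProduct_isoVec_of_ne (by omega))
          (isoBar_dotProduct_isoBar (by omega) 0)
          (by rw [isoVec_dotProduct_isoBar (by omega), if_pos rfl]) ?_
          (by rw [map_smul, contractExt_isoVec_chain hn, smul_zero])
          (by rw [map_smul, contractExt_isoVec_chain hn, smul_zero])
          (by rw [map_smul, contractExt_isoVec_chain hn, smul_zero]), map_smul, map_smul, map_smul,
          smul_smul, smul_eq_zero] at h3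
        · refine (mul_eq_zero.mp (h3.resolve_right ?_)).resolve_left (by norm_num)
          have h5 : contractExt n (isoBar n 1) (chain n 2 t 1) = 0 :=
            contractExt_chain (contractExt_one _) _ _
              fun k _ _ => isoBar_dotProduct_isoVec_of_ne (by omega)
          rw [chain_succ, contractExt_wedgeExt, h5, map_zero, sub_zero,
            isoBar_dotProduct_isoVec (by omega), if_pos rfl, map_smul, map_smul]
          refine smul_ne_zero two_ne_zero (wedgeExt_ne_zero (v := isoBar n 0)
            (isoBar_dotProduct_isoVec_self_ne_zero (by omega))
            (wedgeExt_isoBar_chain_ne_zero (by omega) (by omega)) ?_)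
          rw [contractExt_wedgeExt, isoBar_dotProduct_isoBar (by omega), zero_smul, zero_sub,
            contractExt_chain (contractExt_one _) _ _
              fun k _ _ => isoBar_dotProduct_isoVec_of_ne (by omega), map_zero, neg_zero]
        · have h6 : contractExt n (isoVec n 0)
              (chain n 1 (t + 1) (wedgeExt n (isoBar n (t + 1 + 1)) 1)) = 0 := by
            refine contractExt_chain ?_ _ _ fun l _ _ => isoVec_dotProduct_isoVec (by omega) l
            rw [contractExt_wedgeExt_one, isoVec_dotProduct_isoBar (by omega), if_neg (by omega),
              zero_smul]
          rw [map_add, map_smul, map_smul, h6, contractExt_isoVec_chain hn, smul_zero, smul_zero,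
            add_zero]

/-- The highest weight vectors span the singular vectors of `H^q ⊗ Λ^p`. -/
theorem IsSingular.eq_sum {p q : ℕ} (hp : 1 ≤ p) (hpn : 2 * p < n) {φ : FormPoly n}
    (h : IsSingular φ) (hφ : φ ∈ harmonicForms n q p) :
    ∃ t : Fin 5 → ℂ, φ = ∑ i, t i • genForm n q p i ∧ ∀ i, ¬ GenOccurs n q p i → t i = 0 := by
  classical
  have hφ' := mem_harmonicForms_iff.mp hφ
  obtain ⟨t, ht, ht0⟩ := h.evalForm_eq hp hpn hφ'.1 hφ'.2.2
  choose! c hc hc2 using evalForm_genForm (q := q) hp hpn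
  refine ⟨fun i => t i * (c i)⁻¹, ?_, fun i hi => by simp [ht0 i hi]⟩
  -- The difference is again harmonic and singular, and its value at the base point is zero by the
  -- choice of coefficients.
  rw [← sub_eq_zero]
  have hmem : φ - ∑ i, (t i * (c i)⁻¹) • genForm n q p i ∈ harmonicForms n q p := by
    refine sub_mem hφ (sum_mem fun i _ => ?_)
    by_cases hi : GenOccurs n q p i
    · exact Submodule.smul_mem _ _ (isGenerator_genForm hp hpn i hi).mem
    · rw [ht0 i hi, zero_mul, zero_smul]
      exact zero_mem _
  have h2 := mem_harmonicForms_iff.mp hmem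
  refine eq_zero_of_evalForm_of_lie (by omega) q h2.1 h2.2.1 (fun i hi => ?_) ?_
  · rw [lie_sub, h 0 i hi, zero_sub, neg_eq_zero, lie_sum]
    refine Finset.sum_eq_zero fun k _ => ?_
    by_cases hk : GenOccurs n q p k
    · rw [lie_smul_form, (isGenerator_genForm hp hpn k hk).singular 0 i hi, smul_zero]
    · simp [ht0 k hk]
  · rw [map_sub, ht, map_sum, sub_eq_zero]
    refine Finset.sum_congr rfl fun i _ => ?_
    by_cases hi : GenOccurs n q p i
    · rw [map_smul, hc2 i hi, smul_smul, inv_mul_cancel_right₀ (hc i hi)]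
    · simp [ht0 i hi]

/-- The conditions under which a weight makes sense. -/
def GenShape (n p : ℕ) : Fin 5 → Prop
  | 0 => True
  | 1 => True
  | 2 => n = 2 * p + 2
  | 3 => 2 ≤ p
  | 4 => True

theorem GenOccurs.shape {p q : ℕ} : ∀ {i : Fin 5}, GenOccurs n q p i → GenShape n p i
  | 0, _ => trivial
  | 1, _ => trivial
  | 2, h => h.2
  | 3, h => h.2
  | 4, _ => trivial

/-! ### Distinctness of the weights. -/

/-- The first coordinate separates `μ₀` and `μ₃` from each other and from the other three weights,
which have to be told apart further down the string. -/
theorem genWeight_apply_zero {p : ℕ} (hp : 1 ≤ p) (hn : 0 < n / 2) (q : ℕ) (i : Fin 5) :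
    genWeight n q p i ⟨0, hn⟩ = ![(q : ℤ) + 1, q, q, q, q - 1] i := by
  fin_cases i <;> simp [genWeight, mu0, mu1, mu1', mu2, mu3, hookWeight]
  omega

theorem mu1_ne_mu2 {p : ℕ} (hpn : 2 * p < n) (hp : 2 ≤ p) (q : ℕ) : mu1 n q p ≠ mu2 n q p := by
  intro h
  have h1 := congrFun h ⟨p - 1, by omega⟩
  simp only [mu1, mu2, hookWeight] at h1
  rw [if_neg (by omega), if_pos (by omega), if_neg (by omega), if_neg (by omega)] at h1
  exact one_ne_zero h1

theorem mu1'_ne {p : ℕ} (hp : 1 ≤ p) (hn : n = 2 * p + 2) (q k : ℕ) :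
    mu1' n q p ≠ hookWeight n q k := by
  intro h
  have h1 := congrFun h ⟨p, by omega⟩
  simp only [mu1', hookWeight] at h1
  rw [if_pos trivial, if_neg (by omega)] at h1
  split_ifs at h1

/-- The weights are pairwise different. -/
theorem genWeight_injective {p q : ℕ} (hp : 1 ≤ p) (hpn : 2 * p < n) {i j : Fin 5}
    (hi : GenShape n p i) (hj : GenShape n p j) (h : genWeight n q p i = genWeight n q p j) :
    i = j := by
  have e0 := congrFun h ⟨0, by omega⟩
  rw [genWeight_apply_zero hp, genWeight_apply_zero hp] at e0
  match i, j, hi, hj, h with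
  | 0, 0, _, _, _ | 1, 1, _, _, _ | 2, 2, _, _, _ | 3, 3, _, _, _ | 4, 4, _, _, _ => rfl
  | 1, 2, _, hj, h => exact absurd h.symm (mu1'_ne hp hj q p)
  | 2, 1, hi, _, h => exact absurd h (mu1'_ne hp hi q p)
  | 1, 3, _, hj, h => exact absurd h (mu1_ne_mu2 hpn hj q)
  | 3, 1, hi, _, h => exact absurd h.symm (mu1_ne_mu2 hpn hi q)
  | 2, 3, hi, _, h => exact absurd h (mu1'_ne hp hi q (p - 2))
  | 3, 2, _, hj, h => exact absurd h.symm (mu1'_ne hp hj q (p - 2))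
  | 0, 1, _, _, _ | 0, 2, _, _, _ | 0, 3, _, _, _ | 0, 4, _, _, _ | 1, 0, _, _, _ | 2, 0, _, _, _
  | 3, 0, _, _, _ | 4, 0, _, _, _ | 4, 1, _, _, _ | 4, 2, _, _, _ | 4, 3, _, _, _ | 1, 4, _, _, _
  | 2, 4, _, _, _ | 3, 4, _, _, _ =>
    simp only [Matrix.cons_val] at e0
    omega

/-! ### Roots -/

/-- `v ↦ ⁅u ∧ v, φ⁆`. -/
def skewAct (u : Fin n → ℂ) (φ : FormPoly n) : (Fin n → ℂ) →ₗ[ℂ] FormPoly n where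
  toFun v := ⁅(skew u v : soC n), φ⁆
  map_add' v w := by
    rw [← skewHom_apply, map_add]
    exact add_lie _ _ _
  map_smul' c v := by
    rw [← skewHom_apply, map_smul]
    exact smul_lie _ _ _

theorem skewAct_apply (u v : Fin n → ℂ) (φ : FormPoly n) :
    skewAct u φ v = ⁅(skew u v : soC n), φ⁆ := rfl

/-- The real vectors `e_{2k}, e_{2k+1}` span the same plane as `z_k, z̄_k`. Testing against the `eᵢ`
treats both parities of `n` at once. -/
theorem isSingular_iff {φ : FormPoly n} : IsSingular φ ↔
    (∀ j k : Fin (n / 2), j < k → ⁅(skew (zvec j) (zbar k) : soC n), φ⁆ = 0) ∧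
    (∀ j k : Fin (n / 2), j < k → ⁅(skew (zvec j) (zvec k) : soC n), φ⁆ = 0) ∧
    ∀ (j : Fin (n / 2)) (i : Fin n), (i : ℕ) = 2 * (n / 2) →
      ⁅(skew (zvec j) (Pi.single i 1) : soC n), φ⁆ = 0 := by
  simp only [zvec_eq, zbar_eq, ← skewAct_apply]
  constructor
  · intro h
    refine ⟨fun j k hjk => ?_, fun j k hjk => ?_, fun j i hi => ?_⟩
    · have hjk' : (j : ℕ) < k := hjk
      rw [isoBar_eq (by omega), map_sub, map_smul, skewAct_apply, skewAct_apply,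
        h j _ (by simp only []; omega), h j _ (by simp only []; omega), smul_zero, sub_zero]
    · have hjk' : (j : ℕ) < k := hjk
      rw [isoVec_eq (j := (k : ℕ)) (by omega), map_add, map_smul, skewAct_apply, skewAct_apply,
        h j _ (by simp only []; omega), h j _ (by simp only []; omega), smul_zero, add_zero]
    · rw [skewAct_apply]
      exact h j i (by omega)
  · rintro ⟨h1, h2, h3⟩ l i hi
    have hl : l < n / 2 := by omega
    rw [← skewAct_apply]
    by_cases hi2 : (i : ℕ) = 2 * (n / 2)
    · exact h3 ⟨l, hl⟩ i hi2
    · have hk : (i : ℕ) / 2 < n / 2 := by omega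
      have e1 := h1 ⟨l, hl⟩ ⟨(i : ℕ) / 2, hk⟩ (Fin.mk_lt_mk.mpr (by omega))
      have e2 := h2 ⟨l, hl⟩ ⟨(i : ℕ) / 2, hk⟩ (Fin.mk_lt_mk.mpr (by omega))
      simp only at e1 e2
      rcases (by omega : (i : ℕ) = 2 * ((i : ℕ) / 2) ∨ (i : ℕ) = 2 * ((i : ℕ) / 2) + 1) with h | h
      · have h0 : i = ⟨2 * ((i : ℕ) / 2), by omega⟩ := Fin.ext h
        rw [h0, single_even_eq (by omega), map_smul, map_add, e1, e2, add_zero, smul_zero]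
      · have h0 : i = ⟨2 * ((i : ℕ) / 2) + 1, by omega⟩ := Fin.ext h
        rw [h0, single_odd_eq (by omega), map_smul, map_sub, e1, e2, sub_zero, smul_zero]

theorem isHighestWeightVector_iff {μ : Fin (n / 2) → ℤ} {v : FormPoly n} :
    IsHighestWeightVector μ v ↔ v ≠ 0 ∧ HasWeight μ v ∧ IsSingular v := by
  rw [isSingular_iff]
  exact ⟨fun h => ⟨h.ne_zero, h.weight, h.sub_root, h.add_root, h.short_root⟩,
    fun h => ⟨h.1, h.2.1, h.2.2.1, h.2.2.2.1, h.2.2.2.2⟩⟩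

/-- `𝔰𝔬(n)` is spanned by the root vectors `z_l ∧ eᵢ`, `z̄_l ∧ eᵢ` and the Cartan subalgebra. -/
theorem soC_root_induction {C : soC n → Prop}
    (pos : ∀ (l : ℕ) (i : Fin n), 2 * l + 2 ≤ (i : ℕ) → C (skew (isoVec n l) (Pi.single i 1)))
    (neg : ∀ (l : ℕ) (i : Fin n), 2 * l + 2 ≤ (i : ℕ) → C (skew (isoBar n l) (Pi.single i 1)))
    (cart : ∀ j : Fin (n / 2), C (cartan j))
    (zero : C 0) (add : ∀ A B, C A → C B → C (A + B)) (smul : ∀ (c : ℂ) A, C A → C (c • A))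
    (A : soC n) : C A := by
  have key : ∀ i j : Fin n, i < j → C (skew (Pi.single i 1) (Pi.single j 1)) := by
    intro i j hij
    have hij' : (i : ℕ) < j := hij
    rcases Nat.lt_or_ge (j : ℕ) (2 * ((i : ℕ) / 2) + 2) with hj | hj
    · have hi2 : (i : ℕ) = 2 * ((i : ℕ) / 2) := by omega
      have hj2 : (j : ℕ) = 2 * ((i : ℕ) / 2) + 1 := by omega
      -- Two indices of the same pair: from `z ∧ z̄ = -2i (e_{2k} ∧ e_{2k+1})` one gets `e_{2k} ∧
      -- e_{2k+1} = i H_k`.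
      have h1 : (skew (Pi.single i 1) (Pi.single j 1) : soC n) =
          Complex.I • cartan ⟨(i : ℕ) / 2, by omega⟩ := by
        have ei : i = ⟨2 * ((i : ℕ) / 2), by omega⟩ := Fin.ext hi2
        have ej : j = ⟨2 * ((i : ℕ) / 2) + 1, by omega⟩ := Fin.ext hj2
        rw [cartan, zvec, zbar, ← ei, ← ej]
        simp only [← skewHom_apply, map_add, map_sub, map_smul, LinearMap.add_apply,
          LinearMap.smul_apply]
        simp only [skewHom_apply, skew_self, skew_swap (Pi.single j 1) (Pi.single i 1)]
        rw [show ∀ x : soC n, Complex.I • (1 / 2 : ℂ) • (0 + Complex.I • -x -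
          Complex.I • (x + Complex.I • 0)) = (-(Complex.I * Complex.I)) • x by intro x; module,
          Complex.I_mul_I, neg_neg, one_smul]
      rw [h1]
      exact smul _ _ (cart _)
    · rcases (by omega : (i : ℕ) = 2 * ((i : ℕ) / 2) ∨ (i : ℕ) = 2 * ((i : ℕ) / 2) + 1) with h | h
      · have h0 : i = ⟨2 * ((i : ℕ) / 2), by omega⟩ := Fin.ext h
        rw [h0, single_even_eq (by omega), skew_smul_left, skew_add_left]
        exact smul _ _ (add _ _ (pos _ _ hj) (neg _ _ hj))
      · have h0 : i = ⟨2 * ((i : ℕ) / 2) + 1, by omega⟩ := Fin.ext h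
        rw [h0, single_odd_eq (by omega), skew_smul_left, sub_eq_add_neg, skew_add_left,
          ← neg_one_smul ℂ (isoBar _ _), skew_smul_left]
        exact smul _ _ (add _ _ (pos _ _ hj) (smul _ _ (neg _ _ hj)))
  refine soC_induction (fun i j => ?_) zero add smul A
  rcases lt_trichotomy i j with h | rfl | h
  · exact key i j h
  · rw [skew_self]; exact zero
  · rw [skew_swap, ← neg_one_smul ℂ (skew _ _)]
    exact smul _ _ (key j i h)

/-! ### Weights and orthogonality -/

theorem fischer_cartan (j : Fin (n / 2)) (φ ψ : FormPoly n) :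
    fischer n ⁅(cartan j : soC n), φ⁆ ψ = fischer n φ ⁅(cartan j : soC n), ψ⁆ := by
  rw [lie_cartan, lie_cartan, map_smulₛₗ, LinearMap.smul_apply, fischer_skew, star_isoVec,
    star_isoBar, map_smul, map_div₀, map_one, map_ofNat]

/-- The Cartan elements are self-adjoint, and the weights are integers, so eigenvectors for
different eigenvalues are orthogonal. -/
theorem fischer_eq_zero_of_weight {μ ν : Fin (n / 2) → ℤ} (h : μ ≠ ν) {φ ψ : FormPoly n}
    (hφ : HasWeight μ φ) (hψ : HasWeight ν ψ) : fischer n φ ψ = 0 := by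
  obtain ⟨j, hj⟩ := Function.ne_iff.mp h
  have h1 := fischer_cartan j φ ψ
  rw [hφ j, hψ j, map_smulₛₗ, LinearMap.smul_apply, map_smul, smul_eq_mul, smul_eq_mul,
    map_intCast, ← sub_eq_zero, ← sub_mul, mul_eq_zero] at h1
  refine h1.resolve_left ?_
  exact sub_ne_zero.mpr (by exact_mod_cast hj)

/-- A singular vector is orthogonal to the image of the negative root vectors. -/
theorem IsSingular.fischer_neg {φ : FormPoly n} (h : IsSingular φ) (l : ℕ) (i : Fin n)
    (hi : 2 * l + 2 ≤ (i : ℕ)) (ψ : FormPoly n) :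
    fischer n φ ⁅(skew (isoBar n l) (Pi.single i 1) : soC n), ψ⁆ = 0 := by
  have h1 := fischer_skew (Pi.single i 1) (isoVec n l) φ ψ
  rw [star_isoVec, star_single, skew_swap] at h1
  rw [← h1]
  have h2 : ⁅(-skew (isoVec n l) (Pi.single i 1) : soC n), φ⁆ = 0 := by
    rw [neg_lie, h l i hi, neg_zero]
  rw [h2, map_zero, LinearMap.zero_apply]

/-- The orthogonal complement of a subrepresentation. -/
def orthogonal (W : LieSubmodule ℂ (soC n) (FormPoly n)) :
    LieSubmodule ℂ (soC n) (FormPoly n) where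
  carrier := {x | ∀ w ∈ W, fischer n w x = 0}
  add_mem' := fun ha hb w hw => by rw [map_add, ha w hw, hb w hw, add_zero]
  zero_mem' := fun w _ => map_zero _
  smul_mem' := fun c x hx w hw => by rw [map_smul, hx w hw, smul_zero]
  lie_mem := by
    intro A x hx w hw
    induction A using soC_induction with
    | skew_mem i j =>
      have h1 := fischer_skew (Pi.single j 1) (Pi.single i 1) w x
      rw [star_single, star_single] at h1
      exact h1.symm.trans (hx _ (W.lie_mem hw))
    | zero => rw [zero_lie, map_zero]
    | add A B hA hB => rw [add_lie, map_add, hA, hB, add_zero]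
    | smul c A hA =>
      have : ⁅c • A, x⁆ = c • ⁅A, x⁆ := smul_lie c A x
      rw [this, map_smul, hA, smul_zero]

theorem mem_orthogonal {W : LieSubmodule ℂ (soC n) (FormPoly n)} {x : FormPoly n} :
    x ∈ orthogonal W ↔ ∀ w ∈ W, fischer n w x = 0 := Iff.rfl

theorem fischer_eq_zero_symm {φ ψ : FormPoly n} (h : fischer n φ ψ = 0) : fischer n ψ φ = 0 := by
  rw [← fischer_symm, h, map_zero]

theorem eq_zero_of_fischer_self {φ : FormPoly n} (h : fischer n φ φ = 0) : φ = 0 :=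
  eq_zero_of_fischer (by rw [h, Complex.zero_re])

/-- The span of the vectors obtained from `v` by negative root vectors. -/
def lowerSpan (v : FormPoly n) : Submodule ℂ (FormPoly n) :=
  sInf {S | v ∈ S ∧ ∀ (l : ℕ) (i : Fin n), 2 * l + 2 ≤ (i : ℕ) → ∀ x ∈ S,
    ⁅(skew (isoBar n l) (Pi.single i 1) : soC n), x⁆ ∈ S}

/-- This replaces the Poincaré–Birkhoff–Witt theorem: the span of `v` under negative root vectors is
already stable under the whole algebra. -/
theorem lieSpan_le_lowerSpan {v : FormPoly n} {μ : Fin (n / 2) → ℤ} (h1 : IsSingular v)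
    (h2 : HasWeight μ v) :
    (LieSubmodule.lieSpan ℂ (soC n) {v}).toSubmodule ≤ lowerSpan v := by
  have hv : v ∈ lowerSpan v := Submodule.mem_sInf.mpr fun S hS => hS.1
  have hs : ∀ (l : ℕ) (i : Fin n), 2 * l + 2 ≤ (i : ℕ) → ∀ x ∈ lowerSpan v,
      ⁅(skew (isoBar n l) (Pi.single i 1) : soC n), x⁆ ∈ lowerSpan v := fun l i hi x hx =>
    Submodule.mem_sInf.mpr fun S hS => hS.2 l i hi x (Submodule.mem_sInf.mp hx S hS)
  -- `P` consists of the vectors of the span that the whole algebra maps back into it. It contains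
  -- `v`, and `⁅A, ⁅Y, x⁆⁆ = ⁅⁅A, Y⁆, x⁆ + ⁅Y, ⁅A, x⁆⁆` makes it stable under negative root vectors
  -- `Y`, so by minimality it is everything.
  let P : Submodule ℂ (FormPoly n) := lowerSpan v ⊓
    ⨅ A : soC n, (lowerSpan v).comap (LieModule.toEnd ℂ (soC n) (FormPoly n) A)
  have hP : ∀ x, x ∈ P ↔ x ∈ lowerSpan v ∧ ∀ A : soC n, ⁅A, x⁆ ∈ lowerSpan v := by
    intro x
    simp [P, Submodule.mem_iInf]
  have hle : lowerSpan v ≤ P := by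
    refine sInf_le ⟨(hP v).mpr ⟨hv, fun A => ?_⟩, fun l i hi x hx => ?_⟩
    · induction A using soC_root_induction with
      | pos l i hi => rw [h1 l i hi]; exact zero_mem _
      | neg l i hi => exact hs l i hi v hv
      | cart j => rw [h2 j]; exact Submodule.smul_mem _ _ hv
      | zero => rw [zero_lie]; exact zero_mem _
      | add A B hA hB => rw [add_lie]; exact add_mem hA hB
      | smul c A hA =>
        have : ⁅c • A, v⁆ = c • ⁅A, v⁆ := smul_lie c A v
        rw [this]; exact Submodule.smul_mem _ _ hA
    · rw [hP] at hx ⊢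
      refine ⟨hs l i hi x hx.1, fun A => ?_⟩
      rw [leibniz_lie]
      exact add_mem (hx.2 _) (hs l i hi _ (hx.2 A))
  let L : LieSubmodule ℂ (soC n) (FormPoly n) :=
    { lowerSpan v with lie_mem := fun {A x} hx => ((hP x).mp (hle hx)).2 A }
  exact (LieSubmodule.lieSpan_le (N := L)).mpr (Set.singleton_subset_iff.mpr hv)

/-- A singular vector orthogonal to a singular weight vector `v` is orthogonal to the
representation generated by `v`. -/
theorem IsSingular.fischer_lieSpan {u v : FormPoly n} {μ : Fin (n / 2) → ℤ} (hu : IsSingular u)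
    (h1 : IsSingular v) (h2 : HasWeight μ v) (huv : fischer n u v = 0) {x : FormPoly n}
    (hx : x ∈ LieSubmodule.lieSpan ℂ (soC n) {v}) : fischer n u x = 0 := by
  -- The kernel contains `v` and all images of negative root vectors, so it competes in the infimum
  -- that defines `lowerSpan`.
  have h3 : lowerSpan v ≤ LinearMap.ker (fischer n u) :=
    sInf_le ⟨huv, fun l i hi y _ => hu.fischer_neg l i hi y⟩
  exact h3 (lieSpan_le_lowerSpan h1 h2 hx)

/-- Existence of the orthogonal projection to a finite dimensional subspace. -/
theorem exists_fischer_projection (W : Submodule ℂ (FormPoly n)) [FiniteDimensional ℂ W]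
    (x : FormPoly n) : ∃ w ∈ W, ∀ y ∈ W, fischer n y (x - w) = 0 := by
  let core : InnerProductSpace.Core ℂ (FormPoly n) :=
    { inner := fun φ ψ => fischer n φ ψ
      conj_inner_symm := fun φ ψ => fischer_symm ψ φ
      re_inner_nonneg := fun φ => fischer_self_nonneg φ
      add_left := fun φ ψ χ => by rw [map_add]; rfl
      smul_left := fun φ ψ c => by rw [map_smulₛₗ]; rfl
      definite := fun φ h => eq_zero_of_fischer_self h }
  let _ : NormedAddCommGroup (FormPoly n) := core.toNormedAddCommGroup
  let _ : InnerProductSpace ℂ (FormPoly n) := InnerProductSpace.ofCore core.toCore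
  obtain ⟨w, hw, h⟩ := Submodule.HasOrthogonalProjection.exists_orthogonal (K := W) x
  exact ⟨w, hw, fun y hy => (Submodule.mem_orthogonal W _).mp h y hy⟩

/-! ### Existence of singular vectors -/

theorem skew_lie_skew (a b u v : Fin n → ℂ) : ⁅(skew a b : soC n), (skew u v : soC n)⁆ =
    skew ((b ⬝ᵥ u) • a - (a ⬝ᵥ u) • b) v + skew u ((b ⬝ᵥ v) • a - (a ⬝ᵥ v) • b) := by
  refine Subtype.ext ?_
  have h : ∀ A B : soC n, (⁅A, B⁆ : soC n).1 = A.1 * B.1 - B.1 * A.1 := fun _ _ => rfl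
  have h' : ∀ A B : soC n, (A + B).1 = A.1 + B.1 := fun _ _ => rfl
  rw [h, h']
  simp only [skew, sub_mul, mul_sub, Matrix.vecMulVec_mul_vecMulVec, Matrix.sub_vecMulVec,
    Matrix.vecMulVec_sub, Matrix.smul_vecMulVec, Matrix.vecMulVec_smul, dotProduct_comm _ u,
    dotProduct_comm _ v]
  simp only [dotProduct_comm u, dotProduct_comm v]
  module

/-- `u` is an eigenvector of the Cartan subalgebra. -/
def IsCartanVec (a : Fin (n / 2) → ℂ) (u : Fin n → ℂ) : Prop :=
  ∀ j : Fin (n / 2), (isoBar n j ⬝ᵥ u) • isoVec n j - (isoVec n j ⬝ᵥ u) • isoBar n j =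
    (2 * a j) • u

theorem isCartanVec_isoVec (l : Fin (n / 2)) : IsCartanVec (Pi.single l 1) (isoVec n l) := by
  intro j
  rw [isoBar_dotProduct_isoVec (by omega), isoVec_dotProduct_isoVec (by omega), zero_smul, sub_zero]
  by_cases h : j = l
  · subst h; simp
  · simp [h, Fin.val_ne_of_ne h]

theorem isCartanVec_isoBar (l : Fin (n / 2)) : IsCartanVec (-Pi.single l 1) (isoBar n l) := by
  intro j
  rw [isoVec_dotProduct_isoBar (by omega), isoBar_dotProduct_isoBar (by omega), zero_smul, zero_sub]
  by_cases h : j = l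
  · subst h; simp
  · simp [h, Fin.val_ne_of_ne h]

theorem isCartanVec_single {i : Fin n} (hi : (i : ℕ) = 2 * (n / 2)) :
    IsCartanVec 0 (Pi.single i 1 : Fin n → ℂ) := by
  intro j
  rw [isoVec_dotProduct_single (by omega), isoBar_dotProduct_single (by omega)]
  simp

theorem cartan_lie_skew {a b : Fin (n / 2) → ℂ} {u v : Fin n → ℂ} (hu : IsCartanVec a u)
    (hv : IsCartanVec b v) (j : Fin (n / 2)) :
    ⁅(cartan j : soC n), (skew u v : soC n)⁆ = (a j + b j) • skew u v := by
  rw [cartan, smul_lie, zvec_eq, zbar_eq, skew_lie_skew, hu j, hv j]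
  simp only [← skewHom_apply, map_smul, LinearMap.smul_apply]
  module

/-- A regular dominant element of the Cartan subalgebra. -/
def regElt (n : ℕ) : soC n := ∑ j : Fin (n / 2), ((n : ℂ) - j) • cartan j

theorem regElt_lie_skew {a b : Fin (n / 2) → ℂ} {u v : Fin n → ℂ} (hu : IsCartanVec a u)
    (hv : IsCartanVec b v) : ⁅regElt n, (skew u v : soC n)⁆ =
      (∑ j : Fin (n / 2), ((n : ℂ) - j) * (a j + b j)) • skew u v := by
  rw [regElt, sum_lie, Finset.sum_smul]
  refine Finset.sum_congr rfl fun j _ => ?_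
  rw [smul_lie, cartan_lie_skew hu hv, smul_smul]

theorem sum_mul_single (c : Fin (n / 2) → ℂ) (l : Fin (n / 2)) :
    ∑ j, c j * (Pi.single l 1 : Fin (n / 2) → ℂ) j = c l := by
  simp [Pi.single_apply]

/-- An eigenvector in an invariant subspace whose eigenvalue has maximal real part. -/
theorem exists_maximal_eigenvector {V : Type*} [AddCommGroup V] [Module ℂ V]
    (T : Module.End ℂ V) (W : Submodule ℂ V) [FiniteDimensional ℂ W] (hW : W ≠ ⊥)
    (hT : ∀ x ∈ W, T x ∈ W) : ∃ x ∈ W, x ≠ 0 ∧ ∃ c : ℂ, T x = c • x ∧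
      ∀ y ∈ W, ∀ s : ℂ, 0 < s.re → T y = (s + c) • y → y = 0 := by
  have : Nontrivial W := Submodule.nontrivial_iff_ne_bot.mpr hW
  let S : Module.End ℂ W := LinearMap.restrict T hT
  obtain ⟨c, hc, hmax⟩ := Set.exists_max_image {c | S.HasEigenvalue c} Complex.re
    (Module.End.finite_hasEigenvalue _) (Module.End.exists_eigenvalue _)
  obtain ⟨x, hx⟩ := hc.exists_hasEigenvector
  refine ⟨x, x.2, fun h => hx.2 (Subtype.ext h), c, congrArg Subtype.val hx.apply_eq_smul, ?_⟩
  intro y hy s hs h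
  by_contra hne
  have h1 : S.HasEigenvalue (s + c) :=
    Module.End.hasEigenvalue_of_hasEigenvector (x := ⟨y, hy⟩)
      ⟨Module.End.mem_eigenspace_iff.mpr (Subtype.ext h), fun h => hne (congrArg Subtype.val h)⟩
  have h2 := hmax _ h1
  rw [Complex.add_re] at h2
  linarith

/-- Every nonzero finite dimensional subrepresentation contains a singular vector. -/
theorem exists_isSingular (N : LieSubmodule ℂ (soC n) (FormPoly n)) (hN : N ≠ ⊥)
    [FiniteDimensional ℂ N.toSubmodule] : ∃ x ∈ N, x ≠ 0 ∧ IsSingular x := by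
  obtain ⟨x, hxN, hx0, c, hx1, hmax⟩ := exists_maximal_eigenvector
    { toFun := fun φ : FormPoly n => ⁅regElt n, φ⁆
      map_add' := fun x y => lie_add _ _ _
      map_smul' := fun c x => lie_smul_form _ _ _ } N.toSubmodule
    (by rwa [Ne, LieSubmodule.toSubmodule_eq_bot]) (fun x hx => N.lie_mem hx)
  have hx2 : ⁅regElt n, x⁆ = c • x := hx1
  -- A root vector on which `regElt` has positive real eigenvalue would raise the maximal eigenvalue
  -- of `x`, so it kills `x`. The coefficients `n - j` are positive and strictly decreasing in `j`,
  -- which makes all positive roots positive.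
  have key : ∀ (u v : Fin n → ℂ) (a b : Fin (n / 2) → ℂ), IsCartanVec a u → IsCartanVec b v →
      0 < (∑ j : Fin (n / 2), ((n : ℂ) - j) * (a j + b j)).re →
      ⁅(skew u v : soC n), x⁆ = 0 := by
    intro u v a b hu hv hpos
    refine hmax _ (N.lie_mem hxN) _ hpos ?_
    change ⁅regElt n, ⁅(skew u v : soC n), x⁆⁆ = _
    rw [leibniz_lie, regElt_lie_skew hu hv, hx2, lie_smul_form, add_smul]
    exact congrArg (· + _) (smul_lie _ _ _)
  refine ⟨x, hxN, hx0, isSingular_iff.mpr ⟨?_, ?_, ?_⟩⟩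
  · intro j k hjk
    rw [zvec_eq, zbar_eq]
    refine key _ _ _ _ (isCartanVec_isoVec j) (isCartanVec_isoBar k) ?_
    have hjk' : ((j : ℕ) : ℝ) < (k : ℕ) := by exact_mod_cast hjk
    simp only [mul_add, Finset.sum_add_distrib, Pi.neg_apply, mul_neg, Finset.sum_neg_distrib,
      sum_mul_single (fun j => (n : ℂ) - j)]
    simpa using hjk'
  · intro j k hjk
    rw [zvec_eq, zvec_eq]
    refine key _ _ _ _ (isCartanVec_isoVec j) (isCartanVec_isoVec k) ?_
    have h1 : ((j : ℕ) : ℝ) < n := by exact_mod_cast (by omega : (j : ℕ) < n)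
    have h2 : ((k : ℕ) : ℝ) < n := by exact_mod_cast (by omega : (k : ℕ) < n)
    simp only [mul_add, Finset.sum_add_distrib, sum_mul_single (fun j => (n : ℂ) - j)]
    simp
    linarith
  · intro j i hi
    rw [zvec_eq]
    refine key _ _ _ _ (isCartanVec_isoVec j) (isCartanVec_single hi) ?_
    have h1 : ((j : ℕ) : ℝ) < n := by exact_mod_cast (by omega : (j : ℕ) < n)
    simp only [mul_add, Finset.sum_add_distrib, sum_mul_single (fun j => (n : ℂ) - j)]
    simpa using h1

/-! ### Irreducible subrepresentations -/

/-- Irreducibility is restated inside the ambient space, where the Fischer form and the singular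
vectors are available. -/
theorem isIrreducible_iff {W : LieSubmodule ℂ (soC n) (FormPoly n)} :
    LieModule.IsIrreducible ℂ (soC n) W ↔ W ≠ ⊥ ∧ ∀ N ≤ W, N ≠ ⊥ → N = W := by
  constructor
  · intro h
    refine ⟨fun h0 => ?_, fun N hN h0 => ?_⟩
    · subst h0
      have := h.toNontrivial
      exact bot_ne_top (Subsingleton.elim (⊥ : LieSubmodule ℂ (soC n)
        (⊥ : LieSubmodule ℂ (soC n) (FormPoly n))) ⊤)
    · rcases eq_bot_or_eq_top (N.comap W.incl) with h1 | h1
      · exact absurd (by rwa [LieSubmodule.comap_incl_eq_bot, inf_eq_right.mpr hN] at h1) h0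
      · exact le_antisymm hN (LieSubmodule.comap_incl_eq_top.mp h1)
  · rintro ⟨h0, h⟩
    have : Nontrivial W := by
      rw [LieSubmodule.nontrivial_iff_ne_bot]
      exact h0
    refine LieModule.IsIrreducible.mk fun N hN => ?_
    have h1 : N.map W.incl = W := by
      refine h _ ?_ ?_
      · exact LieSubmodule.map_incl_le
      · intro h2
        refine hN ((LieSubmodule.eq_bot_iff N).mpr fun x hx => Subtype.ext ?_)
        have h3 : (x : FormPoly n) ∈ N.map W.incl := LieSubmodule.mem_map_of_mem hx
        rw [h2] at h3
        exact h3
    rw [eq_top_iff]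
    rintro ⟨x, hx⟩ -
    rw [← h1, LieSubmodule.mem_map] at hx
    obtain ⟨y, hy, rfl⟩ := hx
    exact hy

/-- The subrepresentation generated by a highest weight vector. -/
def genRep (n q p : ℕ) (i : Fin 5) : LieSubmodule ℂ (soC n) (FormPoly n) :=
  LieSubmodule.lieSpan ℂ (soC n) {genForm n q p i}

section

variable {p q : ℕ}

theorem genForm_mem_genRep (i : Fin 5) : genForm n q p i ∈ genRep n q p i :=
  LieSubmodule.subset_lieSpan rfl

theorem genRep_le_iff {i : Fin 5} {N : LieSubmodule ℂ (soC n) (FormPoly n)} :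
    genRep n q p i ≤ N ↔ genForm n q p i ∈ N := by
  rw [genRep, LieSubmodule.lieSpan_le, Set.singleton_subset_iff]
  rfl

theorem genRep_le_harmonicRep (hp : 1 ≤ p) (hpn : 2 * p < n) {i : Fin 5} (hi : GenOccurs n q p i) :
    genRep n q p i ≤ harmonicRep n q p :=
  genRep_le_iff.mpr (isGenerator_genForm hp hpn i hi).mem

theorem finiteDimensional_of_le {W : LieSubmodule ℂ (soC n) (FormPoly n)}
    (h : W ≤ harmonicRep n q p) : FiniteDimensional ℂ W.toSubmodule :=
  Submodule.finiteDimensional_of_le (S₂ := harmonicForms n q p) h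

/-- Different generators are orthogonal. -/
theorem fischer_genForm (hp : 1 ≤ p) (hpn : 2 * p < n) {i j : Fin 5} (hi : GenOccurs n q p i)
    (hj : GenOccurs n q p j) (hij : i ≠ j) :
    fischer n (genForm n q p i) (genForm n q p j) = 0 :=
  fischer_eq_zero_of_weight (fun h => hij (genWeight_injective hp hpn hi.shape hj.shape h))
    (isGenerator_genForm hp hpn i hi).weight (isGenerator_genForm hp hpn j hj).weight

/-- The generator of one piece is orthogonal to the other piece, because it is singular and
orthogonal to that piece's generator. The orthogonal complement is a subrepresentation, so it
contains all that this generator generates. -/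
theorem fischer_genRep (hp : 1 ≤ p) (hpn : 2 * p < n) {i j : Fin 5} (hi : GenOccurs n q p i)
    (hj : GenOccurs n q p j) (hij : i ≠ j) {x y : FormPoly n} (hx : x ∈ genRep n q p i)
    (hy : y ∈ genRep n q p j) : fischer n x y = 0 := by
  have gi := isGenerator_genForm hp hpn i hi
  have gj := isGenerator_genForm hp hpn j hj
  have h1 : genForm n q p i ∈ orthogonal (genRep n q p j) := fun w hw =>
    fischer_eq_zero_symm
      (gi.singular.fischer_lieSpan gj.singular gj.weight (fischer_genForm hp hpn hi hj hij) hw)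
  exact fischer_eq_zero_symm (mem_orthogonal.mp (genRep_le_iff.mpr h1 hx) y hy)

/-- The coefficients of a singular vector. -/
theorem IsSingular.eq_sum_occurs (hp : 1 ≤ p) (hpn : 2 * p < n) {φ : FormPoly n}
    (h : IsSingular φ) (hφ : φ ∈ harmonicForms n q p) :
    ∃ t : Fin 5 → ℂ, φ = ∑ i, t i • genForm n q p i ∧ (∀ i, ¬ GenOccurs n q p i → t i = 0) ∧
      ∀ i, GenOccurs n q p i → fischer n (genForm n q p i) φ = 0 → t i = 0 := by
  obtain ⟨t, ht, ht0⟩ := h.eq_sum hp hpn hφ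
  refine ⟨t, ht, ht0, fun i hi h0 => ?_⟩
  rw [ht, map_sum, Finset.sum_eq_single i, map_smul, smul_eq_mul, mul_eq_zero] at h0
  · exact h0.resolve_right fun h1 =>
      (isGenerator_genForm hp hpn i hi).ne_zero (eq_zero_of_fischer_self h1)
  · intro j _ hij
    by_cases hj : GenOccurs n q p j
    · rw [map_smul, fischer_genForm hp hpn hi hj hij.symm, smul_zero]
    · rw [ht0 j hj, zero_smul, map_zero]
  · simp

/-- Multiplicity one: a singular vector orthogonal to all other generators lies on a single line. -/
theorem IsSingular.eq_smul_of_fischer (hp : 1 ≤ p) (hpn : 2 * p < n) {φ : FormPoly n}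
    (h : IsSingular φ) (hφ : φ ∈ harmonicForms n q p) (i : Fin 5)
    (h0 : ∀ j, GenOccurs n q p j → j ≠ i → fischer n (genForm n q p j) φ = 0) :
    ∃ c : ℂ, φ = c • genForm n q p i ∧ (¬ GenOccurs n q p i → c = 0) := by
  obtain ⟨t, ht, ht1, ht2⟩ := h.eq_sum_occurs hp hpn hφ
  refine ⟨t i, ?_, ht1 i⟩
  rw [Finset.sum_eq_single i] at ht
  · exact ht
  · intro j _ hij
    have : t j = 0 := by
      by_cases hj : GenOccurs n q p j
      · exact ht2 j hj (h0 j hj hij)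
      · exact ht1 j hj
    rw [this, zero_smul]
  · simp

/-- A nonzero subrepresentation contains a singular vector. It is orthogonal to the other pieces,
hence a multiple of the generator, so the generator lies in the subrepresentation. -/
theorem isIrreducible_genRep (hp : 1 ≤ p) (hpn : 2 * p < n) {i : Fin 5}
    (hi : GenOccurs n q p i) : LieModule.IsIrreducible ℂ (soC n) (genRep n q p i) := by
  refine isIrreducible_iff.mpr ⟨fun h => ?_, fun N hN h0 => le_antisymm hN ?_⟩
  · have h1 := genForm_mem_genRep (n := n) (q := q) (p := p) i
    rw [h] at h1
    exact (isGenerator_genForm hp hpn i hi).ne_zero h1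
  · have hle := hN.trans (genRep_le_harmonicRep hp hpn hi)
    have := finiteDimensional_of_le hle
    obtain ⟨x, hx, hx0, hs⟩ := exists_isSingular N h0
    obtain ⟨c, rfl, -⟩ := hs.eq_smul_of_fischer hp hpn (hle hx) i fun j hj hji =>
      fischer_genRep hp hpn hj hi hji (genForm_mem_genRep j) (hN hx)
    have hc : c ≠ 0 := by
      rintro rfl
      exact hx0 (zero_smul _ _)
    exact genRep_le_iff.mpr ((N.toSubmodule.smul_mem_iff hc).mp hx)

theorem isIrreducibleOfWeight_genRep (hp : 1 ≤ p) (hpn : 2 * p < n) {i : Fin 5}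
    (hi : GenOccurs n q p i) : IsIrreducibleOfWeight (genWeight n q p i) (genRep n q p i) := by
  have g := isGenerator_genForm hp hpn i hi
  exact ⟨isIrreducible_genRep hp hpn hi, genForm n q p i, genForm_mem_genRep i,
    isHighestWeightVector_iff.mpr ⟨g.ne_zero, g.weight, g.singular⟩⟩

/-- The highest weight vector of `W` is orthogonal to the generators of other weights, hence a
multiple of `genForm`. Assuming only `GenShape` also covers weights that do not occur: there the
multiple would have to be zero. -/
theorem IsIrreducibleOfWeight.eq_genRep (hp : 1 ≤ p) (hpn : 2 * p < n) {i : Fin 5}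
    (hi : GenShape n p i) {W : LieSubmodule ℂ (soC n) (FormPoly n)}
    (hW : W ≤ harmonicRep n q p) (h : IsIrreducibleOfWeight (genWeight n q p i) W) :
    GenOccurs n q p i ∧ W = genRep n q p i := by
  obtain ⟨h1, v, hv, h2⟩ := h
  obtain ⟨h3, h4, h5⟩ := isHighestWeightVector_iff.mp h2
  obtain ⟨c, rfl, hc0⟩ := h5.eq_smul_of_fischer hp hpn (hW hv) i fun j hj hji =>
    fischer_eq_zero_of_weight (fun h => hji (genWeight_injective hp hpn hj.shape hi h))
      (isGenerator_genForm hp hpn j hj).weight h4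
  have hc : c ≠ 0 := by
    rintro rfl
    exact h3 (zero_smul _ _)
  have hi' : GenOccurs n q p i := by
    by_contra h6
    exact hc (hc0 h6)
  refine ⟨hi', ((isIrreducible_iff.mp h1).2 _ ?_ ?_).symm⟩
  · exact genRep_le_iff.mpr ((W.toSubmodule.smul_mem_iff hc).mp hv)
  · exact (isIrreducible_iff.mp (isIrreducible_genRep hp hpn hi')).1

theorem component_eq_genRep (hp : 1 ≤ p) (hpn : 2 * p < n) {i : Fin 5}
    (hi : GenOccurs n q p i) : component n q p (genWeight n q p i) = genRep n q p i := by
  refine le_antisymm (sSup_le ?_) (le_sSup ?_)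
  · rintro W ⟨h1, h2⟩
    exact (h2.eq_genRep hp hpn hi.shape h1).2.le
  · exact ⟨genRep_le_harmonicRep hp hpn hi, isIrreducibleOfWeight_genRep hp hpn hi⟩

theorem component_eq_bot (hp : 1 ≤ p) (hpn : 2 * p < n) {i : Fin 5} (hs : GenShape n p i)
    (hi : ¬ GenOccurs n q p i) : component n q p (genWeight n q p i) = ⊥ := by
  refine eq_bot_iff.mpr (sSup_le ?_)
  rintro W ⟨h1, h2⟩
  exact absurd (h2.eq_genRep hp hpn hs h1).1 hi

/-- The eigenvalue of `E` on a component. -/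
theorem opE_of_mem_component (hp : 1 ≤ p) (hpn : 2 * p < n) {i : Fin 5} (hs : GenShape n p i)
    {φ : FormPoly n} (hφ : φ ∈ component n q p (genWeight n q p i)) :
    opE n φ = genValue n q p i • φ := by
  by_cases hi : GenOccurs n q p i
  · rw [component_eq_genRep hp hpn hi] at hφ
    have h1 : genRep n q p i ≤ isInvariant_opE.eigenspace (genValue n q p i) :=
      genRep_le_iff.mpr ((isInvariant_opE.mem_eigenspace).mpr
        (isGenerator_genForm hp hpn i hi).eigen)
    exact (isInvariant_opE.mem_eigenspace).mp (h1 hφ)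
  · rw [component_eq_bot hp hpn hs hi] at hφ
    rw [show φ = 0 from hφ, map_zero, smul_zero]

/-- The generated subrepresentations exhaust `H^q ⊗ Λ^p`. -/
theorem iSup_genRep (hp : 1 ≤ p) (hpn : 2 * p < n) :
    ⨆ i : {i // GenOccurs n q p i}, genRep n q p i = harmonicRep n q p := by
  set S := ⨆ i : {i // GenOccurs n q p i}, genRep n q p i
  have hle : S ≤ harmonicRep n q p := iSup_le fun i => genRep_le_harmonicRep hp hpn i.2
  refine le_antisymm hle ?_
  -- A singular vector of the complement would be a combination of generators, hence lie in `S` and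
  -- be orthogonal to itself.
  have h0 : harmonicRep n q p ⊓ orthogonal S = ⊥ := by
    by_contra h0
    have := finiteDimensional_of_le (inf_le_left : harmonicRep n q p ⊓ orthogonal S ≤ _)
    obtain ⟨x, hx, hx0, hs⟩ := exists_isSingular _ h0
    obtain ⟨t, ht, ht1⟩ := hs.eq_sum hp hpn hx.1
    have hxS : x ∈ S := by
      rw [ht]
      refine sum_mem fun i _ => ?_
      by_cases hi : GenOccurs n q p i
      · exact S.toSubmodule.smul_mem _ (le_iSup (fun i : {i // GenOccurs n q p i} =>
          genRep n q p i) ⟨i, hi⟩ (genForm_mem_genRep i))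
      · rw [ht1 i hi, zero_smul]
        exact zero_mem _
    exact hx0 (eq_zero_of_fischer_self (hx.2 x hxS))
  intro x hx
  have := finiteDimensional_of_le hle
  obtain ⟨w, hw, h1⟩ := exists_fischer_projection S.toSubmodule x
  have h2 : x - w ∈ harmonicRep n q p ⊓ orthogonal S := ⟨sub_mem hx (hle hw), h1⟩
  rw [h0] at h2
  rw [sub_eq_zero.mp (show x - w = 0 from h2)]
  exact hw

theorem iSupIndep_genRep (hp : 1 ≤ p) (hpn : 2 * p < n) :
    iSupIndep fun i : {i // GenOccurs n q p i} => genRep n q p i := by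
  intro i
  rw [← LieSubmodule.disjoint_toSubmodule, Submodule.disjoint_def]
  intro x hx hx2
  have h1 : (⨆ j : {i // GenOccurs n q p i}, ⨆ _ : j ≠ i, genRep n q p j) ≤
      orthogonal (genRep n q p i) := iSup₂_le fun j hj y hy w hw =>
    fischer_genRep hp hpn i.2 j.2 (fun h => hj (Subtype.ext h).symm) hw hy
  exact eq_zero_of_fischer_self (h1 hx2 x hx)

/-- So `E` detects every piece except `V_{μ₀}`, which bounds the common kernel of `d` and `d^*` from
above. -/
theorem genValue_ne_zero (hp : 1 ≤ p) (hpn : 2 * p < n) {i : Fin 5} (hi : GenOccurs n q p i)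
    (h0 : i ≠ 0) : genValue n q p i ≠ 0 := by
  have h1 : 1 ≤ q := by
    match i, hi, h0 with
    | 1, hi, _ => exact hi
    | 2, hi, _ => exact hi.1
    | 3, hi, _ => exact hi.1
    | 4, hi, _ => rcases hi with h | h <;> omega
  have h2 : (q : ℂ) + p ≠ 0 := by exact_mod_cast (by omega : q + p ≠ 0)
  match i, h0 with
  | 1, _ => exact h2
  | 2, _ => exact h2
  | 3, _ =>
    have : ((n + q - p : ℕ) : ℂ) ≠ 0 := by exact_mod_cast (by omega : n + q - p ≠ 0)
    rwa [Nat.cast_sub (by omega), Nat.cast_add] at this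
  | 4, _ =>
    have : ((n + 2 * q - 2 : ℕ) : ℂ) ≠ 0 := by exact_mod_cast (by omega : n + 2 * q - 2 ≠ 0)
    rw [Nat.cast_sub (by omega)] at this
    push_cast at this
    exact this

/-- `V_{μ₀}` is the space of closed and coclosed forms. -/
theorem genRep_zero_eq (hp : 1 ≤ p) (hpn : 2 * p < n) : (genRep n q p 0).toSubmodule =
    harmonicForms n q p ⊓ (LinearMap.ker (extD n) ⊓ LinearMap.ker (coD n)) := by
  have hb := isBaseForm_chain_one (n := n) (by omega) q hp
  refine le_antisymm ?_ ?_
  · refine le_inf (genRep_le_harmonicRep hp hpn (i := 0) trivial) (le_inf ?_ ?_)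
    · have h1 : genRep n q p 0 ≤ isInvariant_extD.eigenspace 0 :=
        genRep_le_iff.mpr (isInvariant_extD.mem_eigenspace.mpr (by rw [zero_smul]; exact hb.extD))
      intro x hx
      have h2 := isInvariant_extD.mem_eigenspace.mp (h1 hx)
      rwa [zero_smul] at h2
    · have h1 : genRep n q p 0 ≤ isInvariant_coD.eigenspace 0 :=
        genRep_le_iff.mpr (isInvariant_coD.mem_eigenspace.mpr (by rw [zero_smul]; exact hb.coD))
      intro x hx
      have h2 := isInvariant_coD.mem_eigenspace.mp (h1 hx)
      rwa [zero_smul] at h2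
  · rintro x ⟨hx, hd, hd'⟩
    have hE : opE n x = 0 := by
      rw [opE_apply, LinearMap.mem_ker.mp hd, LinearMap.mem_ker.mp hd', map_zero, map_zero,
        sub_zero]
    have hx' : x ∈ harmonicRep n q p := hx
    rw [← iSup_genRep hp hpn] at hx'
    have h1 : x ∈ ⨆ i : {i // GenOccurs n q p i}, (genRep n q p i).toSubmodule := by
      rwa [← LieSubmodule.iSup_toSubmodule]
    obtain ⟨f, hf, hsum⟩ := (Submodule.mem_iSup_iff_exists_finsupp _ _).mp h1
    have h2 : ∀ j : {i // GenOccurs n q p i}, f j ∈ genRep n q p j := hf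
    have h3 : ∀ j : {i // GenOccurs n q p i}, opE n (f j) = genValue n q p j • f j := fun j =>
      opE_of_mem_component hp hpn j.2.shape (by rw [component_eq_genRep hp hpn j.2]; exact h2 j)
    rw [← hsum]
    refine Submodule.sum_mem _ fun j hj => ?_
    rcases eq_or_ne (j : Fin 5) 0 with h0 | h0
    · rw [← h0]
      exact h2 j
    · refine absurd ?_ (Finsupp.mem_support_iff.mp hj)
      -- Pairing `E x = 0` with the component `f j` leaves the eigenvalue times `‖f j‖²`, by
      -- orthogonality of the pieces.
      have h4 := congrArg (fischer n (f j)) hE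
      rw [← hsum, Finsupp.sum, map_sum, map_sum, map_zero, Finset.sum_eq_single j, h3, map_smul,
        smul_eq_mul, mul_eq_zero] at h4
      · exact eq_zero_of_fischer_self (h4.resolve_left (genValue_ne_zero hp hpn j.2 h0))
      · intro k _ hkj
        rw [h3, map_smul, fischer_genRep hp hpn j.2 k.2 (fun h => hkj (Subtype.ext h).symm)
          (h2 j) (h2 k), smul_zero]
      · exact fun hj' => absurd hj hj'

end

end PFormHarmonic

end

/-! ### Assembly of the theorem. -/

open PFormHarmonic in
theorem mainTheorem6 (n p q : ℕ) (hp : 1 ≤ p) (hpn : 2 * p < n) :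
    -- the irreducible decomposition of `H^q ⊗ Λ^p`
    (∀ μ ∈ constituents n q p, IsIrreducibleOfWeight μ (component n q p μ)) ∧
    iSupIndep (fun μ : constituents n q p => component n q p μ) ∧
    (⨆ μ : constituents n q p, component n q p μ).toSubmodule = harmonicForms n q p ∧
    -- the eigenvalues of `E`
    (∀ φ ∈ component n q p (mu0 n q p), opE n φ = 0) ∧
    (∀ φ ∈ component n q p (mu1 n q p), opE n φ = ((q : ℂ) + p) • φ) ∧
    (n = 2 * p + 2 →
      ∀ φ ∈ component n q p (mu1' n q p), opE n φ = ((q : ℂ) + p) • φ) ∧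
    (2 ≤ p → ∀ φ ∈ component n q p (mu2 n q p), opE n φ = ((n : ℂ) + q - p) • φ) ∧
    (∀ φ ∈ component n q p (mu3 n q p), opE n φ = ((n : ℂ) + 2 * q - 2) • φ) ∧
    -- the top component
    (component n q p (mu0 n q p)).toSubmodule =
      harmonicForms n q p ⊓ (LinearMap.ker (extD n) ⊓ LinearMap.ker (coD n)) := by
  -- The pieces were indexed by the five cases. Independence and the supremum are carried to the set
  -- of weights along this map.
  let e : {i // GenOccurs n q p i} → constituents n q p := fun i =>
    ⟨genWeight n q p i, mem_constituents_iff.mpr ⟨i, i.2, rfl⟩⟩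
  have he : Function.Bijective e := by
    refine ⟨fun i j h => Subtype.ext ?_, fun μ => ?_⟩
    · exact genWeight_injective hp hpn i.2.shape j.2.shape (congrArg Subtype.val h)
    · obtain ⟨i, hi, hμ⟩ := mem_constituents_iff.mp μ.2
      exact ⟨⟨i, hi⟩, Subtype.ext hμ.symm⟩
  have hc : (fun i => component n q p (e i)) =
      fun i : {i // GenOccurs n q p i} => genRep n q p i :=
    funext fun i => component_eq_genRep hp hpn i.2
  refine ⟨?_, ?_, ?_, ?_, ?_, ?_, ?_, ?_, ?_⟩
  · intro μ hμ
    obtain ⟨i, hi, rfl⟩ := mem_constituents_iff.mp hμ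
    rw [component_eq_genRep hp hpn hi]
    exact isIrreducibleOfWeight_genRep hp hpn hi
  · refine iSupIndep.comp' (f := e) ?_ he.surjective
    rw [Function.comp_def, hc]
    exact iSupIndep_genRep hp hpn
  · rw [← he.surjective.iSup_comp fun μ : constituents n q p => component n q p μ, hc,
      iSup_genRep hp hpn]
    rfl
  · intro φ hφ
    rw [opE_of_mem_component hp hpn (i := 0) trivial hφ]
    exact zero_smul _ _
  · exact fun φ hφ => opE_of_mem_component hp hpn (i := 1) trivial hφ
  · exact fun hn φ hφ => opE_of_mem_component hp hpn (i := 2) hn hφ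
  · exact fun h2 φ hφ => opE_of_mem_component hp hpn (i := 3) h2 hφ
  · exact fun φ hφ => opE_of_mem_component hp hpn (i := 4) trivial hφ
  · have h0 : component n q p (mu0 n q p) = genRep n q p 0 :=
      component_eq_genRep hp hpn (i := 0) trivial
    rw [h0, genRep_zero_eq hp hpn]
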